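/- **Notation.** Write $e_1,\dots,e_n$ for the standard basis of $\mathbb{Z}^n$. An *elliptic net* is a map $W:\mathbb{Z}^n\to\mathbb{R}$ with $W(0)=0$ and $$W(p+q+s)W(p-q)W(r+s)W(r)+W(q+r+s)W(q-r)W(p+s)W(p)+W(r+p+s)W(r-p)W(q+s)W(q)=0$$ for all $p,q,r,s\in\mathbb{Z}^n$. It is *non-degenerate* if $W(e_i),W(2e_i)\ne0$ for all $i$, $W(e_i\pm e_j)\ne 0$ for all $i\neq j$, and, when $n=1$, also $W(3e_1)\neq0$. A function $f:\mathbb{Z}^n\to\mathbb{R}^*$ is a *quadratic form* if $$f(a+b+c)f(a+b)^{-1}f(b+c)^{-1}f(c+a)^{-1}f(a)f(b)f(c)=1$$ for all $a,b,c\in\mathbb{Z}^n$. Let $E: y^2+a_1xy+a_3y=x^3+a_2x^2+a_4x+a_6$ be an elliptic curve over $\mathbb{R}$, with period lattice $\Lambda\subset\mathbb{C}$ (that is, $g_2(\Lambda)=c_4/12$ and $g_3(\Lambda)=c_6/216$). Let $\mathbf P=(P_1,\dots,P_n)$ be points of $E(\mathbb{R})$ with $P_i\ne\mathcal O$ for all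 $i$ and $P_i\pm P_j\neq\mathcal O$ for $i<j$. Let $z_i\in\mathbb{C}$ correspond to $P_i$ under $\mathbb{C}/\Lambda\cong E(\mathbb{C})$, $z\mapsto(x,y)$, where $x+\frac{b_2}{12}=\wp(z)$ and $2y+a_1x+a_3=\wp'(z)$. The *net associated to* $E$ and $\mathbf P$ is $$\Psi_v(\mathbf P;E)=(-1)^{\sum_i v_i^2-\sum_{i<j}v_iv_j-1}\,\frac{\sigma(v_1z_1+\dots+v_nz_n;\Lambda)}{\prod_i\sigma(z_i;\Lambda)^{2v_i^2-\sum_j v_iv_j}\prod_{i<j}\sigma(z_i+z_j;\Lambda)^{v_iv_j}},\qquad v\in\mathbb{Z}^n .$$ The pair $(E,\mathbf P)$ is *associated to* an elliptic net $W:\mathbb{Z}^n\to\mathbb{R}$ if $W(v)=f(v)\Psi_v(\mathbf P;E)$ for all $v$, for some quadratic form $f:\mathbb{Z}^n\to\mathbb{R}^*$. The net $W$ is *non-singular* if it has an associated pair $(E,\mathbf P)$ with $E$ an elliptic curve. For real $q$ with $0<|q|<1$ put $s_k(q)=\sum_{m\ge1}\frac{m^kq^m}{1-q^m}$ and $$E_q:\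 y^2+xy=x^3-5s_3(q)\,x-\tfrac{5}{12}s_3(q)-\tfrac{7}{12}s_5(q),$$ with the parametrization $\phi:\mathbb{R}^*/q^{\mathbb{Z}}\to E_q(\mathbb{R})$ given, for $u\notin q^{\mathbb Z}$, by $$\phi(u)=\Big(\sum_{m\in\mathbb{Z}}\tfrac{q^mu}{(1-q^mu)^2}-2s_1(q),\ \sum_{m\in\mathbb{Z}}\tfrac{(q^mu)^2}{(1-q^mu)^3}+s_1(q)\Big).$$ *Normalized parameters* of $(E,\mathbf P)$ are real numbers $q,u_1,\dots,u_n$ with $0<|q|<1$ such that some isomorphism $E_q\to E$ over $\mathbb{R}$ maps $\phi(u_i)$ to $P_i$ for every $i$, and such that $q<|u_i|<1$ for all $i$ if $q>0$, and $q^2<u_i<1$ for all $i$ if $q<0$. Put $\beta_i=\log_q|u_i|$ if $q>0$ and $\beta_i=\tfrac12\log_{|q|}u_i$ if $q<0$. For real $x\neq0$ let $\mathrm{Parity}[x]\in\mathbb{Z}/2\mathbb{Z}$ be $0$ if $x>0$ and $1$ if $x<0$. **Theorem.** Let $W:\mathbb{Z}^n\to\mathbb{R}$ be a non-singular, non-degenerate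 elliptic net with $W(v)\neq0$ for all $v\neq0$. Then there are an elliptic curve $E/\mathbb{R}$ and points $\mathbf P$ on it associated to $W$ that have normalized parameters $q,u_1,\dots,u_n$. Moreover, for every $(E,\mathbf P)$ associated to $W$ and all normalized parameters $q,u_1,\dots,u_n$ of it, the numbers $\beta_1,\dots,\beta_n$ are irrational, and there are a quadratic form $g:\mathbb{Z}^n\to\mathbb{R}^*$ and a choice of $W'=gW$ or $W'=-gW$ such that the following hold for all $v\neq0$. * If $u_1,\dots,u_n>0$, then $$\mathrm{Parity}[W'(v)]\equiv\Big\lfloor\sum_{i=1}^nv_i\beta_i\Big\rfloor\pmod2.$$ * If $0\le k\le n$, $u_1,\dots,u_k<0$ and $u_{k+1},\dots,u_n>0$, then $$\mathrm{Parity}[W'(v)]\equiv\begin{cases}\displaystyle\Big\lfloor\sum_{i=1}^nv_i\beta_i\Big\rfloor+\sum_{i=1}^k\Big\lfloor\frac{v_i}2\Big\rfloor\pmod2&\text{if }\sum_{i=1}^kv_i\text{ is even},\\[2mm]\displaystyle\sum_{i=1}^k\Big\lfloor\frac{v_i}2\Big\rfloor\pmod2&\text{if }\sum_{i=1}^kv_i\text{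 is odd}.\end{cases}$$ -/

import Mathlib

noncomputable section

namespace EllipticNetSigns

/-! ### Elliptic nets -/

/-- `W : ℤⁿ → R` is an elliptic net. -/
def IsNet {n : ℕ} {R : Type*} [CommRing R] (W : (Fin n → ℤ) → R) : Prop :=
  W 0 = 0 ∧ ∀ p q r s : Fin n → ℤ,
    W (p + q + s) * W (p - q) * W (r + s) * W r
      + W (q + r + s) * W (q - r) * W (p + s) * W p
      + W (r + p + s) * W (r - p) * W (q + s) * W q = 0

/-- The standard basis vector `eᵢ` of `ℤⁿ`. -/
def stdVec {n : ℕ} (i : Fin n) : Fin n → ℤ := Pi.single i 1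

/-- Non-degeneracy of a net on `ℤⁿ`. -/
def IsNondegenerate {n : ℕ} {R : Type*} [CommRing R] (W : (Fin n → ℤ) → R) : Prop :=
  (∀ i, W (stdVec i) ≠ 0 ∧ W ((2 : ℤ) • stdVec i) ≠ 0) ∧
  (∀ i j, i ≠ j → W (stdVec i + stdVec j) ≠ 0 ∧ W (stdVec i - stdVec j) ≠ 0) ∧
  (n = 1 → ∀ i, W ((3 : ℤ) • stdVec i) ≠ 0)

/-- A (multiplicative) quadratic form `f : ℤⁿ → ℝ*`. -/
def IsQuadraticForm {n : ℕ} (f : (Fin n → ℤ) → ℝˣ) : Prop :=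
  ∀ a b c : Fin n → ℤ,
    f (a + b + c) * (f (a + b))⁻¹ * (f (b + c))⁻¹ * (f (c + a))⁻¹ * f a * f b * f c = 1

/-! ### The complex-analytic net of an elliptic curve and points on it -/

/-- The Weierstrass `σ`-function of the lattice spanned by the period pair `L`. -/
def sigma (L : PeriodPair) (z : ℂ) : ℂ :=
  z * ∏' ω : {ω : L.lattice // ω ≠ 0},
    (1 - z / (ω.1 : ℂ)) * Complex.exp (z / (ω.1 : ℂ) + (1 / 2) * (z / (ω.1 : ℂ)) ^ 2)

/-- The exponent `∑ vᵢ² - ∑_{i<j} vᵢ vⱼ - 1`. -/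
def signExponent {n : ℕ} (v : Fin n → ℤ) : ℤ :=
  ∑ i, v i ^ 2 - ∑ i, ∑ j ∈ Finset.Ioi i, v i * v j - 1

/-- The function `Ω_v(z; Λ)`, where `Λ` is the lattice of `L`. -/
def Omega {n : ℕ} (L : PeriodPair) (z : Fin n → ℂ) (v : Fin n → ℤ) : ℂ :=
  (-1) ^ signExponent v * sigma L (∑ i, (v i : ℂ) * z i) /
    ((∏ i, sigma L (z i) ^ (2 * v i ^ 2 - ∑ j, v i * v j)) *
      ∏ i, ∏ j ∈ Finset.Ioi i, sigma L (z i + z j) ^ (v i * v j))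

/-- The lattice of `L` is the period lattice of `E`. Completing the square and shifting,
`X = x + b₂/12`, `Y = 2y + a₁x + a₃`, turns the Weierstrass equation of `E` into
`Y² = 4X³ - (c₄/12) X - c₆/216`. -/
def IsPeriodLattice (E : WeierstrassCurve ℝ) (L : PeriodPair) : Prop :=
  L.g₂ = (E.c₄ : ℂ) / 12 ∧ L.g₃ = (E.c₆ : ℂ) / 216

/-- The real point `P` of `E` corresponds to the class of `z` under `ℂ/Λ ≅ E(ℂ)`, that is,
`(x + b₂/12, 2y + a₁x + a₃) = (℘(z), ℘'(z))`. -/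
def CorrespondsTo (E : WeierstrassCurve ℝ) (L : PeriodPair) (z : ℂ) : E.toAffine.Point → Prop
  | .zero => z ∈ L.lattice
  | .some x y _ => z ∉ L.lattice ∧
      (x : ℂ) = L.weierstrassP z - (E.b₂ : ℂ) / 12 ∧
      (y : ℂ) = (L.derivWeierstrassP z - (E.a₁ : ℂ) * x - (E.a₃ : ℂ)) / 2

/-- `(E, P)` is a curve-points pair associated with the net `W`: up to a quadratic form, `W` is
the net `Ψ(P; E)`. (`Ψ(P; E)` takes the value `1` at all `eᵢ` and `eᵢ + eⱼ`, `i < j`, so it is then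
the normalization of `W`.) -/
def IsAssociated {n : ℕ} (W : (Fin n → ℤ) → ℝ) (E : WeierstrassCurve ℝ)
    (P : Fin n → E.toAffine.Point) : Prop :=
  E.IsElliptic ∧ (∀ i, P i ≠ 0) ∧ (∀ i j, i < j → P i + P j ≠ 0 ∧ P i - P j ≠ 0) ∧
  ∃ (L : PeriodPair) (z : Fin n → ℂ) (f : (Fin n → ℤ) → ℝˣ),
    IsPeriodLattice E L ∧ (∀ i, CorrespondsTo E L (z i) (P i)) ∧ IsQuadraticForm f ∧
    ∀ v, (W v : ℂ) = ((f v : ℝ) : ℂ) * Omega L z v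

/-- `W` is non-singular: the cubic of an associated curve-points pair is an elliptic curve. -/
def IsNonsingular {n : ℕ} (W : (Fin n → ℤ) → ℝ) : Prop :=
  ∃ (E : WeierstrassCurve ℝ) (P : Fin n → E.toAffine.Point), IsAssociated W E P

/-! ### The real Tate parametrization `ℝ*/q^ℤ ≅ E(ℝ)` -/

/-- `s_k(q) = ∑_{m ≥ 1} m^k q^m / (1 - q^m)`. -/
def tateS (k : ℕ) (q : ℝ) : ℝ := ∑' m : ℕ+, (m : ℝ) ^ k * q ^ (m : ℕ) / (1 - q ^ (m : ℕ))

/-- The curve `E_q : y² + xy = x³ + a₄(q) x + a₆(q)`. -/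
def tateCurve (q : ℝ) : WeierstrassCurve ℝ where
  a₁ := 1
  a₂ := 0
  a₃ := 0
  a₄ := -5 * tateS 3 q
  a₆ := -(5 / 12) * tateS 3 q - (7 / 12) * tateS 5 q

/-- The `x`-coordinate of the image of `u` under `φ : ℝ*/q^ℤ → E_q(ℝ)`. -/
def tateX (q u : ℝ) : ℝ := ∑' m : ℤ, q ^ m * u / (1 - q ^ m * u) ^ 2 - 2 * tateS 1 q

/-- The `y`-coordinate of the image of `u` under `φ : ℝ*/q^ℤ → E_q(ℝ)`. -/
def tateY (q u : ℝ) : ℝ := ∑' m : ℤ, (q ^ m * u) ^ 2 / (1 - q ^ m * u) ^ 3 + tateS 1 q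

/-- `q` and `u₁, …, uₙ` are the real number with `E ≅ E_q` over `ℝ` and the normalized real numbers
corresponding to `P₁, …, Pₙ` under `ℝ*/q^ℤ ≅ E_q(ℝ) ≅ E(ℝ)`. A change of variables `C` with
`C • E = E_q` gives the isomorphism `E_q → E`,
`(X, Y) ↦ (C.u² X + C.r, C.u³ Y + C.u² C.s X + C.t)`. -/
def IsTateData {n : ℕ} (E : WeierstrassCurve ℝ) (P : Fin n → E.toAffine.Point)
    (q : ℝ) (u : Fin n → ℝ) : Prop :=
  0 < |q| ∧ |q| < 1 ∧
  (∃ C : WeierstrassCurve.VariableChange ℝ, C • E = tateCurve q ∧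
    ∀ i, ∃ h, P i = WeierstrassCurve.Affine.Point.some
      ((C.u : ℝ) ^ 2 * tateX q (u i) + C.r)
      ((C.u : ℝ) ^ 3 * tateY q (u i) + (C.u : ℝ) ^ 2 * C.s * tateX q (u i) + C.t) h) ∧
  (0 < q → ∀ i, q < |u i| ∧ |u i| < 1) ∧
  (q < 0 → ∀ i, q ^ 2 < u i ∧ u i < 1)

/-- `β = log_q |u|` if `q > 0`, and `β = (1/2) log_{|q|} u` if `q < 0`. -/
def beta (q u : ℝ) : ℝ :=
  if 0 < q then Real.logb q |u| else (1 / 2) * Real.logb |q| u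

/-- The parity in `ℤ/2ℤ` of a non-zero real `x`: `sign x = (-1) ^ parity x`. -/
def parity (x : ℝ) : ZMod 2 := if x < 0 then 1 else 0

/-- The sum of `a i` over the first `k` indices. -/
def sumFirst {n : ℕ} (k : ℕ) (a : Fin n → ℤ) : ℤ :=
  ∑ i ∈ Finset.univ.filter (fun i : Fin n => (i : ℕ) < k), a i

end EllipticNetSigns

end

noncomputable section

namespace EllipticNetSigns

open Filter Topology Complex PeriodPair

/-! ### Locally uniform convergence of products and logarithmic derivatives -/

/-! The net is a theta function in disguise. The real invariants of `E` make its period lattice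
stable under conjugation, so a real homothety carries it to a lattice `2πiℤ + ℓℤ` with `q = e^ℓ`
real (`exists_tatePair_of_conj`). This is the lattice of the Tate curve `E_q`: the q-expansions of
`℘`, `℘'` and the Eisenstein series turn the Tate parametrization into the Weierstrass one
(`tateX_eq`, `tateY_eq`, `g₂_tatePair`, `g₃_tatePair`). To transfer points between the two, a
lattice must be determined by its invariants and a class `z + Λ` by `(℘(z), ℘'(z))`; both follow
from the differential equations of `℘`.

On the Tate lattice, `σ` and the theta product in `e^w` have second logarithmic derivatives that
differ by a constant. Hence `σ(w) = c exp(aw² + bw) θ(e^w)` (`exists_sigma_tatePair_eq`). In the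
formula for the net, the Gaussian factor, the `σ`-denominator and the effect of replacing a
coordinate by a `q^ℤ`-multiple are all quadratic forms in `v`; the sign prefactor is minus one.
Therefore `W(v) = κ F(v) θ(q, ∏ uᵢ^{vᵢ})` with `F` quadratic (`exists_theta_form`), and `κ`, `F` are
real because `W` and `θ` are (`exists_real_form`).

Only the sign of `θ` remains. From `θ(qx) = -x⁻¹ θ(x)` it alternates on the positive axis from one
period to the next, the period being `q` if `q > 0` and `q²` if `q < 0`; this produces the floor of
`∑ vᵢβᵢ`. For `q > 0` and `x < 0` all factors of `θ` are positive, so there the floor is absent. The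
terms `⌊vᵢ/2⌋` come from twisting by the quadratic form `(-1)^{vᵢ(vᵢ-1)/2}` (`exists_sign_twist`). A
rational `βᵢ` would make some nontrivial monomial an integral power of `q`, where `θ` vanishes,
against `W(v) ≠ 0`. -/

theorem hasSumLocallyUniformlyOn_logDeriv {ι : Type*} {U : Set ℂ} (hU : IsOpen U)
    {f : ι → ℂ → ℂ} {F : ℂ → ℂ} (h : HasProdLocallyUniformlyOn f F U)
    (hf : ∀ i, DifferentiableOn ℂ (f i) U) (hf0 : ∀ i, ∀ z ∈ U, f i z ≠ 0)
    (hF0 : ∀ z ∈ U, F z ≠ 0) :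
    HasSumLocallyUniformlyOn (fun i => logDeriv (f i)) (logDeriv F) U := by
  have hd : ∀ s : Finset ι, DifferentiableOn ℂ (fun z => ∏ i ∈ s, f i z) U :=
    fun s => DifferentiableOn.fun_finsetProd fun i _ => hf i
  have h' : TendstoLocallyUniformlyOn (fun (s : Finset ι) z => ∏ i ∈ s, f i z) F atTop U := h
  have hFd : DifferentiableOn ℂ F U := h'.differentiableOn (.of_forall hd) hU
  have key := (h'.deriv (.of_forall hd) hU).div₀ h' (hFd.deriv hU).continuousOn
    hFd.continuousOn hF0
  refine key.congr fun s z hz => ?_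
  have := logDeriv_prod (s := s) (f := f) (x := z) (fun i _ => hf0 i z hz)
    (fun i _ => (hf i).differentiableAt (hU.mem_nhds hz))
  simp only [← this]
  rfl

theorem hasSumLocallyUniformlyOn_deriv {ι : Type*} {U : Set ℂ} (hU : IsOpen U)
    {f : ι → ℂ → ℂ} {F : ℂ → ℂ} (h : HasSumLocallyUniformlyOn f F U)
    (hf : ∀ i, DifferentiableOn ℂ (f i) U) :
    HasSumLocallyUniformlyOn (fun i => deriv (f i)) (deriv F) U := by
  have h' : TendstoLocallyUniformlyOn (fun (s : Finset ι) z => ∑ i ∈ s, f i z) F atTop U := h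
  refine (h'.deriv (.of_forall fun s => DifferentiableOn.fun_sum fun i _ => hf i) hU).congr
    fun s z hz => ?_
  exact deriv_fun_sum fun i _ => (hf i).differentiableAt (hU.mem_nhds hz)

/-- Weierstrass M-test on discs. Finitely many indices may be discarded because the factors of the
`σ`-product are controlled only for periods that are large compared with the radius. -/
theorem hasProdLocallyUniformly_one_add {ι : Type*} {f : ι → ℂ → ℂ}
    (hf : ∀ i, Continuous (f i))
    (hb : ∀ r : ℝ, 0 < r → ∃ u : ι → ℝ, Summable u ∧
      ∀ᶠ i in cofinite, ∀ z : ℂ, ‖z‖ ≤ r → ‖f i z‖ ≤ u i) :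
    HasProdLocallyUniformly (fun i z => 1 + f i z) (fun z => ∏' i, (1 + f i z)) := by
  refine hasProdLocallyUniformly_of_of_forall_exists_nhds fun x => ?_
  obtain ⟨u, hu, hb⟩ := hb (‖x‖ + 1) (by positivity)
  refine ⟨Metric.closedBall 0 (‖x‖ + 1), ?_, ?_⟩
  · exact mem_of_superset (Metric.isOpen_ball.mem_nhds (show x ∈ Metric.ball 0 (‖x‖ + 1) by simp))
      Metric.ball_subset_closedBall
  · refine hu.hasProdUniformlyOn_one_add (isCompact_closedBall _ _) ?_
      fun i => (hf i).continuousOn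
    filter_upwards [hb] with i hi z hz
    exact hi z (by simpa using hz)

theorem tprod_one_add_ne_zero {ι : Type*} {f : ι → ℂ → ℂ}
    (hb : ∀ r : ℝ, 0 < r → ∃ u : ι → ℝ, Summable u ∧
      ∀ᶠ i in cofinite, ∀ z : ℂ, ‖z‖ ≤ r → ‖f i z‖ ≤ u i) {z : ℂ}
    (hz : ∀ i, 1 + f i z ≠ 0) : ∏' i, (1 + f i z) ≠ 0 := by
  obtain ⟨u, hu, hb⟩ := hb (‖z‖ + 1) (by positivity)
  refine tprod_one_add_ne_zero_of_summable hz (hu.of_norm_bounded_eventually ?_)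
  filter_upwards [hb] with i hi
  simpa using hi z (by linarith)

/-- A function whose logarithmic derivative has vanishing second difference is the exponential of a
quadratic polynomial times the comparison function. -/
theorem eq_exp_quadratic_mul {U : Set ℂ} (hU : IsOpen U) (hU' : IsPreconnected U)
    {F G : ℂ → ℂ} (hF : DifferentiableOn ℂ F U) (hG : DifferentiableOn ℂ G U)
    (hF0 : ∀ z ∈ U, F z ≠ 0) (hG0 : ∀ z ∈ U, G z ≠ 0) {κ : ℂ}
    (h : ∀ z ∈ U, deriv (logDeriv F) z = deriv (logDeriv G) z + κ) :
    ∃ b c : ℂ, c ≠ 0 ∧ ∀ z ∈ U, F z = c * exp (κ / 2 * z ^ 2 + b * z) * G z := by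
  rcases U.eq_empty_or_nonempty with rfl | ⟨z₀, hz₀⟩
  · exact ⟨0, 1, one_ne_zero, by simp⟩
  have hda : ∀ {H : ℂ → ℂ}, DifferentiableOn ℂ H U → (∀ z ∈ U, H z ≠ 0) → ∀ z ∈ U,
      DifferentiableAt ℂ (logDeriv H) z := fun {H} hH hH0 z hz =>
    ((hH.deriv hU).div hH hH0).differentiableAt (hU.mem_nhds hz)
  -- First integration: the logarithmic derivatives differ by the linear function `κz + b`.
  have h1 : ∃ b, ∀ z ∈ U, logDeriv F z - logDeriv G z - κ * z = b := by
    obtain ⟨b, hb⟩ := hU.exists_is_const_of_deriv_eq_zero (𝕜 := ℂ) hU'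
      (f := fun z => logDeriv F z - logDeriv G z - κ * z) (fun z hz => by
        exact (((hda hF hF0 z hz).sub (hda hG hG0 z hz)).sub
          (by fun_prop)).differentiableWithinAt) (fun z hz => by
        have : deriv (fun z => logDeriv F z - logDeriv G z - κ * z) z = 0 := by
          have e1 : DifferentiableAt ℂ (fun z => logDeriv F z - logDeriv G z) z :=
            (hda hF hF0 z hz).sub (hda hG hG0 z hz)
          rw [deriv_fun_sub e1 (by fun_prop), deriv_fun_sub (hda hF hF0 z hz) (hda hG hG0 z hz),
            h z hz]
          simp
        simpa using this)
    exact ⟨b, hb⟩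
  obtain ⟨b, hb⟩ := h1
  -- Second integration: dividing `F / G` by the exponential of a primitive of `κz + b` leaves a
  -- constant.
  have h2 : ∃ c, ∀ z ∈ U, F z / G z * exp (-(κ / 2 * z ^ 2 + b * z)) = c := by
    obtain ⟨c, hc⟩ := hU.exists_is_const_of_deriv_eq_zero (𝕜 := ℂ) hU'
      (f := fun z => F z / G z * exp (-(κ / 2 * z ^ 2 + b * z))) (fun z hz => by
        exact DifferentiableWithinAt.mul ((hF z hz).div (hG z hz) (hG0 z hz)) (by fun_prop))
      (fun z hz => by
        have dF := (hF.differentiableAt (hU.mem_nhds hz)).hasDerivAt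
        have dG := (hG.differentiableAt (hU.mem_nhds hz)).hasDerivAt
        have dE : HasDerivAt (fun z : ℂ => exp (-(κ / 2 * z ^ 2 + b * z)))
            (exp (-(κ / 2 * z ^ 2 + b * z)) * -(κ * z + b)) z := by
          have : HasDerivAt (fun z : ℂ => -(κ / 2 * z ^ 2 + b * z)) (-(κ * z + b)) z := by
            have := (((hasDerivAt_id z).pow 2).const_mul (κ / 2)).add ((hasDerivAt_id z).const_mul b)
            convert! this.neg using 1
            simp
            ring
          exact this.cexp
        have := ((dF.div dG (hG0 z hz)).mul dE).deriv
        have h3 := hb z hz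
        simp only [logDeriv_apply] at h3
        have hF1 := hF0 z hz
        have hG1 := hG0 z hz
        refine this.trans ?_
        simp only [Pi.div_apply, Pi.zero_apply]
        generalize exp (-(κ / 2 * z ^ 2 + b * z)) = E
        rw [← h3]
        field_simp
        ring)
    exact ⟨c, hc⟩
  obtain ⟨c, hc⟩ := h2
  refine ⟨b, c, ?_, fun z hz => ?_⟩
  · rw [← hc z₀ hz₀]
    exact mul_ne_zero (div_ne_zero (hF0 _ hz₀) (hG0 _ hz₀)) (exp_ne_zero _)
  · rw [← hc z hz, exp_neg]
    have := exp_ne_zero (κ / 2 * z ^ 2 + b * z)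
    have hG1 := hG0 z hz
    field_simp

/-! ### Dependence on the lattice only, and homogeneity -/

/-- A period pair carries a basis, but the series sees only the lattice. Writing it as a function
`S` of the submodule avoids transporting the sum between two equal index types. -/
theorem weierstrassP_congr {L L' : PeriodPair} (h : L.lattice = L'.lattice) :
    L.weierstrassP = L'.weierstrassP := by
  let S : Submodule ℤ ℂ → ℂ → ℂ := fun M z => ∑' l : M, (1 / (z - l) ^ 2 - 1 / (l : ℂ) ^ 2)
  exact congrArg S h

theorem derivWeierstrassP_congr {L L' : PeriodPair} (h : L.lattice = L'.lattice) :
    L.derivWeierstrassP = L'.derivWeierstrassP := by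
  let S : Submodule ℤ ℂ → ℂ → ℂ := fun M z => -∑' l : M, 2 / (z - l) ^ 3
  exact congrArg S h

theorem G_congr {L L' : PeriodPair} (h : L.lattice = L'.lattice) (n : ℕ) : L.G n = L'.G n := by
  let S : Submodule ℤ ℂ → ℂ := fun M => ∑' l : M, ((l : ℂ) ^ n)⁻¹
  exact congrArg S h

theorem sigma_congr {L L' : PeriodPair} (h : L.lattice = L'.lattice) : sigma L = sigma L' := by
  let S : Submodule ℤ ℂ → ℂ → ℂ := fun M z =>
    z * ∏' ω : {ω : M // ω ≠ 0},
      (1 - z / (ω.1 : ℂ)) * Complex.exp (z / (ω.1 : ℂ) + (1 / 2) * (z / (ω.1 : ℂ)) ^ 2)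
  exact congrArg S h

/-- The period pair `(c ω₁, c ω₂)`. -/
def scale (L : PeriodPair) (c : ℂ) (hc : c ≠ 0) : PeriodPair where
  ω₁ := c * L.ω₁
  ω₂ := c * L.ω₂
  indep := by
    have := L.indep
    rw [LinearIndependent.pair_iff] at this ⊢
    intro s t h
    refine this s t ?_
    simp only [real_smul] at h ⊢
    exact (mul_eq_zero.1 (show c * (s * L.ω₁ + t * L.ω₂) = 0 by linear_combination h)).resolve_left
      hc

theorem mem_scale {L : PeriodPair} {c : ℂ} {hc : c ≠ 0} {z : ℂ} :
    z ∈ (scale L c hc).lattice ↔ z / c ∈ L.lattice := by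
  simp only [PeriodPair.mem_lattice, scale]
  refine exists₂_congr fun m n => ?_
  rw [eq_div_iff hc]
  ring_nf

theorem mul_mem_scale {L : PeriodPair} {c : ℂ} {hc : c ≠ 0} {z : ℂ} :
    c * z ∈ (scale L c hc).lattice ↔ z ∈ L.lattice := by
  rw [mem_scale, mul_div_cancel_left₀ _ hc]

/-- Multiplication by `c` as a bijection of lattices. -/
def scaleEquiv (L : PeriodPair) (c : ℂ) (hc : c ≠ 0) : L.lattice ≃ (scale L c hc).lattice where
  toFun l := ⟨c * l, mul_mem_scale.2 l.2⟩
  invFun l := ⟨l / c, mem_scale.1 l.2⟩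
  left_inv l := by ext; simp [hc]
  right_inv l := by ext; simp [mul_div_cancel₀, hc]

theorem weierstrassP_scale (L : PeriodPair) {c : ℂ} (hc : c ≠ 0) (z : ℂ) :
    (scale L c hc).weierstrassP (c * z) = (c ^ 2)⁻¹ * L.weierstrassP z := by
  rw [weierstrassP, weierstrassP, ← (scaleEquiv L c hc).tsum_eq, ← tsum_mul_left]
  congr 1 with l
  simp only [scaleEquiv, Equiv.coe_fn_mk, ← mul_sub, mul_pow, one_div, mul_inv]

theorem derivWeierstrassP_scale (L : PeriodPair) {c : ℂ} (hc : c ≠ 0) (z : ℂ) :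
    (scale L c hc).derivWeierstrassP (c * z) = (c ^ 3)⁻¹ * L.derivWeierstrassP z := by
  rw [derivWeierstrassP, derivWeierstrassP, ← (scaleEquiv L c hc).tsum_eq, mul_neg,
    ← tsum_mul_left]
  congr 2 with l
  simp only [scaleEquiv, Equiv.coe_fn_mk, ← mul_sub, mul_pow, div_eq_mul_inv, mul_inv]
  ring

theorem G_scale (L : PeriodPair) {c : ℂ} (hc : c ≠ 0) (n : ℕ) :
    (scale L c hc).G n = (c ^ n)⁻¹ * L.G n := by
  rw [G, G, ← (scaleEquiv L c hc).tsum_eq, ← tsum_mul_left]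
  congr 1 with l
  simp only [scaleEquiv, Equiv.coe_fn_mk, mul_pow, mul_inv]

theorem g₂_scale (L : PeriodPair) {c : ℂ} (hc : c ≠ 0) :
    (scale L c hc).g₂ = (c ^ 4)⁻¹ * L.g₂ := by
  rw [g₂, g₂, G_scale]; ring

theorem g₃_scale (L : PeriodPair) {c : ℂ} (hc : c ≠ 0) :
    (scale L c hc).g₃ = (c ^ 6)⁻¹ * L.g₃ := by
  rw [g₃, g₃, G_scale]; ring

theorem sigma_scale (L : PeriodPair) {c : ℂ} (hc : c ≠ 0) (z : ℂ) :
    sigma (scale L c hc) (c * z) = c * sigma L z := by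
  let e : {ω : L.lattice // ω ≠ 0} ≃ {ω : (scale L c hc).lattice // ω ≠ 0} :=
    (scaleEquiv L c hc).subtypeEquiv fun l => by
      rw [not_iff_not, Subtype.ext_iff, Subtype.ext_iff]
      exact (mul_eq_zero_iff_left hc).symm
  rw [sigma, sigma, ← e.tprod_eq, mul_assoc]
  congr 3 with l
  have : c * z / ((e l).1 : ℂ) = z / (l.1 : ℂ) := by
    simp only [e, scaleEquiv, Equiv.subtypeEquiv_apply, Equiv.coe_fn_mk]
    rw [mul_div_mul_left _ _ hc]
  rw [this]

/-- The complex conjugate of a period pair. -/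
def conjPair (L : PeriodPair) : PeriodPair where
  ω₁ := (starRingEnd ℂ) L.ω₁
  ω₂ := (starRingEnd ℂ) L.ω₂
  indep := by
    have := L.indep
    rw [LinearIndependent.pair_iff] at this ⊢
    intro s t h
    refine this s t ?_
    simp only [real_smul] at h ⊢
    have := congrArg (starRingEnd ℂ) h
    simpa using this

theorem mem_conjPair {L : PeriodPair} {z : ℂ} :
    z ∈ (conjPair L).lattice ↔ (starRingEnd ℂ) z ∈ L.lattice := by
  simp only [PeriodPair.mem_lattice, conjPair]
  refine exists₂_congr fun m n => ?_
  rw [← (starRingEnd ℂ).injective.eq_iff]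
  simp

/-- Conjugation as a bijection of lattices. -/
def conjEquiv (L : PeriodPair) : L.lattice ≃ (conjPair L).lattice where
  toFun l := ⟨(starRingEnd ℂ) l, mem_conjPair.2 (by simp)⟩
  invFun l := ⟨(starRingEnd ℂ) l, mem_conjPair.1 l.2⟩
  left_inv l := by ext; simp
  right_inv l := by ext; simp

theorem weierstrassP_conj (L : PeriodPair) (z : ℂ) :
    (conjPair L).weierstrassP ((starRingEnd ℂ) z) = (starRingEnd ℂ) (L.weierstrassP z) := by
  rw [weierstrassP, weierstrassP, ← (conjEquiv L).tsum_eq, Complex.conj_tsum]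
  congr 1 with l
  simp [conjEquiv]

theorem derivWeierstrassP_conj (L : PeriodPair) (z : ℂ) :
    (conjPair L).derivWeierstrassP ((starRingEnd ℂ) z) =
      (starRingEnd ℂ) (L.derivWeierstrassP z) := by
  rw [derivWeierstrassP, derivWeierstrassP, ← (conjEquiv L).tsum_eq, map_neg, Complex.conj_tsum]
  congr 2 with l
  simp [conjEquiv, map_ofNat]

theorem G_conj (L : PeriodPair) (n : ℕ) : (conjPair L).G n = (starRingEnd ℂ) (L.G n) := by
  rw [G, G, ← (conjEquiv L).tsum_eq, Complex.conj_tsum]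
  congr 1 with l
  simp [conjEquiv]

theorem g₂_conj (L : PeriodPair) : (conjPair L).g₂ = (starRingEnd ℂ) L.g₂ := by
  simp [g₂, G_conj, map_ofNat]

theorem g₃_conj (L : PeriodPair) : (conjPair L).g₃ = (starRingEnd ℂ) L.g₃ := by
  simp [g₃, G_conj, map_ofNat]

/-! ### The lattice is determined by its invariants, and `ℂ/Λ → E` is injective -/

theorem countable_lattice (L : PeriodPair) : (L.lattice : Set ℂ).Countable := by
  have : Countable L.lattice := L.latticeEquivProd.toEquiv.countable_iff.2 inferInstance
  exact Set.to_countable _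

theorem isOpen_compl_lattice (L : PeriodPair) : IsOpen (L.lattice : Set ℂ)ᶜ :=
  L.isClosed_lattice.isOpen_compl

theorem isPreconnected_compl_of_countable {s : Set ℂ} (hs : s.Countable) : IsPreconnected sᶜ :=
  (hs.isConnected_compl_of_one_lt_rank (by simp)).isPreconnected

theorem isPreconnected_compl_lattice (L : PeriodPair) : IsPreconnected (L.lattice : Set ℂ)ᶜ :=
  isPreconnected_compl_of_countable (countable_lattice L)

theorem eventually_notMem_lattice (L : PeriodPair) (z : ℂ) : ∀ᶠ w in 𝓝[≠] z, w ∉ L.lattice := by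
  filter_upwards [self_mem_nhdsWithin,
    mem_nhdsWithin_of_mem_nhds (L.compl_lattice_sdiff_singleton_mem_nhds z)] with w hw hw'
  simp_all

theorem tendsto_weierstrassP_cobounded (L : PeriodPair) {l : ℂ} (hl : l ∈ L.lattice) :
    Tendsto L.weierstrassP (𝓝[≠] l) (Bornology.cobounded ℂ) := by
  apply tendsto_cobounded_of_meromorphicOrderAt_neg
  rw [L.order_weierstrassP l hl]
  exact WithTop.coe_lt_zero.2 (by norm_num : (-2 : ℤ) < 0)

theorem analyticAt_weierstrassP {L : PeriodPair} {z : ℂ} (hz : z ∉ L.lattice) :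
    AnalyticAt ℂ L.weierstrassP z :=
  L.analyticOnNhd_weierstrassP z hz

theorem analyticAt_derivWeierstrassP {L : PeriodPair} {z : ℂ} (hz : z ∉ L.lattice) :
    AnalyticAt ℂ L.derivWeierstrassP z :=
  L.analyticOnNhd_derivWeierstrassP z hz

theorem hasDerivAt_weierstrassP {L : PeriodPair} {z : ℂ} (hz : z ∉ L.lattice) :
    HasDerivAt L.weierstrassP (L.derivWeierstrassP z) z := by
  rw [← L.deriv_weierstrassP]
  exact (analyticAt_weierstrassP hz).differentiableAt.hasDerivAt

/-- The left side is unbounded at `l`, whereas the right side would be continuous there if `l + b`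
were not a period. -/
theorem pole_mem_lattice {L L' : PeriodPair} {a b l : ℂ} (hl : l + a ∈ L.lattice)
    (h : ∀ᶠ z in 𝓝[≠] l, L.weierstrassP (z + a) = L'.weierstrassP (z + b)) :
    l + b ∈ L'.lattice := by
  by_contra hb
  have ht : Tendsto (fun z => z + a) (𝓝[≠] l) (𝓝[≠] (l + a)) := by
    refine tendsto_nhdsWithin_of_tendsto_nhds_of_eventually_within _
      (((continuous_add_const a).tendsto l).mono_left nhdsWithin_le_nhds) ?_
    filter_upwards [self_mem_nhdsWithin] with z hz
    simpa using hz
  have h1 : Tendsto (fun z => L'.weierstrassP (z + b)) (𝓝[≠] l) (Bornology.cobounded ℂ) :=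
    ((tendsto_weierstrassP_cobounded L hl).comp ht).congr' h
  have h2 : Tendsto (fun z => L'.weierstrassP (z + b)) (𝓝[≠] l) (𝓝 (L'.weierstrassP (l + b))) :=
    ((analyticAt_weierstrassP hb).continuousAt.tendsto.comp
      ((continuous_add_const b).tendsto l)).mono_left nhdsWithin_le_nhds
  exact h2.not_tendsto (Metric.disjoint_nhds_cobounded _) h1

/-- If two translated `℘`-functions agree near a point, then their pole sets agree. -/
theorem lattice_translate_of_eventuallyEq {L L' : PeriodPair} {a b z₀ : ℂ}
    (h : ∀ᶠ z in 𝓝[≠] z₀, L.weierstrassP (z + a) = L'.weierstrassP (z + b)) {l : ℂ}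
    (hl : l + a ∈ L.lattice) : l + b ∈ L'.lattice := by
  set S : Set ℂ := {z | z + a ∈ L.lattice} ∪ {z | z + b ∈ L'.lattice} with hS
  have hc : S.Countable := by
    refine .union ?_ ?_
    · exact (countable_lattice L).preimage (add_left_injective a)
    · exact (countable_lattice L').preimage (add_left_injective b)
  have hev : ∀ w, ∀ᶠ z in 𝓝[≠] w, z ∉ S := by
    intro w
    have key : ∀ (M : PeriodPair) (c : ℂ), ∀ᶠ z in 𝓝[≠] w, z + c ∉ M.lattice := by
      intro M c
      have ht : Tendsto (fun z => z + c) (𝓝[≠] w) (𝓝[≠] (w + c)) := by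
        refine tendsto_nhdsWithin_of_tendsto_nhds_of_eventually_within _
          (((continuous_add_const c).tendsto w).mono_left nhdsWithin_le_nhds) ?_
        filter_upwards [self_mem_nhdsWithin] with z hz
        simpa using hz
      exact ht.eventually (eventually_notMem_lattice M (w + c))
    filter_upwards [key L a, key L' b] with z h1 h2
    simp [hS, h1, h2]
  have hcl : IsOpen Sᶜ := by
    refine (IsClosed.union ?_ ?_).isOpen_compl
    · exact L.isClosed_lattice.preimage (continuous_add_const a)
    · exact L'.isClosed_lattice.preimage (continuous_add_const b)
  have hf : AnalyticOnNhd ℂ (fun z => L.weierstrassP (z + a)) Sᶜ := fun z hz =>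
    AnalyticAt.comp (f := fun z => z + a) (analyticAt_weierstrassP fun h' => hz (Or.inl h'))
      (by fun_prop)
  have hg : AnalyticOnNhd ℂ (fun z => L'.weierstrassP (z + b)) Sᶜ := fun z hz =>
    AnalyticAt.comp (f := fun z => z + b) (analyticAt_weierstrassP fun h' => hz (Or.inr h'))
      (by fun_prop)
  obtain ⟨z₁, hz₁, hz₁'⟩ :
      ∃ z₁ ∈ Sᶜ, ∀ᶠ z in 𝓝 z₁, L.weierstrassP (z + a) = L'.weierstrassP (z + b) := by
    obtain ⟨z₁, h1, h2⟩ := ((eventually_eventually_nhdsWithin.2 h).and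
      ((hev z₀).and self_mem_nhdsWithin)).exists
    refine ⟨z₁, h2.1, ?_⟩
    rwa [(isOpen_compl_singleton (x := z₀)).nhdsWithin_eq h2.2] at h1
  -- Identity theorem: the complement of the countable set of all possible poles is connected, so
  -- agreement near one point spreads to all of it.
  have heq := hf.eqOn_of_preconnected_of_eventuallyEq hg (isPreconnected_compl_of_countable hc)
    hz₁ hz₁'
  refine pole_mem_lattice hl ?_
  filter_upwards [hev l] with z hz using heq hz

/-- If `℘'` vanished near one point it would vanish off the lattice, making `℘` constant in spite of
its pole at `0`. -/
theorem derivWeierstrassP_frequently_ne_zero {L : PeriodPair} {z : ℂ} (hz : z ∉ L.lattice) :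
    ∀ᶠ w in 𝓝[≠] z, L.derivWeierstrassP w ≠ 0 := by
  refine (analyticAt_derivWeierstrassP hz).eventually_eq_zero_or_eventually_ne_zero.resolve_left
    fun h => ?_
  have h0 : Set.EqOn L.derivWeierstrassP 0 (L.lattice : Set ℂ)ᶜ :=
    L.analyticOnNhd_derivWeierstrassP.eqOn_of_preconnected_of_eventuallyEq
      (fun _ _ => analyticAt_const) (isPreconnected_compl_lattice L) hz h
  obtain ⟨c, hc⟩ := (isOpen_compl_lattice L).exists_is_const_of_deriv_eq_zero (𝕜 := ℂ)
    (isPreconnected_compl_lattice L) L.differentiableOn_weierstrassP (by simpa using h0)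
  have h1 : Tendsto (fun _ : ℂ => c) (𝓝[≠] (0 : ℂ)) (Bornology.cobounded ℂ) := by
    refine (tendsto_weierstrassP_cobounded L L.lattice.zero_mem).congr' ?_
    filter_upwards [eventually_notMem_lattice L 0] with w hw using hc w hw
  exact tendsto_const_nhds.not_tendsto (Metric.disjoint_nhds_cobounded _) h1

/-- Differentiating `℘'² = 4℘³ - g₂℘ - g₃` and cancelling `℘'` gives this away from the zeros of
`℘'`; these are isolated, so continuity covers them. -/
theorem deriv_derivWeierstrassP {L : PeriodPair} {z : ℂ} (hz : z ∉ L.lattice) :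
    deriv L.derivWeierstrassP z = 6 * L.weierstrassP z ^ 2 - L.g₂ / 2 := by
  have hU := isOpen_compl_lattice L
  have key : ∀ w ∉ L.lattice, L.derivWeierstrassP w ≠ 0 →
      deriv L.derivWeierstrassP w = 6 * L.weierstrassP w ^ 2 - L.g₂ / 2 := by
    intro w hw hw0
    have h1 : (fun z => L.derivWeierstrassP z ^ 2) =ᶠ[𝓝 w]
        fun z => 4 * L.weierstrassP z ^ 3 - L.g₂ * L.weierstrassP z - L.g₃ := by
      filter_upwards [hU.mem_nhds hw] with z hz using L.derivWeierstrassP_sq z hz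
    have h2 := ((analyticAt_derivWeierstrassP hw).differentiableAt.hasDerivAt.pow 2).deriv
    have hP := hasDerivAt_weierstrassP hw
    have h3 := ((((hP.pow 3).const_mul 4).sub (hP.const_mul L.g₂)).sub_const L.g₃).deriv
    have h4 := h1.deriv_eq
    have h5 := h2.symm.trans (h4.trans h3)
    have : L.derivWeierstrassP w * (deriv L.derivWeierstrassP w) =
        L.derivWeierstrassP w * (6 * L.weierstrassP w ^ 2 - L.g₂ / 2) := by
      norm_num at h5
      linear_combination h5 / 2
    exact mul_left_cancel₀ hw0 this
  have hl := (analyticAt_derivWeierstrassP hz).deriv.continuousAt.tendsto.mono_left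
    (nhdsWithin_le_nhds (s := {z}ᶜ))
  have hr : Tendsto (fun w => 6 * L.weierstrassP w ^ 2 - L.g₂ / 2) (𝓝[≠] z)
      (𝓝 (6 * L.weierstrassP z ^ 2 - L.g₂ / 2)) := by
    refine Tendsto.mono_left (ContinuousAt.tendsto ?_) nhdsWithin_le_nhds
    have := (analyticAt_weierstrassP hz).continuousAt
    fun_prop
  refine tendsto_nhds_unique_of_eventuallyEq hl hr ?_
  filter_upwards [derivWeierstrassP_frequently_ne_zero hz, eventually_notMem_lattice L z]
    with w h1 h2 using key w h2 h1

/-- Factorization of an analytic germ that is not zero, with its first two derivatives. -/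
theorem exists_factorization {d : ℂ → ℂ} (hd : AnalyticAt ℂ d 0) (h : ¬ ∀ᶠ z in 𝓝 0, d z = 0) :
    ∃ (n : ℕ) (k : ℂ → ℂ), AnalyticAt ℂ k 0 ∧ k 0 ≠ 0 ∧ ∀ᶠ z in 𝓝 0, d z = z ^ n * k z ∧
      z * deriv d z = z ^ n * (n * k z + z * deriv k z) ∧
      z ^ 2 * deriv (deriv d) z = z ^ n * (n * (n - 1) * k z + 2 * n * z * deriv k z
        + z ^ 2 * deriv (deriv k) z) := by
  obtain ⟨k, hk, hk0, hdk⟩ := hd.analyticOrderAt_ne_top.1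
    (fun h' => h (analyticOrderAt_eq_top.1 h'))
  set n := analyticOrderNatAt d 0
  simp only [sub_zero, smul_eq_mul] at hdk
  have aux : ∀ (n : ℕ) (k : ℂ → ℂ), AnalyticAt ℂ k 0 → ∀ᶠ z in 𝓝 0,
      deriv (fun z => z ^ n * k z) z = n * z ^ (n - 1) * k z + z ^ n * deriv k z := by
    intro n k hk
    filter_upwards [hk.eventually_analyticAt] with z hz
    rw [deriv_fun_mul (by fun_prop) hz.differentiableAt]
    simp
  have h1 := hdk.eventuallyEq_nhds.mono fun z hz => hz.deriv_eq
  have h1' : deriv d =ᶠ[𝓝 0] fun z => n * z ^ (n - 1) * k z + z ^ n * deriv k z := by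
    filter_upwards [h1, aux n k hk] with z h1 h2 using h1.trans h2
  refine ⟨n, k, hk, hk0, ?_⟩
  have h2 := h1'.eventuallyEq_nhds.mono fun z hz => hz.deriv_eq
  have a1 := aux (n - 1) k hk
  have a2 := aux n (deriv k) hk.deriv
  filter_upwards [hdk, h1', h2, a1, a2, hk.eventually_analyticAt] with z h0 h1 h2 a1 a2 hz
  refine ⟨h0, ?_, ?_⟩
  · rw [h1]
    rcases n with _ | n
    · simp
    · simp [pow_succ]; ring
  · rw [h2]
    have e1 : DifferentiableAt ℂ (fun z => z ^ (n - 1) * k z) z :=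
      DifferentiableAt.mul (by fun_prop) hz.differentiableAt
    have e2 : DifferentiableAt ℂ (fun z => z ^ n * deriv k z) z :=
      DifferentiableAt.mul (by fun_prop) hz.deriv.differentiableAt
    simp only [mul_assoc] at *
    rw [deriv_fun_add (e1.const_mul _) e2, deriv_const_mul _ e1, a1, a2]
    -- The truncated exponents `n - 1` and `n - 2` are harmless: they occur with coefficients that
    -- vanish exactly when truncation takes place.
    rcases n with _ | _ | n
    · simp
    · simp; ring
    · simp [pow_succ]; ring

/-- Injectivity of `ℂ/Λ → E`, as uniqueness for the second order equation `℘'' = 6℘² - g₂/2`: the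
two translates of `℘` have the same initial data at `0`. If they coincide, so do their poles.
Otherwise let `n` be the order of vanishing of the difference `d`; since `d''` is a holomorphic
multiple of `d`, leading terms give `n(n - 1) = 0`, while the initial data force `n ≥ 2`. -/
theorem sub_mem_lattice_of_weierstrassP_eq {L : PeriodPair} {a b : ℂ} (ha : a ∉ L.lattice)
    (hb : b ∉ L.lattice) (h : L.weierstrassP a = L.weierstrassP b)
    (h' : L.derivWeierstrassP a = L.derivWeierstrassP b) : a - b ∈ L.lattice := by
  set d : ℂ → ℂ := fun z => L.weierstrassP (z + a) - L.weierstrassP (z + b) with hdd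
  have han : ∀ {c}, c ∉ L.lattice → AnalyticAt ℂ (fun z => L.weierstrassP (z + c)) 0 := fun hc =>
    (show AnalyticAt ℂ L.weierstrassP (0 + _) by rw [zero_add]; exact analyticAt_weierstrassP hc).comp
      (f := fun z => z + _) (analyticAt_id.add analyticAt_const)
  have hd : AnalyticAt ℂ d 0 := (han ha).sub (han hb)
  have hev : ∀ {c}, c ∉ L.lattice → ∀ᶠ z in 𝓝 (0 : ℂ), z + c ∉ L.lattice := fun {c} hc =>
    ((continuous_add_const c).tendsto 0).eventually
      ((isOpen_compl_lattice L).mem_nhds (by simpa using hc))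
  have hd1 : ∀ᶠ z in 𝓝 (0 : ℂ), deriv d z =
      L.derivWeierstrassP (z + a) - L.derivWeierstrassP (z + b) := by
    filter_upwards [hev ha, hev hb] with z h1 h2
    exact (((hasDerivAt_weierstrassP h1).comp_add_const z a).sub
      ((hasDerivAt_weierstrassP h2).comp_add_const z b)).deriv
  have hd2 : ∀ᶠ z in 𝓝 (0 : ℂ), deriv (deriv d) z =
      6 * (L.weierstrassP (z + a) + L.weierstrassP (z + b)) * d z := by
    filter_upwards [hev ha, hev hb, eventually_eventually_nhds.2 hd1] with z h1 h2 h3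
    rw [EventuallyEq.deriv_eq h3]
    have e := fun {c} (hc : c ∉ L.lattice) =>
      (analyticAt_derivWeierstrassP hc).differentiableAt.hasDerivAt
    refine (((e h1).comp_add_const z a).sub ((e h2).comp_add_const z b)).deriv.trans ?_
    rw [deriv_derivWeierstrassP h1, deriv_derivWeierstrassP h2]
    simp only [hdd]
    ring
  by_cases hz : ∀ᶠ z in 𝓝 0, d z = 0
  · have := lattice_translate_of_eventuallyEq (L := L) (L' := L) (a := b) (b := a) (z₀ := 0)
      (l := -b) ((hz.filter_mono nhdsWithin_le_nhds).mono fun z hz => (sub_eq_zero.1 hz).symm)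
      (by simp)
    rwa [neg_add_eq_sub] at this
  exfalso
  obtain ⟨n, k, hk, hk0, hfac⟩ := exists_factorization hd hz
  have hlim : Tendsto (fun z => (n * (n - 1) * k z + 2 * n * z * deriv k z
        + z ^ 2 * deriv (deriv k) z) -
        z ^ 2 * (6 * (L.weierstrassP (z + a) + L.weierstrassP (z + b))) * k z) (𝓝[≠] 0)
      (𝓝 ((n * (n - 1) * k 0 + 2 * n * 0 * deriv k 0
        + 0 ^ 2 * deriv (deriv k) 0) -
        0 ^ 2 * (6 * (L.weierstrassP (0 + a) + L.weierstrassP (0 + b))) * k 0)) := by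
    refine Tendsto.mono_left (ContinuousAt.tendsto ?_) nhdsWithin_le_nhds
    have := (han ha).continuousAt
    have := (han hb).continuousAt
    have := hk.continuousAt
    have := hk.deriv.continuousAt
    have := hk.deriv.deriv.continuousAt
    fun_prop
  have hzero : ∀ᶠ z in 𝓝[≠] (0 : ℂ), (n * (n - 1) * k z + 2 * n * z * deriv k z
        + z ^ 2 * deriv (deriv k) z) -
        z ^ 2 * (6 * (L.weierstrassP (z + a) + L.weierstrassP (z + b))) * k z = 0 := by
    filter_upwards [self_mem_nhdsWithin, hfac.filter_mono nhdsWithin_le_nhds,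
      hd2.filter_mono nhdsWithin_le_nhds] with z hz hf h2
    obtain ⟨f0, -, f2⟩ := hf
    rw [h2, f0] at f2
    have : z ^ n ≠ 0 := pow_ne_zero _ hz
    refine mul_left_cancel₀ this ?_
    linear_combination -f2
  have hval := tendsto_nhds_unique (hlim.congr' hzero) tendsto_const_nhds
  have hn : (n : ℂ) * (n - 1) = 0 := by
    have : (n : ℂ) * (n - 1) * k 0 = 0 := by linear_combination hval
    exact (mul_eq_zero.1 this).resolve_right hk0
  have hd0 : d 0 = 0 := by simp [hdd, h]
  have hd0' : deriv d 0 = 0 := by rw [hd1.self_of_nhds]; simp [h']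
  have hcases : n = 0 ∨ n = 1 := by
    rcases mul_eq_zero.1 hn with h | h
    · exact Or.inl (by exact_mod_cast h)
    · exact Or.inr (by exact_mod_cast sub_eq_zero.1 h)
  rcases hcases with rfl | rfl
  · have := hfac.self_of_nhds.1
    simp [hd0] at this
    exact hk0 this.symm
  · have h1 : d =ᶠ[𝓝 0] fun z => z * k z := hfac.mono fun z hz => by simpa using hz.1
    have h2 := h1.deriv_eq
    rw [hd0', deriv_fun_mul (by fun_prop) hk.differentiableAt] at h2
    simp at h2
    exact hk0 h2.symm

/-- Both `℘`-functions satisfy the same first order equation with the same principal part `1/z²`.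
Subtracting the equations gives a linear relation between `d` and `zd'`, where `d` is the difference
of the regular parts. If `d` vanished to finite order `n`, its leading coefficients would give `-4n
= 12`. So `d = 0`, and the poles, that is the lattices, agree. -/
theorem lattice_le_of_invariants_eq {L L' : PeriodPair} (h₂ : L.g₂ = L'.g₂) (h₃ : L.g₃ = L'.g₃) :
    L.lattice ≤ L'.lattice := by
  set f := L.weierstrassPExcept 0 with hfd
  set g := L'.weierstrassPExcept 0 with hgd
  have hf : AnalyticAt ℂ f 0 := L.analyticAt_weierstrassPExcept 0
  have hg : AnalyticAt ℂ g 0 := L'.analyticAt_weierstrassPExcept 0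
  -- `weierstrassPExcept 0` is the part of `℘` regular at `0`.
  have hP : ∀ (M : PeriodPair) (z : ℂ), M.weierstrassP z = M.weierstrassPExcept 0 z + 1 / z ^ 2 :=
    fun M z => by
      have := M.weierstrassPExcept_add 0 z
      simp only [ZeroMemClass.coe_zero, sub_zero] at this
      rw [← this]; norm_num
  have hP' : ∀ M : PeriodPair, ∀ᶠ z in 𝓝[≠] (0 : ℂ), M.derivWeierstrassP z =
      deriv (M.weierstrassPExcept 0) z - 2 / z ^ 3 := fun M => by
    filter_upwards [mem_nhdsWithin_of_mem_nhds (M.compl_lattice_sdiff_singleton_mem_nhds 0)]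
      with z hz
    rw [M.eqOn_deriv_weierstrassPExcept_derivWeierstrassPExcept 0 hz]
    have := M.derivWeierstrassPExcept_sub 0 z
    simp only [ZeroMemClass.coe_zero, sub_zero] at this
    rw [← this]
  set d : ℂ → ℂ := fun z => f z - g z with hdd
  have hd : AnalyticAt ℂ d 0 := hf.sub hg
  have hode : ∀ᶠ z in 𝓝[≠] (0 : ℂ), z * deriv d z * (z ^ 3 * (deriv f z + deriv g z) - 4) =
      d z * (4 * ((z ^ 2 * f z + 1) ^ 2 + (z ^ 2 * f z + 1) * (z ^ 2 * g z + 1)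
        + (z ^ 2 * g z + 1) ^ 2) - L.g₂ * z ^ 4) := by
    filter_upwards [self_mem_nhdsWithin, hP' L, hP' L', eventually_notMem_lattice L 0,
      eventually_notMem_lattice L' 0, hf.eventually_analyticAt.filter_mono nhdsWithin_le_nhds,
      hg.eventually_analyticAt.filter_mono nhdsWithin_le_nhds] with z hz p1 p2 n1 n2 a1 a2
    have hz' : z ≠ 0 := hz
    have e1 := L.derivWeierstrassP_sq z n1
    have e2 := L'.derivWeierstrassP_sq z n2
    rw [p1, hP L] at e1
    rw [p2, hP L', ← h₂, ← h₃] at e2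
    simp only [hdd]
    rw [deriv_fun_sub a1.differentiableAt a2.differentiableAt]
    simp only [← hfd, ← hgd] at e1 e2
    generalize f z = x at *
    generalize g z = y at *
    generalize deriv f z = x' at *
    generalize deriv g z = y' at *
    field_simp at e1 e2
    have : z ^ 2 ≠ 0 := pow_ne_zero _ hz'
    refine mul_left_cancel₀ this ?_
    linear_combination e1 - e2
  by_cases hz : ∀ᶠ z in 𝓝 0, d z = 0
  · intro l hl
    have := lattice_translate_of_eventuallyEq (L := L) (L' := L') (a := 0) (b := 0) (z₀ := 0)
      (l := l) ((hz.filter_mono nhdsWithin_le_nhds).mono fun z hz => by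
        simp only [add_zero, hP]
        rw [show L.weierstrassPExcept 0 z = L'.weierstrassPExcept 0 z from sub_eq_zero.1 hz])
      (by simpa using hl)
    simpa using this
  exfalso
  obtain ⟨n, k, hk, hk0, hfac⟩ := exists_factorization hd hz
  let F : ℂ → ℂ := fun z => (n * k z + z * deriv k z) * (z ^ 3 * (deriv f z + deriv g z) - 4) -
    k z * (4 * ((z ^ 2 * f z + 1) ^ 2 + (z ^ 2 * f z + 1) * (z ^ 2 * g z + 1)
        + (z ^ 2 * g z + 1) ^ 2) - L.g₂ * z ^ 4)
  have hlim : Tendsto F (𝓝[≠] 0) (𝓝 (F 0)) := by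
    refine Tendsto.mono_left (ContinuousAt.tendsto ?_) nhdsWithin_le_nhds
    have := hf.continuousAt
    have := hg.continuousAt
    have := hf.deriv.continuousAt
    have := hg.deriv.continuousAt
    have := hk.continuousAt
    have := hk.deriv.continuousAt
    fun_prop
  have hzero : ∀ᶠ z in 𝓝[≠] (0 : ℂ), F z = 0 := by
    filter_upwards [self_mem_nhdsWithin, hfac.filter_mono nhdsWithin_le_nhds, hode] with z hz hf h2
    obtain ⟨f0, f1, -⟩ := hf
    rw [f1, f0] at h2
    have : z ^ n ≠ 0 := pow_ne_zero _ hz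
    refine mul_left_cancel₀ this ?_
    simp only [F]
    linear_combination h2
  have hval := tendsto_nhds_unique (hlim.congr' hzero) tendsto_const_nhds
  have : ((n : ℂ) + 3) * k 0 = 0 := by
    simp only [F] at hval
    linear_combination -hval / 4
  rcases mul_eq_zero.1 this with h | h
  · norm_cast at h
  · exact hk0 h

theorem lattice_eq_of_invariants_eq {L L' : PeriodPair} (h₂ : L.g₂ = L'.g₂) (h₃ : L.g₃ = L'.g₃) :
    L.lattice = L'.lattice :=
  le_antisymm (lattice_le_of_invariants_eq h₂ h₃) (lattice_le_of_invariants_eq h₂.symm h₃.symm)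

/-! ### The `q`-expansion of `℘` -/

/-- The function `e ^ w / (1 - e ^ w) ^ 2`, the sum of `1 / (w + 2πin) ^ 2` over `n ∈ ℤ`. -/
def expKernel (w : ℂ) : ℂ := exp w / (1 - exp w) ^ 2

theorem expKernel_neg (w : ℂ) : expKernel (-w) = expKernel w := by
  rw [expKernel, expKernel, exp_neg]
  have := exp_ne_zero w
  by_cases h : exp w = 1
  · simp [h]
  have h1 : 1 - exp w ≠ 0 := sub_ne_zero.2 (Ne.symm h)
  have h2 : 1 - (exp w)⁻¹ ≠ 0 := by
    rw [sub_ne_zero, ne_eq, eq_comm, inv_eq_one]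
    exact h
  have h3 : exp w - 1 ≠ 0 := sub_ne_zero.2 h
  field_simp
  ring

theorem integerComplement_div {w : ℂ} (hw : exp w ≠ 1) :
    w / (2 * Real.pi * I) ∈ integerComplement := by
  rw [Complex.mem_integerComplement_iff]
  rintro ⟨n, hn⟩
  apply hw
  rw [exp_eq_one_iff]
  exact ⟨n, by rw [hn]; field_simp⟩

theorem sin_pi_mul_div_sq (w : ℂ) :
    (exp w) * (-4 * sin (Real.pi * (w / (2 * Real.pi * I))) ^ 2) = (1 - exp w) ^ 2 := by
  have h1 : (Real.pi : ℂ) * (w / (2 * Real.pi * I)) = w / (2 * I) := by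
    have : (Real.pi : ℂ) ≠ 0 := by exact_mod_cast Real.pi_ne_zero
    field_simp
  have h2 : w / (2 * I) * I = w / 2 := by field_simp
  have h3 : exp w = exp (w / 2) ^ 2 := by rw [← exp_nat_mul]; congr 1; push_cast; ring
  rw [h1, sin, neg_mul (w / (2 * I)), h2, h3, exp_neg]
  have := exp_ne_zero (w / 2)
  field_simp
  rw [I_sq]
  ring

/-- Obtained by differentiating Euler's sine product logarithmically and then once more; its factors
pair the terms for `n` and `-n`, and the term `n = 0` is added at the end. -/
theorem hasSum_pi_sq_div_sin_sq {z : ℂ} (hz : z ∈ integerComplement) :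
    HasSum (fun n : ℤ => 1 / (z + n) ^ 2) (Real.pi ^ 2 / sin (Real.pi * z) ^ 2) := by
  have hU : IsOpen (integerComplement : Set ℂ) := Complex.isOpen_compl_range_intCast
  have hsin : ∀ z ∈ integerComplement, sin (Real.pi * z) ≠ 0 := fun z hz => sin_pi_mul_ne_zero hz
  have hz0 : ∀ z ∈ integerComplement, z ≠ 0 := fun z hz => integerComplement.ne_zero hz
  have hpi : (Real.pi : ℂ) ≠ 0 := by exact_mod_cast Real.pi_ne_zero
  have h1 := hasSumLocallyUniformlyOn_logDeriv hU HasProdLocallyUniformlyOn_euler_sin_prod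
    (fun i => by fun_prop) (fun i z hz => sineTerm_ne_zero hz i)
    (fun z hz => div_ne_zero (hsin z hz) (mul_ne_zero hpi (hz0 z hz)))
  have h2 := hasSumLocallyUniformlyOn_deriv hU h1 (fun i => by
    have : DifferentiableOn ℂ (fun z : ℂ => 1 + sineTerm z i) integerComplement := by fun_prop
    exact (this.deriv hU).div this (fun z hz => sineTerm_ne_zero hz i))
  have h3 := h2.hasSum hz
  have hne1 : ∀ (n : ℕ), z - (n + 1) ≠ 0 := fun n => by
    simpa [sub_eq_add_neg] using integerComplement_add_ne_zero hz (-(n + 1))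
  have hne2 : ∀ (n : ℕ), z + (n + 1) ≠ 0 := fun n => by
    simpa using integerComplement_add_ne_zero hz (n + 1)
  have e1 : ∀ n : ℕ, deriv (logDeriv fun z => 1 + sineTerm z n) z =
      -(1 / (z + (n + 1)) ^ 2 + 1 / (z - (n + 1)) ^ 2) := by
    intro n
    have : (logDeriv fun z => 1 + sineTerm z n) =ᶠ[𝓝 z] fun z => cotTerm z n := by
      filter_upwards [hU.mem_nhds hz] with y hy using logDeriv_sineTerm_eq_cotTerm hy n
    rw [this.deriv_eq]
    have d1 : HasDerivAt (fun y : ℂ => 1 / (y - (n + 1))) (-1 / (z - (n + 1)) ^ 2) z := by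
      simpa [Pi.inv_def] using ((hasDerivAt_id z).sub_const ((n : ℂ) + 1)).inv (hne1 n)
    have d2 : HasDerivAt (fun y : ℂ => 1 / (y + (n + 1))) (-1 / (z + (n + 1)) ^ 2) z := by
      simpa [Pi.inv_def] using ((hasDerivAt_id z).add_const ((n : ℂ) + 1)).inv (hne2 n)
    refine (d1.add d2).deriv.trans ?_
    ring
  have e2 : deriv (logDeriv fun t : ℂ => sin (Real.pi * t) / (Real.pi * t)) z =
      -(Real.pi ^ 2 / sin (Real.pi * z) ^ 2 - 1 / z ^ 2) := by
    have : (logDeriv fun t : ℂ => sin (Real.pi * t) / (Real.pi * t)) =ᶠ[𝓝 z]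
        fun t => Real.pi * (cos (Real.pi * t) / sin (Real.pi * t)) - 1 / t := by
      filter_upwards [hU.mem_nhds hz] with y hy
      rw [logDeriv_sin_div_eq_cot hy, cot]
    rw [this.deriv_eq]
    have d0 : HasDerivAt (fun t : ℂ => Real.pi * t) Real.pi z := by
      simpa using (hasDerivAt_id z).const_mul (Real.pi : ℂ)
    have d1 : HasDerivAt (fun t : ℂ => 1 / t) (-1 / z ^ 2) z := by
      simpa [Pi.inv_def, id_def] using (hasDerivAt_id z).inv (hz0 z hz)
    have d2 := ((d0.ccos.div d0.csin (hsin z hz)).const_mul (Real.pi : ℂ)).sub d1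
    refine d2.deriv.trans ?_
    have := hsin z hz
    have := hz0 z hz
    field_simp
    linear_combination (-(Real.pi : ℂ) ^ 2 * z ^ 2) * sin_sq_add_cos_sq (Real.pi * z)
  have hs : Summable fun n : ℤ => 1 / (z + n) ^ 2 := by
    have := EisensteinSeries.linear_right_summable z 1 (k := 2) le_rfl
    refine this.congr fun n => ?_
    simp
  have hs1 : Summable fun n : ℕ => 1 / (z + ((n + 1 : ℕ) : ℤ)) ^ 2 :=
    hs.comp_injective (i := fun n : ℕ => ((n + 1 : ℕ) : ℤ)) fun a b h => by simpa using h
  have hs2 : Summable fun n : ℕ => 1 / (z + (-((n + 1 : ℕ) : ℤ) : ℤ)) ^ 2 :=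
    hs.comp_injective (i := fun n : ℕ => (-((n + 1 : ℕ) : ℤ))) fun a b h => by simpa using h
  have h4 := hs1.hasSum.add hs2.hasSum
  have h5 : HasSum (fun n : ℕ => 1 / (z + ((n + 1 : ℕ) : ℤ)) ^ 2 +
      1 / (z + (-((n + 1 : ℕ) : ℤ) : ℤ)) ^ 2) (Real.pi ^ 2 / sin (Real.pi * z) ^ 2 - 1 / z ^ 2) := by
    rw [e2] at h3
    simp only [e1] at h3
    have := h3.neg
    simp only [neg_neg] at this
    refine this.congr_fun fun n => ?_
    push_cast
    ring
  have h6 := h4.unique h5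
  have h7 := HasSum.of_add_one_of_neg_add_one (f := fun n : ℤ => 1 / (z + n) ^ 2)
    (by simpa using hs1.hasSum) (by simpa using hs2.hasSum)
  convert! h7 using 1
  simp at h6 ⊢
  linear_combination -h6

theorem hasSum_expKernel_row {w : ℂ} (hw : exp w ≠ 1) :
    HasSum (fun n : ℤ => 1 / (w + n * (2 * Real.pi * I)) ^ 2) (expKernel w) := by
  have hpi : (Real.pi : ℂ) ≠ 0 := by exact_mod_cast Real.pi_ne_zero
  have h2 : (2 * Real.pi * I : ℂ) ≠ 0 := by simp [hpi]
  have h := (hasSum_pi_sq_div_sin_sq (integerComplement_div hw)).mul_left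
    (1 / (2 * Real.pi * I : ℂ) ^ 2)
  convert! h using 1
  · ext n
    rw [← mul_div_mul_comm, one_mul, ← mul_pow]
    congr 2
    field_simp
  · have h3 := sin_pi_mul_div_sq w
    have h4 := sin_pi_mul_ne_zero (integerComplement_div hw)
    have h5 := exp_ne_zero w
    rw [expKernel, ← h3]
    field_simp
    rw [I_sq]
    ring

/-- This is `2ζ(2)/(2πi)²`; the term `n = 0` contributes `1 / 0 = 0`. -/
theorem hasSum_row_zero :
    HasSum (fun n : ℤ => 1 / (n * (2 * Real.pi * I) : ℂ) ^ 2) (-1 / 12) := by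
  have hpi : (Real.pi : ℂ) ≠ 0 := by exact_mod_cast Real.pi_ne_zero
  have h0 : HasSum (fun n : ℕ => (1 : ℝ) / ((n + 1 : ℕ) : ℝ) ^ 2) (Real.pi ^ 2 / 6) := by
    have := (hasSum_nat_add_iff' (f := fun n : ℕ => (1 : ℝ) / (n : ℝ) ^ 2) 1).2 hasSum_zeta_two
    simpa using this
  have h1 := (Complex.hasSum_ofReal.2 h0).mul_left (1 / (2 * Real.pi * I : ℂ) ^ 2)
  have h2 := HasSum.of_add_one_of_neg_add_one (f := fun n : ℤ => 1 / (n * (2 * Real.pi * I) : ℂ) ^ 2)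
    (h1.congr_fun fun n => by push_cast; field_simp)
    (h1.congr_fun fun n => by push_cast; field_simp)
  convert! h2 using 1
  push_cast
  field_simp
  rw [I_sq]
  norm_num
  ring

/-- The period pair `(2πi, ℓ)`; its lattice is the kernel of `w ↦ e ^ w` modulo powers of `e ^ ℓ`. -/
def tatePair (ℓ : ℂ) (hℓ : ℓ.re < 0) : PeriodPair where
  ω₁ := 2 * Real.pi * I
  ω₂ := ℓ
  indep := by
    rw [LinearIndependent.pair_iff]
    intro s t h
    have hre := congrArg re h
    have him := congrArg im h
    simp at hre him
    have ht : t = 0 := hre.resolve_right hℓ.ne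
    subst ht
    simpa [Real.pi_ne_zero] using him

theorem mem_tatePair {ℓ : ℂ} {hℓ : ℓ.re < 0} {w : ℂ} :
    w ∈ (tatePair ℓ hℓ).lattice ↔ ∃ m : ℤ, exp (m * ℓ + w) = 1 := by
  simp only [PeriodPair.mem_lattice, tatePair, exp_eq_one_iff]
  constructor
  · rintro ⟨m, n, h⟩
    exact ⟨-n, m, by rw [← h]; push_cast; ring⟩
  · rintro ⟨n, m, h⟩
    exact ⟨m, -n, by rw [← h]; push_cast; ring⟩

theorem norm_exp_lt_one {ℓ : ℂ} (hℓ : ℓ.re < 0) : ‖exp ℓ‖ < 1 := by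
  rwa [norm_exp, Real.exp_lt_one_iff]

theorem exp_mul_ne_one {ℓ : ℂ} (hℓ : ℓ.re < 0) {m : ℤ} (hm : m ≠ 0) : exp (m * ℓ) ≠ 1 := by
  intro h
  have := congrArg norm h
  rw [norm_exp, norm_one, Real.exp_eq_one_iff] at this
  simp [hm, hℓ.ne] at this

/-- The sum of `m qᵐ / (1 - qᵐ)` over `m ≥ 1`, for complex `q`. -/
def tateSumOne (q : ℂ) : ℂ := ∑' m : ℕ+, (m : ℂ) * q ^ (m : ℕ) / (1 - q ^ (m : ℕ))

/-- Both series are rearrangements of the absolutely convergent double series of `m q^{dm}` over `d,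
m ≥ 1`: summing over `m` gives `q^d / (1 - q^d)²`, summing over `d` gives `m q^m / (1 - q^m)`. -/
theorem hasSum_geometric_kernel {q : ℂ} (hq : ‖q‖ < 1) :
    HasSum (fun n : ℕ => q ^ (n + 1) / (1 - q ^ (n + 1)) ^ 2) (tateSumOne q) := by
  have hs := summable_prod_mul_pow 1 hq
  have h1 := tsum_pow_div_one_sub_eq_tsum_sigma hq 1
  rw [← tsum_prod_pow_eq_tsum_sigma 1 hq, ← hs.tsum_prod] at h1
  have h2 := hs.hasSum
  rw [← h1] at h2
  have h3 := h2.prod_fiberwise (g := fun d : ℕ+ => q ^ (d : ℕ) / (1 - q ^ (d : ℕ)) ^ 2) fun d => by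
    have hd : ‖q ^ (d : ℕ)‖ < 1 := by
      rw [norm_pow]
      exact pow_lt_one₀ (norm_nonneg _) hq d.ne_zero
    have h := hasSum_coe_mul_geometric_of_norm_lt_one hd
    have h' := (hasSum_nat_add_iff' (f := fun n : ℕ => (n : ℂ) * (q ^ (d : ℕ)) ^ n) 1).2 h
    simp only [Finset.range_one, Finset.sum_singleton, Nat.cast_zero, zero_mul, sub_zero] at h'
    rw [← Equiv.pnatEquivNat.symm.hasSum_iff]
    refine h'.congr_fun fun n => ?_
    simp [Function.comp, pow_mul, Equiv.pnatEquivNat]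
  have h4 := Equiv.pnatEquivNat.symm.hasSum_iff.2 h3
  simpa [Function.comp_def, tateSumOne, Equiv.pnatEquivNat] using h4

/-- The lattice sum for `℘` is evaluated row by row, a row being a translate of `2πiℤ`. The constant
collects the subtracted terms `1/l²`. -/
theorem hasSum_expKernel {ℓ : ℂ} {hℓ : ℓ.re < 0} {w : ℂ} (hw : w ∉ (tatePair ℓ hℓ).lattice) :
    HasSum (fun m : ℤ => expKernel (m * ℓ + w))
      ((tatePair ℓ hℓ).weierstrassP w + (2 * tateSumOne (exp ℓ) - 1 / 12)) := by
  set L := tatePair ℓ hℓ with hL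
  have h1 := L.hasSum_weierstrassP w
  rw [← L.latticeEquivProd.symm.toEquiv.hasSum_iff, ← (Equiv.prodComm ℤ ℤ).hasSum_iff] at h1
  have hcoe : ∀ a b : ℤ, ((L.latticeEquivProd.symm.toEquiv (a, b) : L.lattice) : ℂ) =
      a * (2 * Real.pi * I) + b * ℓ := fun a b => L.latticeEquiv_symm_apply (a, b)
  simp only [Function.comp_def, Equiv.prodComm_apply, Prod.swap, hcoe] at h1
  -- Row sums of `1/l²`. Row `0` contains the origin, whose term is `0` by convention; its sum is
  -- `-1/12`.
  let r : ℤ → ℂ := fun m => if m = 0 then -1 / 12 else expKernel (m * ℓ)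
  have hrow : ∀ m : ℤ, HasSum (fun n : ℤ => 1 / ((n : ℂ) * (2 * Real.pi * I) + m * ℓ) ^ 2)
      (r m) := by
    intro m
    by_cases hm : m = 0
    · subst hm
      simpa [r] using hasSum_row_zero
    · simp only [r, if_neg hm]
      refine (hasSum_expKernel_row (exp_mul_ne_one hℓ hm)).congr_fun fun n => ?_
      rw [add_comm]
  have hw' : ∀ m : ℤ, exp (m * ℓ + w) ≠ 1 := fun m h => hw (mem_tatePair.2 ⟨m, h⟩)
  have h2 := h1.prod_fiberwise (g := fun m : ℤ => expKernel (-m * ℓ + w) - r m) fun m => by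
    refine HasSum.sub ?_ (hrow m)
    have := hasSum_expKernel_row (hw' (-m))
    rw [← (Equiv.neg ℤ).hasSum_iff] at this
    push_cast at this
    refine this.congr_fun fun n => ?_
    simp only [Function.comp, Equiv.neg_apply]
    push_cast
    congr 2
    ring
  have hr : HasSum r (2 * tateSumOne (exp ℓ) - 1 / 12) := by
    have hg := hasSum_geometric_kernel (norm_exp_lt_one hℓ)
    have hk : ∀ n : ℕ, expKernel ((n + 1) * ℓ) = exp ℓ ^ (n + 1) / (1 - exp ℓ ^ (n + 1)) ^ 2 := by
      intro n
      rw [expKernel, ← exp_nat_mul]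
      push_cast
      rfl
    have := HasSum.of_add_one_of_neg_add_one (f := r)
      (hg.congr_fun fun n => by
        simp only [r, if_neg (show ((n : ℤ) + 1) ≠ 0 by omega)]
        push_cast
        exact hk n)
      (hg.congr_fun fun n => by
        simp only [r, if_neg (show (-((n : ℤ) + 1)) ≠ 0 by omega)]
        push_cast
        rw [neg_mul, expKernel_neg]
        exact hk n)
    convert! this using 1
    simp only [r, if_pos]
    ring
  have h3 := h2.add hr
  rw [← (Equiv.neg ℤ).hasSum_iff]
  refine h3.congr_fun fun m => ?_
  simp

/-! ### The invariants of the Tate lattice -/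

theorem tateSum_eq {q : ℝ} (k : ℕ) {ℓ : ℂ} (hℓ : exp ℓ = q) :
    (tateS k q : ℂ) = ∑' m : ℕ+, (m : ℂ) ^ k * (exp ℓ) ^ (m : ℕ) / (1 - (exp ℓ) ^ (m : ℕ)) := by
  rw [tateS, Complex.ofReal_tsum, hℓ]
  push_cast
  rfl

theorem tateSumOne_eq {q : ℝ} {ℓ : ℂ} (hℓ : exp ℓ = q) : tateSumOne (exp ℓ) = tateS 1 q := by
  rw [tateSum_eq 1 hℓ, tateSumOne]
  simp

/-- Scaling by `(2πi)⁻¹` gives the lattice `ℤ + ℤτ` with `τ = ℓ/(2πi)`, which lies in the upper half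
plane because `Re ℓ < 0`; the formula is then the q-expansion of the Eisenstein series. -/
theorem G_tatePair {ℓ : ℂ} (hℓ : ℓ.re < 0) {k : ℕ} (hk : 3 ≤ k) (hk2 : Even k) {q : ℝ}
    (hq : exp ℓ = q) :
    (tatePair ℓ hℓ).G k = ((2 * Real.pi * I) ^ k)⁻¹ * (2 * riemannZeta k) +
      2 / (k - 1).factorial * tateS (k - 1) q := by
  have hpi : (Real.pi : ℂ) ≠ 0 := by exact_mod_cast Real.pi_ne_zero
  have h2 : (2 * Real.pi * I : ℂ) ≠ 0 := by simp [hpi]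
  have him : 0 < (ℓ / (2 * Real.pi * I)).im := by
    have : ℓ / (2 * Real.pi * I) = ((2 * Real.pi)⁻¹ : ℝ) * (-(I * ℓ)) := by
      push_cast
      field_simp
      rw [I_sq]
      ring
    rw [this, im_ofReal_mul]
    have := Real.pi_pos
    refine mul_pos (by positivity) ?_
    simpa using hℓ
  let τ : UpperHalfPlane := ⟨ℓ / (2 * Real.pi * I), him⟩
  have hτ : 2 * Real.pi * I * (τ : ℂ) = ℓ := mul_div_cancel₀ _ h2
  have h := tsum_eisSummand_eq_tsum_sigma_mul_cexp_pow hk hk2 τ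
  rw [hτ, ← tsum_pow_div_one_sub_eq_tsum_sigma (norm_exp_lt_one hℓ), ← tateSum_eq _ hq,
    ← (finTwoArrowEquiv ℤ).symm.tsum_eq] at h
  rw [PeriodPair.G, ← (tatePair ℓ hℓ).latticeEquivProd.symm.toEquiv.tsum_eq,
    ← (Equiv.prodComm ℤ ℤ).tsum_eq]
  have hterm : ∀ x : ℤ × ℤ, ((((tatePair ℓ hℓ).latticeEquivProd.symm.toEquiv
      (Equiv.prodComm ℤ ℤ x) : (tatePair ℓ hℓ).lattice) : ℂ) ^ k)⁻¹ =
      ((2 * Real.pi * I) ^ k)⁻¹ * EisensteinSeries.eisSummand k ((finTwoArrowEquiv ℤ).symm x) τ := by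
    intro x
    have := (tatePair ℓ hℓ).latticeEquiv_symm_apply (x.2, x.1)
    simp only [tatePair] at this
    rw [show (((tatePair ℓ hℓ).latticeEquivProd.symm.toEquiv
      (Equiv.prodComm ℤ ℤ x) : (tatePair ℓ hℓ).lattice) : ℂ) =
        x.2 * (2 * Real.pi * I) + x.1 * ℓ from this]
    simp only [EisensteinSeries.eisSummand, finTwoArrowEquiv_symm_apply, Matrix.cons_val_zero,
      Matrix.cons_val_one]
    rw [zpow_neg, zpow_natCast, ← mul_inv, ← mul_pow]
    congr 2
    linear_combination (-(x.1 : ℂ)) * hτ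
  rw [tsum_congr hterm, tsum_mul_left, h, mul_add]
  congr 1
  rw [show (-2 * Real.pi * I : ℂ) = -(2 * Real.pi * I) by ring, hk2.neg_pow]
  have := pow_ne_zero k h2
  field_simp

theorem bernoulli_six : bernoulli 6 = 1 / 42 := by
  have h5 : bernoulli' 5 = 0 := bernoulli'_eq_zero_of_odd (by decide) (by norm_num)
  have c1 : Nat.choose 6 2 = 15 := by decide
  have c2 : Nat.choose 6 4 = 15 := by decide
  have c3 : Nat.choose 6 3 = 20 := by decide
  have c4 : Nat.choose 6 5 = 6 := by decide
  rw [bernoulli_eq_bernoulli'_of_ne_one (by norm_num), bernoulli'_def]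
  norm_num [Finset.sum_range_succ, c1, c2, c3, c4, h5]

theorem riemannZeta_six : riemannZeta 6 = Real.pi ^ 6 / 945 := by
  have := riemannZeta_two_mul_nat (k := 3) (by norm_num)
  norm_num at this
  rw [this, bernoulli_six]
  norm_num [Nat.factorial]
  ring

theorem g₂_tatePair {ℓ : ℂ} (hℓ : ℓ.re < 0) {q : ℝ} (hq : exp ℓ = q) :
    (tatePair ℓ hℓ).g₂ = ((tateCurve q).c₄ : ℂ) / 12 := by
  have hpi : (Real.pi : ℂ) ≠ 0 := by exact_mod_cast Real.pi_ne_zero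
  rw [PeriodPair.g₂, G_tatePair hℓ (by norm_num) (by decide) hq]
  have h4 : riemannZeta ((4 : ℕ) : ℂ) = Real.pi ^ 4 / 90 := by
    rw [← riemannZeta_four]; norm_num
  have hI : I ^ 4 = 1 := I_pow_four
  rw [h4, mul_pow, mul_pow, hI]
  simp [WeierstrassCurve.c₄, WeierstrassCurve.b₂, WeierstrassCurve.b₄, tateCurve, Nat.factorial]
  field_simp
  ring

theorem g₃_tatePair {ℓ : ℂ} (hℓ : ℓ.re < 0) {q : ℝ} (hq : exp ℓ = q) :
    (tatePair ℓ hℓ).g₃ = ((tateCurve q).c₆ : ℂ) / 216 := by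
  have hpi : (Real.pi : ℂ) ≠ 0 := by exact_mod_cast Real.pi_ne_zero
  rw [PeriodPair.g₃, G_tatePair hℓ (by norm_num) (by decide) hq]
  have h6 : riemannZeta ((6 : ℕ) : ℂ) = Real.pi ^ 6 / 945 := by
    rw [← riemannZeta_six]; norm_num
  have hI : I ^ 6 = -1 := by rw [show (6 : ℕ) = 4 + 2 by norm_num, pow_add, I_pow_four, I_sq, one_mul]
  rw [h6, mul_pow, mul_pow, hI]
  simp [WeierstrassCurve.c₆, WeierstrassCurve.b₂, WeierstrassCurve.b₄, WeierstrassCurve.b₆,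
    tateCurve, Nat.factorial]
  field_simp
  ring

/-! ### The theta product -/

/-- The factors of the theta product in the exponential coordinate. -/
def thetaFactor (ℓ : ℂ) (m : ℤ) (w : ℂ) : ℂ :=
  if 0 ≤ m then -exp (m * ℓ + w) else -exp (-(m * ℓ + w))

/-- The theta function `∏_{m ≥ 0} (1 - qᵐ u) ∏_{m ≥ 1} (1 - qᵐ / u)` with `q = e ^ ℓ`,
`u = e ^ w`. -/
def thetaExp (ℓ w : ℂ) : ℂ := ∏' m : ℤ, (1 + thetaFactor ℓ m w)

theorem continuous_thetaFactor (ℓ : ℂ) (m : ℤ) : Continuous (thetaFactor ℓ m) := by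
  unfold thetaFactor
  split_ifs <;> fun_prop

theorem differentiable_thetaFactor (ℓ : ℂ) (m : ℤ) :
    Differentiable ℂ (fun w => 1 + thetaFactor ℓ m w) := by
  unfold thetaFactor
  split_ifs <;> fun_prop

theorem summable_pow_natAbs {r : ℝ} (h0 : 0 ≤ r) (h1 : r < 1) :
    Summable fun m : ℤ => r ^ m.natAbs := by
  refine Summable.of_nat_of_neg ?_ ?_ <;>
    simpa using summable_geometric_of_lt_one h0 h1

theorem thetaFactor_bound {ℓ : ℂ} (hℓ : ℓ.re < 0) (r : ℝ) (_ : 0 < r) : ∃ u : ℤ → ℝ, Summable u ∧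
    ∀ᶠ i in cofinite, ∀ z : ℂ, ‖z‖ ≤ r → ‖thetaFactor ℓ i z‖ ≤ u i := by
  refine ⟨fun m => Real.exp r * Real.exp ℓ.re ^ m.natAbs,
    (summable_pow_natAbs (Real.exp_pos _).le (Real.exp_lt_one_iff.2 hℓ)).mul_left _,
    .of_forall fun m z hz => ?_⟩
  have hre := (abs_le.1 ((abs_re_le_norm z).trans hz))
  have habs : ((m.natAbs : ℕ) : ℝ) = |(m : ℝ)| := by
    rw [← Int.cast_natCast, Int.natCast_natAbs, Int.cast_abs]
  simp only
  rw [← Real.exp_nat_mul, ← Real.exp_add, habs]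
  unfold thetaFactor
  split_ifs with hm
  · rw [norm_neg, norm_exp]
    have : (0 : ℝ) ≤ m := by exact_mod_cast hm
    apply Real.exp_le_exp.2
    simp [abs_of_nonneg this]
    linarith [hre.2]
  · rw [norm_neg, norm_exp]
    have : (m : ℝ) < 0 := by exact_mod_cast not_le.1 hm
    apply Real.exp_le_exp.2
    simp [abs_of_neg this]
    linarith [hre.1]

theorem hasProdLocallyUniformly_thetaExp {ℓ : ℂ} (hℓ : ℓ.re < 0) :
    HasProdLocallyUniformly (fun m w => 1 + thetaFactor ℓ m w) (thetaExp ℓ) :=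
  hasProdLocallyUniformly_one_add (continuous_thetaFactor ℓ) (thetaFactor_bound hℓ)

theorem one_add_thetaFactor_ne_zero {ℓ : ℂ} {hℓ : ℓ.re < 0} {w : ℂ}
    (hw : w ∉ (tatePair ℓ hℓ).lattice) (m : ℤ) : 1 + thetaFactor ℓ m w ≠ 0 := by
  have h1 : exp (m * ℓ + w) ≠ 1 := fun h => hw (mem_tatePair.2 ⟨m, h⟩)
  unfold thetaFactor
  split_ifs with hm
  · rw [← sub_eq_add_neg, sub_ne_zero]
    exact h1.symm
  · rw [← sub_eq_add_neg, sub_ne_zero, exp_neg, ne_eq, eq_comm, inv_eq_one]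
    exact h1

theorem thetaExp_ne_zero {ℓ : ℂ} {hℓ : ℓ.re < 0} {w : ℂ} (hw : w ∉ (tatePair ℓ hℓ).lattice) :
    thetaExp ℓ w ≠ 0 :=
  tprod_one_add_ne_zero (thetaFactor_bound hℓ) (one_add_thetaFactor_ne_zero hw)

theorem thetaExp_eq_zero {ℓ : ℂ} {hℓ : ℓ.re < 0} {w : ℂ} (hw : w ∈ (tatePair ℓ hℓ).lattice) :
    thetaExp ℓ w = 0 := by
  obtain ⟨m, hm⟩ := mem_tatePair.1 hw
  refine tprod_of_exists_eq_zero ⟨m, ?_⟩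
  unfold thetaFactor
  split_ifs
  · rw [hm]; ring
  · rw [exp_neg, hm]; norm_num

theorem differentiable_thetaExp {ℓ : ℂ} (hℓ : ℓ.re < 0) : Differentiable ℂ (thetaExp ℓ) := by
  have h := (hasProdLocallyUniformly_thetaExp hℓ).hasProdLocallyUniformlyOn (s := Set.univ)
  have h' : TendstoLocallyUniformlyOn (fun (s : Finset ℤ) z => ∏ i ∈ s, (1 + thetaFactor ℓ i z))
    (thetaExp ℓ) atTop Set.univ := h
  rw [← differentiableOn_univ]
  exact h'.differentiableOn (.of_forall fun s => DifferentiableOn.fun_finsetProd fun i _ =>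
    (differentiable_thetaFactor ℓ i).differentiableOn) isOpen_univ

theorem hasDerivAt_expKernel {w : ℂ} (hw : exp w ≠ 1) :
    HasDerivAt expKernel (exp w * (1 + exp w) / (1 - exp w) ^ 3) w := by
  have h1 : 1 - exp w ≠ 0 := sub_ne_zero.2 hw.symm
  have h := (hasDerivAt_exp w).div (((hasDerivAt_exp w).const_sub 1).pow 2) (pow_ne_zero 2 h1)
  refine h.congr_deriv ?_
  simp
  field_simp
  ring

theorem deriv_logDeriv_one_sub_exp {w : ℂ} (hw : exp w ≠ 1) :
    HasDerivAt (logDeriv fun w => 1 + -exp w) (-expKernel w) w := by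
  have h1 : 1 - exp w ≠ 0 := sub_ne_zero.2 hw.symm
  have e : (logDeriv fun w => 1 + -exp w) = fun w => -exp w / (1 - exp w) := by
    ext w
    simp [logDeriv_apply, ← sub_eq_add_neg]
  rw [e]
  refine ((hasDerivAt_exp w).neg.div ((hasDerivAt_exp w).const_sub 1) h1).congr_deriv ?_
  simp [expKernel]
  field_simp
  ring

theorem hasDerivAt_logDeriv_thetaFactor {ℓ w : ℂ} {m : ℤ} (hw : exp (m * ℓ + w) ≠ 1) :
    HasDerivAt (logDeriv fun w => 1 + thetaFactor ℓ m w) (-expKernel (m * ℓ + w)) w := by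
  unfold thetaFactor
  split_ifs with hm
  · have := (deriv_logDeriv_one_sub_exp hw).comp_const_add (m * ℓ) w
    convert! this using 1
    ext z
    simp only [logDeriv_apply]
    rw [deriv_comp_const_add (fun w => 1 + -exp w)]
  · have hw' : exp (-(m * ℓ) - w) ≠ 1 := by
      rw [show -(m * ℓ) - w = -(m * ℓ + w) by ring, exp_neg, ne_eq, inv_eq_one]
      exact hw
    have := ((deriv_logDeriv_one_sub_exp hw').comp_const_sub (-(m * ℓ)) w).neg
    convert! this using 1
    · ext z
      simp only [logDeriv_apply, Pi.neg_apply]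
      have e : (fun z => 1 + -exp (-(m * ℓ + z))) = fun z => (fun w => 1 + -exp w) (-(m * ℓ) - z) := by
        ext z; ring_nf
      rw [e, deriv_comp_const_sub (f := fun w => 1 + -exp w), neg_div, show -(m * ℓ + z) = -(m * ℓ) - z by ring]
    · rw [← expKernel_neg]
      ring_nf

/-- Every factor of the theta product, in either form, has second logarithmic derivative `-expKernel
(m * ℓ + w)`. Besides linking `θ` to `℘`, the locally uniform convergence permits one more termwise
derivative, which yields the series for `℘'`. -/
theorem hasSumLocallyUniformlyOn_expKernel {ℓ : ℂ} (hℓ : ℓ.re < 0) :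
    HasSumLocallyUniformlyOn (fun (m : ℤ) w => -expKernel (m * ℓ + w))
      (deriv (logDeriv (thetaExp ℓ))) ((tatePair ℓ hℓ).lattice : Set ℂ)ᶜ := by
  have hU := isOpen_compl_lattice (tatePair ℓ hℓ)
  have h1 := hasSumLocallyUniformlyOn_logDeriv hU
    (hasProdLocallyUniformly_thetaExp hℓ).hasProdLocallyUniformlyOn
    (fun m => (differentiable_thetaFactor ℓ m).differentiableOn)
    (fun m z hz => one_add_thetaFactor_ne_zero hz m) (fun z hz => thetaExp_ne_zero hz)
  have hne : ∀ z ∈ ((tatePair ℓ hℓ).lattice : Set ℂ)ᶜ, ∀ m : ℤ, exp (m * ℓ + z) ≠ 1 :=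
    fun z hz m h => hz (mem_tatePair.2 ⟨m, h⟩)
  have h2 := hasSumLocallyUniformlyOn_deriv hU h1 fun m z hz =>
    (hasDerivAt_logDeriv_thetaFactor (hne z hz m)).differentiableAt.differentiableWithinAt
  have h2' : TendstoLocallyUniformlyOn (fun (s : Finset ℤ) z => ∑ i ∈ s,
    deriv (logDeriv fun w => 1 + thetaFactor ℓ i w) z) _ atTop _ := h2
  refine h2'.congr fun s z hz => Finset.sum_congr rfl fun m _ => ?_
  exact (hasDerivAt_logDeriv_thetaFactor (hne z hz m)).deriv

theorem deriv_logDeriv_thetaExp {ℓ : ℂ} {hℓ : ℓ.re < 0} {w : ℂ}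
    (hw : w ∉ (tatePair ℓ hℓ).lattice) : deriv (logDeriv (thetaExp ℓ)) w =
      -((tatePair ℓ hℓ).weierstrassP w + (2 * tateSumOne (exp ℓ) - 1 / 12)) :=
  ((hasSumLocallyUniformlyOn_expKernel hℓ).hasSum hw).unique (hasSum_expKernel hw).neg

theorem hasSum_deriv_expKernel {ℓ : ℂ} {hℓ : ℓ.re < 0} {w : ℂ}
    (hw : w ∉ (tatePair ℓ hℓ).lattice) :
    HasSum (fun m : ℤ => exp (m * ℓ + w) * (1 + exp (m * ℓ + w)) / (1 - exp (m * ℓ + w)) ^ 3)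
      ((tatePair ℓ hℓ).derivWeierstrassP w) := by
  have hU := isOpen_compl_lattice (tatePair ℓ hℓ)
  have hne : ∀ z ∈ ((tatePair ℓ hℓ).lattice : Set ℂ)ᶜ, ∀ m : ℤ, exp (m * ℓ + z) ≠ 1 :=
    fun z hz m h => hz (mem_tatePair.2 ⟨m, h⟩)
  have hd : ∀ z ∈ ((tatePair ℓ hℓ).lattice : Set ℂ)ᶜ, ∀ m : ℤ,
      HasDerivAt (fun w => -expKernel (m * ℓ + w))
        (-(exp (m * ℓ + z) * (1 + exp (m * ℓ + z)) / (1 - exp (m * ℓ + z)) ^ 3)) z := fun z hz m =>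
    ((hasDerivAt_expKernel (hne z hz m)).comp_const_add (m * ℓ) z).neg
  have h1 := (hasSumLocallyUniformlyOn_deriv hU (hasSumLocallyUniformlyOn_expKernel hℓ)
    fun m z hz => (hd z hz m).differentiableAt.differentiableWithinAt).hasSum hw
  have e : deriv (logDeriv (thetaExp ℓ)) =ᶠ[𝓝 w] fun w =>
      -((tatePair ℓ hℓ).weierstrassP w + (2 * tateSumOne (exp ℓ) - 1 / 12)) := by
    filter_upwards [hU.mem_nhds hw] with z hz using deriv_logDeriv_thetaExp hz
  have e' : HasDerivAt (fun w => -((tatePair ℓ hℓ).weierstrassP w +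
      (2 * tateSumOne (exp ℓ) - 1 / 12))) (-(tatePair ℓ hℓ).derivWeierstrassP w) w :=
    ((hasDerivAt_weierstrassP hw).add_const _).neg
  rw [e.deriv_eq, e'.deriv] at h1
  have h2 := h1.neg
  rw [neg_neg] at h2
  refine h2.congr_fun fun m => ?_
  rw [(hd w hw m).deriv, neg_neg]

/-! ### The Tate parametrization in terms of `℘` -/

theorem tateX_eq {ℓ : ℂ} {hℓ : ℓ.re < 0} {w : ℂ} (hw : w ∉ (tatePair ℓ hℓ).lattice) {q u : ℝ}
    (hq : exp ℓ = q) (hu : exp w = u) :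
    (tateX q u : ℂ) = (tatePair ℓ hℓ).weierstrassP w - 1 / 12 := by
  have h := hasSum_expKernel hw
  have e : ∀ m : ℤ, expKernel (m * ℓ + w) = ((q ^ m * u / (1 - q ^ m * u) ^ 2 : ℝ) : ℂ) := by
    intro m
    rw [expKernel, exp_add, exp_int_mul, hq, hu]
    push_cast
    rfl
  simp only [e] at h
  rw [tateX, ofReal_sub, Complex.ofReal_tsum, h.tsum_eq, tateSumOne_eq hq]
  push_cast
  ring

/-- Termwise this is `(x(1 + x)/(1 - x)³ - x/(1 - x)²)/2 = x²/(1 - x)³`; the left side is `2y + a₁x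
+ a₃` on `E_q`. -/
theorem tateY_eq {ℓ : ℂ} {hℓ : ℓ.re < 0} {w : ℂ} (hw : w ∉ (tatePair ℓ hℓ).lattice) {q u : ℝ}
    (hq : exp ℓ = q) (hu : exp w = u) :
    2 * (tateY q u : ℂ) + tateX q u = (tatePair ℓ hℓ).derivWeierstrassP w := by
  have h1 := hasSum_expKernel hw
  have h2 := hasSum_deriv_expKernel hw
  have hx := tateX_eq hw hq hu
  have h3 := (h2.sub h1).div_const 2
  have hne : ∀ m : ℤ, exp (m * ℓ + w) ≠ 1 := fun m h => hw (mem_tatePair.2 ⟨m, h⟩)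
  have e : ∀ m : ℤ, (exp (m * ℓ + w) * (1 + exp (m * ℓ + w)) / (1 - exp (m * ℓ + w)) ^ 3 -
      expKernel (m * ℓ + w)) / 2 = (((q ^ m * u) ^ 2 / (1 - q ^ m * u) ^ 3 : ℝ) : ℂ) := by
    intro m
    have h0 : 1 - exp (m * ℓ + w) ≠ 0 := sub_ne_zero.2 (hne m).symm
    have : exp (m * ℓ + w) = ((q ^ m * u : ℝ) : ℂ) := by
      rw [exp_add, exp_int_mul, hq, hu]
      push_cast
      rfl
    push_cast at this ⊢
    rw [expKernel]
    rw [← this]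
    field_simp
    ring
  simp only [e] at h3
  rw [tateY, ofReal_add, Complex.ofReal_tsum, h3.tsum_eq, hx, tateSumOne_eq hq]
  ring

/-! ### The `σ`-function -/

/-- The exponential removes the Taylor terms of `log(1 - x)` up to degree two, so the factor is `exp
r` with `r` of order `x³`. Cubic decay makes the product over a planar lattice converge. -/
theorem norm_weierstrass_factor_sub_one_le {x : ℂ} (hx : ‖x‖ ≤ 1 / 2) :
    ‖(1 - x) * exp (x + 1 / 2 * x ^ 2) - 1‖ ≤ 2 * ‖x‖ ^ 3 := by
  have hx1 : 1 - x ≠ 0 := by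
    intro h
    have : x = 1 := (sub_eq_zero.1 h).symm
    rw [this] at hx
    norm_num at hx
  have h := norm_log_sub_logTaylor_le 2 (z := -x) (by rw [norm_neg]; linarith)
  have ht : logTaylor (2 + 1) (-x) = -(x + 1 / 2 * x ^ 2) := by
    simp [logTaylor_succ, logTaylor_zero]
    ring
  rw [ht, norm_neg, ← sub_eq_add_neg, sub_neg_eq_add] at h
  set r := log (1 - x) + (x + 1 / 2 * x ^ 2) with hr
  have hE : (1 - x) * exp (x + 1 / 2 * x ^ 2) = exp r := by
    rw [hr, exp_add (log (1 - x)), exp_log hx1]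
  have h3 : ‖r‖ ≤ ‖x‖ ^ 3 := by
    refine h.trans ?_
    have hinv : (1 - ‖x‖)⁻¹ ≤ 2 := by
      rw [inv_le_comm₀ (by linarith) (by norm_num)]
      linarith
    have hp : 0 ≤ ‖x‖ ^ 3 := by positivity
    norm_num
    nlinarith
  have hx3 : ‖x‖ ^ 3 ≤ 1 := pow_le_one₀ (norm_nonneg _) (by linarith)
  rw [hE]
  exact (norm_exp_sub_one_le (h3.trans hx3)).trans (by linarith)

/-- The factor of the `σ`-product at `ω`, minus `1`. -/
def sigmaFactor (ω z : ℂ) : ℂ := (1 - z / ω) * exp (z / ω + 1 / 2 * (z / ω) ^ 2) - 1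

theorem sigma_eq (L : PeriodPair) (z : ℂ) :
    sigma L z = z * ∏' ω : {ω : L.lattice // ω ≠ 0}, (1 + sigmaFactor (ω.1 : ℂ) z) := by
  simp only [sigma, sigmaFactor, add_sub_cancel]

theorem differentiable_sigmaFactor (ω : ℂ) : Differentiable ℂ (fun z => 1 + sigmaFactor ω z) := by
  unfold sigmaFactor
  fun_prop

theorem sigmaFactor_bound (L : PeriodPair) (r : ℝ) (hr : 0 < r) :
    ∃ u : {ω : L.lattice // ω ≠ 0} → ℝ, Summable u ∧
      ∀ᶠ ω in cofinite, ∀ z : ℂ, ‖z‖ ≤ r → ‖sigmaFactor (ω.1 : ℂ) z‖ ≤ u ω := by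
  have hs : Summable fun l : L.lattice => ‖l‖ ^ (-3 : ℝ) :=
    ZLattice.summable_norm_rpow _ _ (by simp; norm_num)
  refine ⟨fun ω => 2 * r ^ 3 * ‖ω.1‖ ^ (-3 : ℝ), (hs.mul_left _).comp_injective
    Subtype.val_injective, ?_⟩
  have hfin : {l : L.lattice | ‖l‖ ≤ 2 * r}.Finite := by
    refine (isCompact_iff_finite.mp (isCompact_closedBall (0 : L.lattice) (2 * r))).subset ?_
    intro l hl
    simpa using hl
  have : ∀ᶠ ω : {ω : L.lattice // ω ≠ 0} in cofinite, 2 * r < ‖ω.1‖ := by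
    have := hfin.preimage (f := (Subtype.val : {ω : L.lattice // ω ≠ 0} → L.lattice))
      Subtype.val_injective.injOn
    rw [Filter.eventually_cofinite]
    refine this.subset fun ω hω => ?_
    simpa using hω
  filter_upwards [this] with ω hω z hz
  have hω' : 0 < ‖ω.1‖ := by linarith
  have hn : ‖(ω.1 : ℂ)‖ = ‖ω.1‖ := rfl
  have hx : ‖z / (ω.1 : ℂ)‖ ≤ r / ‖ω.1‖ := by
    rw [norm_div, hn]
    gcongr
  have hx2 : r / ‖ω.1‖ ≤ 1 / 2 := by
    rw [div_le_iff₀ hω']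
    linarith
  refine (norm_weierstrass_factor_sub_one_le (hx.trans hx2)).trans ?_
  calc 2 * ‖z / (ω.1 : ℂ)‖ ^ 3 ≤ 2 * (r / ‖ω.1‖) ^ 3 := by gcongr
    _ = 2 * r ^ 3 * ‖ω.1‖ ^ (-3 : ℝ) := by
      rw [Real.rpow_neg hω'.le, div_pow]
      norm_cast
      ring

theorem hasProdLocallyUniformly_sigma (L : PeriodPair) :
    HasProdLocallyUniformly
      (fun (ω : {ω : L.lattice // ω ≠ 0}) z => 1 + sigmaFactor (ω.1 : ℂ) z)
      (fun z => ∏' ω : {ω : L.lattice // ω ≠ 0}, (1 + sigmaFactor (ω.1 : ℂ) z)) := by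
  refine hasProdLocallyUniformly_one_add (fun ω => ?_) (sigmaFactor_bound L)
  unfold sigmaFactor
  fun_prop

theorem coe_ne_zero_of_ne_zero {L : PeriodPair} (ω : {ω : L.lattice // ω ≠ 0}) :
    ((ω.1 : L.lattice) : ℂ) ≠ 0 := fun h => ω.2 (Subtype.ext h)

theorem one_sub_div_ne_zero {L : PeriodPair} {z : ℂ} (hz : z ∉ L.lattice)
    (ω : {ω : L.lattice // ω ≠ 0}) : 1 - z / (ω.1 : ℂ) ≠ 0 := by
  intro h
  have : z = ω.1 := by
    rw [sub_eq_zero, eq_div_iff (coe_ne_zero_of_ne_zero ω), one_mul] at h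
    exact h.symm
  exact hz (this ▸ ω.1.2)

theorem one_add_sigmaFactor_ne_zero {L : PeriodPair} {z : ℂ} (hz : z ∉ L.lattice)
    (ω : {ω : L.lattice // ω ≠ 0}) : 1 + sigmaFactor (ω.1 : ℂ) z ≠ 0 := by
  rw [sigmaFactor, add_sub_cancel]
  exact mul_ne_zero (one_sub_div_ne_zero hz ω) (exp_ne_zero _)

theorem sigma_eq_zero {L : PeriodPair} {z : ℂ} (hz : z ∈ L.lattice) : sigma L z = 0 := by
  rw [sigma_eq]
  by_cases h0 : z = 0
  · rw [h0, zero_mul]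
  · refine mul_eq_zero_of_right _ (tprod_of_exists_eq_zero
      ⟨⟨⟨z, hz⟩, fun h => h0 (congrArg Subtype.val h)⟩, ?_⟩)
    simp [sigmaFactor, h0]

theorem sigma_ne_zero {L : PeriodPair} {z : ℂ} (hz : z ∉ L.lattice) : sigma L z ≠ 0 := by
  rw [sigma_eq]
  refine mul_ne_zero (fun h => hz (h ▸ L.lattice.zero_mem)) ?_
  exact tprod_one_add_ne_zero (sigmaFactor_bound L) (one_add_sigmaFactor_ne_zero hz)

theorem differentiable_sigma_product (L : PeriodPair) : Differentiable ℂ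
    (fun z => ∏' ω : {ω : L.lattice // ω ≠ 0}, (1 + sigmaFactor (ω.1 : ℂ) z)) := by
  have h := (hasProdLocallyUniformly_sigma L).hasProdLocallyUniformlyOn (s := Set.univ)
  have h' : TendstoLocallyUniformlyOn (fun (s : Finset {ω : L.lattice // ω ≠ 0}) z =>
    ∏ ω ∈ s, (1 + sigmaFactor (ω.1 : ℂ) z)) _ atTop Set.univ := h
  rw [← differentiableOn_univ]
  exact h'.differentiableOn (.of_forall fun s => DifferentiableOn.fun_finsetProd fun ω _ =>
    (differentiable_sigmaFactor _).differentiableOn) isOpen_univ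

theorem differentiable_sigma (L : PeriodPair) : Differentiable ℂ (sigma L) := by
  rw [funext (sigma_eq L)]
  exact differentiable_id.mul (differentiable_sigma_product L)

theorem hasDerivAt_logDeriv_sigmaFactor {ω z : ℂ} (hω : ω ≠ 0) (hz : z ≠ ω) :
    HasDerivAt (logDeriv fun z => 1 + sigmaFactor ω z) (-(1 / (z - ω) ^ 2 - 1 / ω ^ 2)) z := by
  have e : (logDeriv fun z => 1 + sigmaFactor ω z) =ᶠ[𝓝 z]
      fun z => (z - ω)⁻¹ + (1 / ω + z / ω ^ 2) := by
    filter_upwards [isOpen_ne.mem_nhds hz] with y hy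
    have hy' : y - ω ≠ 0 := sub_ne_zero.2 hy
    have hy1 : 1 - y / ω ≠ 0 := by
      intro h
      rw [sub_eq_zero, eq_div_iff hω, one_mul] at h
      exact hy h.symm
    have d1 : HasDerivAt (fun y : ℂ => y / ω) (1 / ω) y := (hasDerivAt_id y).div_const ω
    have d2 := (d1.const_sub 1).mul (d1.add ((d1.pow 2).const_mul (1 / 2))).cexp
    have e2 : (fun z => 1 + sigmaFactor ω z) =
        fun z => (1 - z / ω) * exp (z / ω + 1 / 2 * (z / ω) ^ 2) := by
      ext z; simp [sigmaFactor]
    rw [logDeriv_apply, congrFun e2 y, e2]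
    have d3 : deriv (fun z => (1 - z / ω) * exp (z / ω + 1 / 2 * (z / ω) ^ 2)) y = _ := d2.deriv
    rw [d3]
    simp only [Pi.add_apply, Pi.pow_apply]
    have hexp := exp_ne_zero (y / ω + 1 / 2 * (y / ω) ^ 2)
    have hy2 : ω - y ≠ 0 := sub_ne_zero.2 hy.symm
    obtain ⟨t, rfl⟩ : ∃ t, y = t * ω := ⟨y / ω, by field_simp⟩
    have ht : 1 - t ≠ 0 := by rwa [mul_div_cancel_right₀ _ hω] at hy1
    have ht' : t * ω - ω = -(ω * (1 - t)) := by ring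
    simp only [mul_div_cancel_right₀ _ hω, ht'] at hexp ⊢
    generalize exp (t + 1 / 2 * t ^ 2) = E at *
    norm_num
    field_simp
  have hz' : z - ω ≠ 0 := sub_ne_zero.2 hz
  have d4 : HasDerivAt (fun z => (z - ω)⁻¹ + (1 / ω + z / ω ^ 2))
      (-1 / (z - ω) ^ 2 + 1 / ω ^ 2) z :=
    (((hasDerivAt_id z).sub_const ω).fun_inv hz').add
      (((hasDerivAt_id z).div_const (ω ^ 2)).const_add _)
  refine (d4.congr_of_eventuallyEq e).congr_deriv ?_
  ring

/-- The product over nonzero periods produces the part of `℘` regular at `0`, and the prefactor `z`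
of `σ` supplies the missing `1/z²`. -/
theorem deriv_logDeriv_sigma {L : PeriodPair} {z : ℂ} (hz : z ∉ L.lattice) :
    deriv (logDeriv (sigma L)) z = -L.weierstrassP z := by
  have hU := isOpen_compl_lattice L
  set F : ℂ → ℂ := fun z => ∏' ω : {ω : L.lattice // ω ≠ 0}, (1 + sigmaFactor (ω.1 : ℂ) z) with hF
  have hF0 : ∀ z ∈ (L.lattice : Set ℂ)ᶜ, F z ≠ 0 := fun z hz =>
    tprod_one_add_ne_zero (sigmaFactor_bound L) (one_add_sigmaFactor_ne_zero hz)
  have hFd : Differentiable ℂ F := differentiable_sigma_product L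
  have hd : ∀ (ω : {ω : L.lattice // ω ≠ 0}), ∀ z ∈ (L.lattice : Set ℂ)ᶜ,
      HasDerivAt (logDeriv fun z => 1 + sigmaFactor (ω.1 : ℂ) z)
        (-(1 / (z - ω.1) ^ 2 - 1 / (ω.1 : ℂ) ^ 2)) z := fun ω z hz =>
    hasDerivAt_logDeriv_sigmaFactor (coe_ne_zero_of_ne_zero ω) fun h => hz (h ▸ ω.1.2)
  have h1 := hasSumLocallyUniformlyOn_logDeriv hU
    (hasProdLocallyUniformly_sigma L).hasProdLocallyUniformlyOn
    (fun ω => (differentiable_sigmaFactor _).differentiableOn)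
    (fun ω z hz => one_add_sigmaFactor_ne_zero hz ω) hF0
  have h2 := (hasSumLocallyUniformlyOn_deriv hU h1 fun ω z hz =>
    (hd ω z hz).differentiableAt.differentiableWithinAt).hasSum hz
  have h3 : HasSum (fun ω : {ω : L.lattice // ω ≠ 0} => 1 / (z - ω.1) ^ 2 - 1 / (ω.1 : ℂ) ^ 2)
      (L.weierstrassPExcept 0 z) := by
    have := L.hasSum_weierstrassPExcept 0 z
    rw [← hasSum_subtype_iff_of_support_subset (s := {ω : L.lattice | ω ≠ 0})] at this
    · refine this.congr_fun fun ω => ?_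
      simp only [Function.comp]
      rw [if_neg]
      exact coe_ne_zero_of_ne_zero ω
    · intro ω hω h0
      apply hω
      simp [h0]
  have h4 : deriv (logDeriv F) z = -L.weierstrassPExcept 0 z :=
    h2.unique (h3.neg.congr_fun fun ω => (hd ω z hz).deriv)
  have hz0 : ∀ y ∈ (L.lattice : Set ℂ)ᶜ, y ≠ 0 := fun y hy h => hy (h ▸ L.lattice.zero_mem)
  have e : logDeriv (sigma L) =ᶠ[𝓝 z] fun y => y⁻¹ + logDeriv F y := by
    filter_upwards [hU.mem_nhds hz] with y hy
    rw [funext (sigma_eq L), logDeriv_mul (f := fun y => y) (g := F) y (hz0 y hy) (hF0 y hy)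
      differentiableAt_id (hFd y)]
    simp [logDeriv_apply]
  have dF : DifferentiableAt ℂ (logDeriv F) z :=
    ((hFd.differentiableOn.deriv hU).div hFd.differentiableOn hF0).differentiableAt (hU.mem_nhds hz)
  rw [e.deriv_eq, deriv_fun_add (differentiableAt_inv (hz0 z hz)) dF, h4, deriv_inv]
  have := L.weierstrassPExcept_add 0 z
  simp only [ZeroMemClass.coe_zero, sub_zero] at this
  rw [← this]
  norm_num

/-- On the Tate lattice, `σ` is the exponential of a quadratic polynomial times the theta
function. -/
theorem exists_sigma_tatePair_eq {ℓ : ℂ} (hℓ : ℓ.re < 0) : ∃ a b c : ℂ, c ≠ 0 ∧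
    ∀ w, sigma (tatePair ℓ hℓ) w = c * exp (a * w ^ 2 + b * w) * thetaExp ℓ w := by
  obtain ⟨b, c, hc, h⟩ := eq_exp_quadratic_mul (isOpen_compl_lattice (tatePair ℓ hℓ))
    (isPreconnected_compl_lattice _) (differentiable_sigma _).differentiableOn
    (differentiable_thetaExp hℓ).differentiableOn (fun z hz => sigma_ne_zero hz)
    (fun z hz => thetaExp_ne_zero hz) (κ := 2 * tateSumOne (exp ℓ) - 1 / 12) fun z hz => by
      rw [deriv_logDeriv_sigma hz, deriv_logDeriv_thetaExp hz]
      ring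
  refine ⟨(2 * tateSumOne (exp ℓ) - 1 / 12) / 2, b, c, hc, fun w => ?_⟩
  by_cases hw : w ∈ (tatePair ℓ hℓ).lattice
  · rw [sigma_eq_zero hw, thetaExp_eq_zero hw, mul_zero]
  · exact h w hw

/-! ### Lattices stable under complex conjugation -/

theorem exists_norm_le_of_mem_lattice (L : PeriodPair) :
    ∃ ε > 0, ∀ l ∈ L.lattice, l ≠ 0 → ε ≤ ‖l‖ := by
  have h := eventually_notMem_lattice L 0
  rw [eventually_nhdsWithin_iff, Metric.eventually_nhds_iff] at h
  obtain ⟨ε, hε, h⟩ := h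
  refine ⟨ε, hε, fun l hl h0 => ?_⟩
  by_contra! hlt
  exact h (by simpa using hlt) h0 hl

/-- The real multiples of a nonzero complex number in a lattice are the multiples of one of them. -/
theorem exists_real_multiple_generator (L : PeriodPair) {d : ℂ} (hd : d ≠ 0)
    (hne : ∃ t : ℝ, t ≠ 0 ∧ (t : ℂ) * d ∈ L.lattice) :
    ∃ a : ℝ, 0 < a ∧ ∀ t : ℝ, (t : ℂ) * d ∈ L.lattice ↔ ∃ m : ℤ, t = m * a := by
  let A : AddSubgroup ℝ :=
    { carrier := {t | (t : ℂ) * d ∈ L.lattice}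
      zero_mem' := by simp
      add_mem' := fun {s t} hs ht => by
        simp only [Set.mem_ofPred_eq] at *
        simpa [add_mul] using add_mem hs ht
      neg_mem' := fun {s} hs => by
        simp only [Set.mem_ofPred_eq] at *
        simpa using neg_mem hs }
  have hA : ∀ t, t ∈ A ↔ (t : ℂ) * d ∈ L.lattice := fun t => Iff.rfl
  obtain ⟨ε, hε, h⟩ := exists_norm_le_of_mem_lattice L
  have hd0 : 0 < ‖d‖ := norm_pos_iff.2 hd
  -- A subgroup of `ℝ` without small positive elements is cyclic.
  have hcyc := AddSubgroup.cyclic_of_isolated_zero (H := A) (a := ε / ‖d‖) (by positivity) (by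
    rw [Set.disjoint_left]
    rintro t ht ⟨h0, h1⟩
    have := h _ ((hA t).1 ht) (mul_ne_zero (by exact_mod_cast h0.ne') hd)
    rw [norm_mul, norm_real, Real.norm_of_nonneg h0.le] at this
    rw [lt_div_iff₀ hd0] at h1
    linarith)
  obtain ⟨a, ha⟩ := hcyc
  have hmem : ∀ t : ℝ, (t : ℂ) * d ∈ L.lattice ↔ ∃ m : ℤ, t = m * a := fun t => by
    rw [← hA, ha, AddSubgroup.mem_closure_singleton]
    simp [eq_comm]
  have ha0 : a ≠ 0 := by
    rintro rfl
    obtain ⟨t, ht0, ht⟩ := hne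
    obtain ⟨m, hm⟩ := (hmem t).1 ht
    exact ht0 (by simpa using hm)
  refine ⟨|a|, abs_pos.2 ha0, fun t => (hmem t).trans ?_⟩
  rcases abs_choice a with h | h <;> rw [h]
  exact ⟨fun ⟨m, hm⟩ => ⟨-m, by rw [hm]; push_cast; ring⟩,
    fun ⟨m, hm⟩ => ⟨-m, by rw [hm]; push_cast; ring⟩⟩

theorem exists_re_ne_zero (L : PeriodPair) : ∃ l ∈ L.lattice, l.re ≠ 0 := by
  by_contra! h
  have h1 := h _ L.ω₁_mem_lattice
  have h2 := h _ L.ω₂_mem_lattice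
  have := L.indep
  rw [LinearIndependent.pair_iff] at this
  have h3 := this L.ω₂.im (-L.ω₁.im) (by apply Complex.ext <;> simp [h1, h2]; ring)
  have h4 := this 1 0 (by apply Complex.ext <;> simp [h1]; linarith [h3.2])
  simp at h4

theorem exists_im_ne_zero (L : PeriodPair) : ∃ l ∈ L.lattice, l.im ≠ 0 := by
  by_contra! h
  have h1 := h _ L.ω₁_mem_lattice
  have h2 := h _ L.ω₂_mem_lattice
  have := L.indep
  rw [LinearIndependent.pair_iff] at this
  have h3 := this L.ω₂.re (-L.ω₁.re) (by apply Complex.ext <;> simp [h1, h2]; ring)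
  have h4 := this 1 0 (by apply Complex.ext <;> simp [h1]; linarith [h3.2])
  simp at h4

theorem exists_tatePair_of_conj {L : PeriodPair}
    (hconj : ∀ z ∈ L.lattice, (starRingEnd ℂ) z ∈ L.lattice) :
    ∃ (ℓ : ℂ) (hℓ : ℓ.re < 0) (q c : ℝ), exp ℓ = q ∧ c ≠ 0 ∧
      ∀ z, (c : ℂ) * z ∈ L.lattice ↔ z ∈ (tatePair ℓ hℓ).lattice := by
  have hre : ∀ z ∈ L.lattice, ((2 * z.re : ℝ) : ℂ) * 1 ∈ L.lattice := fun z hz => by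
    have := add_mem hz (hconj z hz)
    rw [add_conj] at this
    rwa [mul_one]
  have him : ∀ z ∈ L.lattice, ((2 * z.im : ℝ) : ℂ) * I ∈ L.lattice := fun z hz => by
    have := sub_mem hz (hconj z hz)
    rwa [sub_conj] at this
  obtain ⟨a, ha, hA⟩ := exists_real_multiple_generator L one_ne_zero <| by
    obtain ⟨l, hl, h0⟩ := exists_re_ne_zero L
    exact ⟨2 * l.re, by simpa using h0, hre l hl⟩
  obtain ⟨b, hb, hB⟩ := exists_real_multiple_generator L I_ne_zero <| by
    obtain ⟨l, hl, h0⟩ := exists_im_ne_zero L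
    exact ⟨2 * l.im, by simpa using h0, him l hl⟩
  have haL : ∀ m : ℤ, (m * a : ℂ) ∈ L.lattice := fun m => by
    have := (hA (m * a)).2 ⟨m, rfl⟩
    push_cast at this
    rwa [mul_one] at this
  have hbL : ∀ m : ℤ, (m * b * I : ℂ) ∈ L.lattice := fun m => by
    have := (hB (m * b)).2 ⟨m, rfl⟩
    push_cast at this
    exact this
  have hπ := Real.pi_pos
  have hb' : (b : ℂ) ≠ 0 := by exact_mod_cast hb.ne'
  have hπ' : (Real.pi : ℂ) ≠ 0 := by exact_mod_cast hπ.ne'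
  have hc0 : b / (2 * Real.pi) ≠ 0 := by positivity
  have key : ∀ (ℓ : ℂ) (hℓ : ℓ.re < 0) (q : ℝ), exp ℓ = q →
      (∀ z, z ∈ L.lattice ↔ ∃ m n : ℤ, m * (b * I) + n * (b / (2 * Real.pi) * ℓ) = z) →
      ∃ (ℓ : ℂ) (hℓ : ℓ.re < 0) (q c : ℝ), exp ℓ = q ∧ c ≠ 0 ∧
      ∀ z, (c : ℂ) * z ∈ L.lattice ↔ z ∈ (tatePair ℓ hℓ).lattice := by
    intro ℓ hℓ q hq h
    refine ⟨ℓ, hℓ, q, b / (2 * Real.pi), hq, hc0, fun z => ?_⟩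
    rw [h, PeriodPair.mem_lattice]
    refine exists₂_congr fun m n => ?_
    simp only [tatePair]
    push_cast
    rw [← mul_right_inj' (b := (m * (2 * Real.pi * I) + n * ℓ : ℂ)) (c := z)
      (a := (b / (2 * Real.pi) : ℂ)) (by exact_mod_cast hc0)]
    have : (b / (2 * Real.pi) * (m * (2 * Real.pi * I) + n * ℓ) : ℂ) =
      m * (b * I) + n * (b / (2 * Real.pi) * ℓ) := by field_simp
    rw [this]
  -- The real period `a` and the imaginary period `bi` span a sublattice that contains `2z`, since
  -- `z ± z̄` are periods; the coordinates of `z` are thus half-integers.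
  have hcoord : ∀ z ∈ L.lattice, ∃ m n : ℤ, z = m * a / 2 + n * b / 2 * I := fun z hz => by
    obtain ⟨m, hm⟩ := (hA _).1 (hre z hz)
    obtain ⟨n, hn⟩ := (hB _).1 (him z hz)
    refine ⟨m, n, ?_⟩
    apply Complex.ext
    · simp [-ofReal_intCast, ← ofReal_intCast]; linarith
    · simp [-ofReal_intCast, ← ofReal_intCast]; linarith
  -- Rhombic case: `bi` and `(-a + bi)/2` generate. The homothety by `b/(2π)` sends `2πi` to `bi`,
  -- so `ℓ = -πa/b + πi` and `q < 0`.
  by_cases hhalf : ((-a + b * I) / 2 : ℂ) ∈ L.lattice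
  · have e : (b / (2 * Real.pi) * ((-(Real.pi * a / b) : ℝ) + Real.pi * I) : ℂ) =
        (-a + b * I) / 2 := by
      push_cast
      field_simp
    refine key ((-(Real.pi * a / b) : ℝ) + Real.pi * I) ?_ (-Real.exp (-(Real.pi * a / b))) ?_ ?_
    · simp
      positivity
    · rw [exp_add, exp_pi_mul_I]
      push_cast
      ring
    · intro z
      rw [e]
      constructor
      · intro hz
        obtain ⟨m, n, h⟩ := hcoord z hz
        have h2 : (((n + m) / 2 * b : ℝ) : ℂ) * I ∈ L.lattice := by
          have := add_mem hz (L.lattice.smul_mem m hhalf)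
          rw [zsmul_eq_mul] at this
          convert this using 1
          rw [h]
          push_cast
          ring
        obtain ⟨k, hk⟩ := (hB _).1 h2
        have hk' : (n + m) / 2 * (b : ℂ) = k * b := by exact_mod_cast hk
        refine ⟨k, -m, ?_⟩
        rw [h]
        push_cast
        linear_combination (-I) * hk'
      · rintro ⟨m, n, rfl⟩
        have := add_mem (hbL m) (L.lattice.smul_mem n hhalf)
        rwa [zsmul_eq_mul, mul_assoc] at this
  -- Rectangular case: `bi` and `-a` generate, so `ℓ = -2πa/b` is real and `q > 0`.
  · have e : (b / (2 * Real.pi) * ((-(2 * Real.pi * a / b) : ℝ)) : ℂ) = -a := by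
      push_cast
      field_simp
    refine key ((-(2 * Real.pi * a / b) : ℝ)) ?_ (Real.exp (-(2 * Real.pi * a / b))) ?_ ?_
    · simp
      positivity
    · simp
    · intro z
      rw [e]
      constructor
      · intro hz
        obtain ⟨m, n, h⟩ := hcoord z hz
        have hm : Even m := by
          by_contra hm
          obtain ⟨k, hk⟩ := Int.not_even_iff_odd.1 hm
          rcases Int.even_or_odd n with ⟨j, hj⟩ | ⟨j, hj⟩
          · have h2 : ((m / 2 * a : ℝ) : ℂ) * 1 ∈ L.lattice := by
              have := sub_mem hz (hbL j)
              convert this using 1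
              rw [h, hj]
              push_cast
              ring
            obtain ⟨i, hi⟩ := (hA _).1 h2
            have hi' := mul_right_cancel₀ ha.ne' hi
            have : m = 2 * i := by
              have : (m : ℝ) = 2 * i := by linarith
              exact_mod_cast this
            omega
          · apply hhalf
            have := sub_mem (sub_mem hz (hbL j)) (haL (k + 1))
            convert this using 1
            rw [h, hj, hk]
            push_cast
            ring
        obtain ⟨k, hk⟩ := hm
        have h2 : ((n / 2 * b : ℝ) : ℂ) * I ∈ L.lattice := by
          have := sub_mem hz (haL k)
          convert this using 1
          rw [h, hk]
          push_cast
          ring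
        obtain ⟨i, hi⟩ := (hB _).1 h2
        have hi' : (n : ℂ) / 2 * (b : ℂ) = i * b := by exact_mod_cast hi
        refine ⟨i, -k, ?_⟩
        rw [h, hk]
        push_cast
        linear_combination (-I) * hi'
      · rintro ⟨m, n, rfl⟩
        have := sub_mem (hbL m) (haL n)
        convert this using 1
        ring

/-! ### The theta function of a real variable and its sign -/

/-- The factors of the theta product. -/
def thetaTerm (q x : ℝ) (m : ℤ) : ℝ := if 0 ≤ m then 1 - q ^ m * x else 1 - q ^ (-m) / x

/-- The theta function `∏_{m ≥ 0} (1 - qᵐ x) ∏_{m ≥ 1} (1 - qᵐ / x)`. -/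
def theta (q x : ℝ) : ℝ := ∏' m : ℤ, thetaTerm q x m

theorem multipliable_thetaTerm {q : ℝ} (hq1 : |q| < 1) (x : ℝ) :
    Multipliable (thetaTerm q x) := by
  have h : Summable fun m : ℤ => ‖thetaTerm q x m - 1‖ := by
    refine Summable.of_nonneg_of_le (fun m => norm_nonneg _) (fun m => ?_)
      ((summable_pow_natAbs (abs_nonneg q) hq1).mul_left (|x| + |x|⁻¹))
    have hx0 : 0 ≤ |x| := abs_nonneg x
    have hp : 0 ≤ |q| ^ m.natAbs := by positivity
    have hx1 : 0 ≤ |x|⁻¹ := by positivity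
    unfold thetaTerm
    split_ifs with hm
    · have e : ((m.natAbs : ℕ) : ℤ) = m := Int.natAbs_of_nonneg hm
      have : |q| ^ m = |q| ^ m.natAbs := by rw [← zpow_natCast, e]
      rw [sub_sub_cancel_left, norm_neg, Real.norm_eq_abs, abs_mul, abs_zpow, this]
      nlinarith
    · have e : ((m.natAbs : ℕ) : ℤ) = -m := by omega
      have : |q| ^ (-m) = |q| ^ m.natAbs := by rw [← zpow_natCast, e]
      rw [sub_sub_cancel_left, norm_neg, Real.norm_eq_abs, abs_div, abs_zpow, this, div_eq_mul_inv]
      nlinarith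
  simpa using multipliable_one_add_of_summable h

/-- Passing from `x` to `qx` shifts the index of the factors by one. Only `m = -1` changes from one
kind of factor to the other, through `1 - 1/x = -x⁻¹(1 - x)`. -/
theorem theta_mul {q x : ℝ} (hq0 : q ≠ 0) (hq1 : |q| < 1) (hx : x ≠ 0) :
    theta q (q * x) = -x⁻¹ * theta q x := by
  have e : ∀ m : ℤ, thetaTerm q (q * x) m =
      (if m = -1 then -x⁻¹ else 1) * thetaTerm q x (m + 1) := by
    intro m
    unfold thetaTerm
    by_cases h1 : m = -1
    · subst h1
      norm_num
      field_simp
      ring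
    · rw [if_neg h1, one_mul]
      by_cases hm : 0 ≤ m
      · rw [if_pos hm, if_pos (by omega), zpow_add_one₀ hq0, mul_assoc]
      · rw [if_neg hm, if_neg (by omega), neg_add, ← sub_eq_add_neg, zpow_sub_one₀ hq0]
        field_simp
  have h1 : HasProd (fun m : ℤ => if m = -1 then -x⁻¹ else 1) (-x⁻¹) := hasProd_ite_eq _ _
  have h0 : HasProd (thetaTerm q x) (theta q x) := (multipliable_thetaTerm hq1 x).hasProd
  have h2 : HasProd (thetaTerm q x ∘ Equiv.addRight (1 : ℤ)) (theta q x) :=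
    (Equiv.addRight (1 : ℤ)).hasProd_iff.2 h0
  have h3 : HasProd (thetaTerm q (q * x)) (-x⁻¹ * theta q x) :=
    (h1.mul h2).congr_fun fun m => e m
  exact h3.tprod_eq

theorem theta_nonneg_of_terms {q x : ℝ} (h : ∀ m, 0 ≤ thetaTerm q x m) : 0 ≤ theta q x := by
  -- A product that does not converge has the default value `1`, so convergence need not be assumed.
  by_cases hm : Multipliable (thetaTerm q x)
  · exact ge_of_tendsto' hm.hasProd fun s => Finset.prod_nonneg fun m _ => h m
  · rw [theta, tprod_eq_one_of_not_multipliable hm]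
    exact zero_le_one

/-- The triangular number `k (k - 1) / 2`. -/
def tri (k : ℤ) : ℤ := k * (k - 1) / 2

theorem two_mul_tri (k : ℤ) : 2 * tri k = k * (k - 1) :=
  Int.mul_ediv_cancel' (Int.even_mul_pred_self k).two_dvd

theorem tri_add_one (k : ℤ) : tri (k + 1) = tri k + k := by
  have h1 := two_mul_tri k
  have h2 := two_mul_tri (k + 1)
  have : 2 * tri (k + 1) = 2 * (tri k + k) := by rw [mul_add, h1, h2]; ring
  omega

theorem tri_quadratic (a b c : ℤ) :
    tri (a + b + c) + tri a + tri b + tri c = tri (a + b) + tri (b + c) + tri (c + a) := by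
  have : 2 * (tri (a + b + c) + tri a + tri b + tri c) =
      2 * (tri (a + b) + tri (b + c) + tri (c + a)) := by
    simp only [mul_add, two_mul_tri]
    ring
  omega

/-- Both sides obey the same one-step recursion in `k`; the exponents of `q` add up to the
triangular number. As `tri` is quadratic, the multiplier becomes a quadratic form when `k` is linear
in `v`. -/
theorem theta_zpow_mul {q x : ℝ} (hq0 : q ≠ 0) (hq1 : |q| < 1) (hx : x ≠ 0) (k : ℤ) :
    theta q (q ^ k * x) = (-1) ^ k * q ^ (-tri k) * x ^ (-k) * theta q x := by
  have step : ∀ k : ℤ, theta q (q ^ (k + 1) * x) = -(q ^ k * x)⁻¹ * theta q (q ^ k * x) := by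
    intro k
    rw [← theta_mul hq0 hq1 (mul_ne_zero (zpow_ne_zero _ hq0) hx), zpow_add_one₀ hq0]
    ring_nf
  have hs : ∀ k : ℤ, (-1 : ℝ) ^ (k + 1) * q ^ (-tri (k + 1)) * x ^ (-(k + 1)) =
      -(q ^ k * x)⁻¹ * ((-1) ^ k * q ^ (-tri k) * x ^ (-k)) := by
    intro k
    rw [tri_add_one, zpow_add_one₀ (by norm_num), neg_add, neg_add, zpow_add₀ hq0, zpow_add₀ hx,
      zpow_neg q k, zpow_neg_one, mul_inv]
    ring
  induction k with
  | zero => simp [tri]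
  | succ k ih => rw [step, ih, hs, ← mul_assoc]
  | pred k ih =>
    have h1 := step (-k - 1)
    have h2 := hs (-k - 1)
    rw [sub_add_cancel] at h1 h2
    rw [ih, h2] at h1
    have hne : -(q ^ (-(k : ℤ) - 1) * x)⁻¹ ≠ 0 :=
      neg_ne_zero.2 (inv_ne_zero (mul_ne_zero (zpow_ne_zero _ hq0) hx))
    rw [mul_assoc] at h1
    exact (mul_left_cancel₀ hne h1).symm

theorem theta_zpow_eq_zero {q : ℝ} (hq0 : q ≠ 0) (hq1 : |q| < 1) (k : ℤ) : theta q (q ^ k) = 0 := by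
  have h : theta q 1 = 0 := tprod_of_exists_eq_zero ⟨0, by simp [thetaTerm]⟩
  have := theta_zpow_mul hq0 hq1 one_ne_zero k
  rwa [h, mul_zero, mul_one] at this

/-- Write `r^t = r^⌊t⌋ r^{fract t}`. The last factor lies in `[r, 1]`, where `f` is nonnegative, and
each of the `⌊t⌋` steps reverses the sign. -/
theorem sign_rpow_of_alternating {f : ℝ → ℝ} {r : ℝ} (hr0 : 0 < r) (hr1 : r < 1)
    (hf : ∀ x, 0 < x → ∃ c, 0 < c ∧ f (r * x) = -c * f x)
    (hbase : ∀ x, r ≤ x → x ≤ 1 → 0 ≤ f x) (t : ℝ) : 0 ≤ (-1) ^ ⌊t⌋ * f (r ^ t) := by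
  have step : ∀ (k : ℤ) (x : ℝ), 0 < x →
      (0 ≤ (-1) ^ (k + 1) * f (r ^ (k + 1) * x) ↔ 0 ≤ (-1) ^ k * f (r ^ k * x)) := by
    intro k x hx
    obtain ⟨c, hc, h⟩ := hf (r ^ k * x) (by positivity)
    have e : (-1) ^ (k + 1) * f (r ^ (k + 1) * x) = c * ((-1) ^ k * f (r ^ k * x)) := by
      rw [zpow_add_one₀ hr0.ne', zpow_add_one₀ (by norm_num), mul_comm (r ^ k) r, mul_assoc r, h]
      ring
    rw [e, mul_nonneg_iff_of_pos_left hc]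
  have main : ∀ (k : ℤ) (x : ℝ), 0 < x → 0 ≤ f x → 0 ≤ (-1) ^ k * f (r ^ k * x) := by
    intro k x hx h0
    induction k with
    | zero => simpa using h0
    | succ k ih => exact (step _ x hx).2 ih
    | pred k ih =>
      refine (step _ x hx).1 ?_
      rwa [sub_add_cancel]
  have e : r ^ t = r ^ ⌊t⌋ * r ^ Int.fract t := by
    rw [← Real.rpow_intCast, ← Real.rpow_add hr0, Int.floor_add_fract]
  rw [e]
  refine main _ _ (Real.rpow_pos_of_pos hr0 _) (hbase _ ?_ ?_)
  · simpa using Real.rpow_le_rpow_of_exponent_ge hr0 hr1.le (Int.fract_lt_one t).le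
  · exact Real.rpow_le_one hr0.le hr1.le (Int.fract_nonneg t)

theorem zpow_le_one_of_abs {q : ℝ} (hq1 : |q| ≤ 1) {m : ℤ} (hm : 0 ≤ m) : q ^ m ≤ 1 := by
  lift m to ℕ using hm
  rw [zpow_natCast]
  exact (le_abs_self _).trans ((abs_pow q m).le.trans (pow_le_one₀ (abs_nonneg q) hq1))

/-- The modulus of the sign changes of the theta function on the positive reals. -/
def signPeriod (q : ℝ) : ℝ := if 0 < q then q else q ^ 2

theorem theta_rpow_sign {q : ℝ} (hq0 : q ≠ 0) (hq1 : |q| < 1) (t : ℝ) :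
    0 ≤ (-1) ^ ⌊t⌋ * theta q (signPeriod q ^ t) := by
  unfold signPeriod
  split_ifs with hq
  · refine sign_rpow_of_alternating hq (lt_of_abs_lt hq1)
      (fun x hx => ⟨x⁻¹, by positivity, theta_mul hq0 hq1 hx.ne'⟩) (fun x h1 h2 => ?_) t
    have hx : 0 < x := hq.trans_le h1
    refine theta_nonneg_of_terms fun m => ?_
    unfold thetaTerm
    split_ifs with hm
    · have h3 := zpow_le_one_of_abs hq1.le hm
      have : q ^ m * x ≤ 1 := mul_le_one₀ h3 hx.le h2
      linarith
    · have h3 : q ^ (-m) ≤ q := by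
        have := zpow_le_one_of_abs hq1.le (m := -m - 1) (by omega)
        calc q ^ (-m) = q ^ (-m - 1) * q := by rw [← zpow_add_one₀ hq0]; ring_nf
          _ ≤ 1 * q := by gcongr
          _ = q := one_mul q
      have : q ^ (-m) / x ≤ 1 := (div_le_one hx).2 (h3.trans h1)
      linarith
  · have hq' : q < 0 := lt_of_le_of_ne (not_lt.1 hq) hq0
    have hqq : 0 < q ^ 2 := by positivity
    have hqq1 : q ^ 2 < 1 := by rwa [sq_lt_one_iff_abs_lt_one]
    refine sign_rpow_of_alternating hqq hqq1 (fun x hx => ⟨-(q⁻¹ * (x ^ 2)⁻¹), ?_, ?_⟩)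
      (fun x h1 h2 => ?_) t
    · have := mul_neg_of_neg_of_pos (inv_lt_zero.2 hq') (inv_pos.2 (pow_pos hx 2))
      linarith
    -- For `q < 0` two steps give `θ(q²x) = q⁻¹x⁻² θ(x)`, again with a negative multiplier; this is
    -- why the period is `q²`.
    · rw [pow_two, mul_assoc, theta_mul hq0 hq1 (mul_ne_zero hq0 hx.ne'), theta_mul hq0 hq1 hx.ne']
      field_simp
    · have hx : 0 < x := hqq.trans_le h1
      refine theta_nonneg_of_terms fun m => ?_
      unfold thetaTerm
      split_ifs with hm
      · have h3 := zpow_le_one_of_abs hq1.le hm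
        have : q ^ m * x ≤ 1 := by nlinarith
        linarith
      · have h3 : q ^ (-m) ≤ q ^ 2 := by
          by_cases h1 : m = -1
          · subst h1
            norm_num
            linarith
          · have := zpow_le_one_of_abs hq1.le (m := -m - 2) (by omega)
            calc q ^ (-m) = q ^ (-m - 2) * q ^ 2 := by
                  rw [← zpow_natCast, ← zpow_add₀ hq0]; ring_nf
              _ ≤ 1 * q ^ 2 := by gcongr
              _ = q ^ 2 := one_mul _
        have : q ^ (-m) / x ≤ 1 := (div_le_one hx).2 (h3.trans h1)
        linarith

theorem theta_neg_nonneg {q x : ℝ} (hq : 0 < q) (hx : x < 0) : 0 ≤ theta q x := by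
  refine theta_nonneg_of_terms fun m => ?_
  unfold thetaTerm
  split_ifs with hm
  · have := mul_neg_of_pos_of_neg (zpow_pos hq m) hx
    linarith
  · have := div_neg_of_pos_of_neg (zpow_pos hq (-m)) hx
    linarith

theorem theta_eq_thetaExp {q x : ℝ} (hq1 : |q| < 1) {ℓ w : ℂ}
    (hℓ : exp ℓ = q) (hw : exp w = x) : (theta q x : ℂ) = thetaExp ℓ w := by
  have h := (multipliable_thetaTerm hq1 x).hasProd.map ofRealHom continuous_ofReal
  rw [thetaExp]
  refine (HasProd.tprod_eq (h.congr_fun fun m => ?_)).symm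
  simp only [Function.comp, thetaTerm, thetaFactor, ofRealHom_eq_coe]
  split_ifs with hm
  · rw [exp_add, exp_int_mul, hℓ, hw]
    push_cast
    ring
  · rw [exp_neg, exp_add, exp_int_mul, hℓ, hw]
    push_cast
    rw [mul_inv, zpow_neg]
    ring

/-! ### Normalization of multiplicative coordinates -/

/-- `x` lies in the fundamental domain for the action of `q ^ ℤ` (modulo its boundary). -/
def IsNormalized (q x : ℝ) : Prop :=
  (0 < q → q < |x| ∧ |x| < 1) ∧ (q < 0 → q ^ 2 < x ∧ x < 1)

theorem IsNormalized.ne_zero {q x : ℝ} (hq0 : q ≠ 0) (h : IsNormalized q x) : x ≠ 0 := by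
  rintro rfl
  rcases hq0.lt_or_gt with hq | hq
  · exact absurd (h.2 hq).1 (not_lt.2 (sq_nonneg q))
  · have := (h.1 hq).1
    rw [abs_zero] at this
    exact lt_asymm this hq

theorem IsNormalized.zpow_mul_ne_one {q x : ℝ} (hq0 : q ≠ 0) (hq1 : |q| < 1)
    (h : IsNormalized q x) (m : ℤ) : q ^ m * x ≠ 1 := by
  intro hm
  have hqp : 0 < |q| := abs_pos.2 hq0
  have habs : |q| ^ m * |x| = 1 := by rw [← abs_zpow, ← abs_mul, hm, abs_one]
  have hx1 : |x| < 1 := by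
    rcases hq0.lt_or_gt with hq | hq
    · have := h.2 hq
      rw [abs_lt]
      constructor <;> nlinarith
    · exact (h.1 hq).2
  have hm0 : m < 0 := by
    by_contra! h0
    have := zpow_le_one_of_abs (q := |q|) (by rw [abs_abs]; exact hq1.le) h0
    have h2 : |q| ^ m * |x| ≤ 1 * |x| := by gcongr
    linarith
  have hup : ∀ k : ℤ, m + k ≤ 0 → |q| ^ k < |x| → False := fun k hk hlt => by
    have h1 : 1 ≤ |q| ^ (m + k) := by
      have := zpow_le_zpow_right_of_le_one₀ hqp hq1.le hk
      rwa [zpow_zero] at this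
    rw [zpow_add₀ hqp.ne'] at h1
    have : |q| ^ m * |q| ^ k < |q| ^ m * |x| := by gcongr
    linarith
  rcases hq0.lt_or_gt with hq | hq
  · have h2 := h.2 hq
    have hx : 0 < x := lt_of_le_of_lt (sq_nonneg q) h2.1
    by_cases h1 : m = -1
    · rw [h1, zpow_neg_one] at hm
      have := mul_neg_of_neg_of_pos (inv_lt_zero.2 hq) hx
      linarith
    · refine hup 2 (by omega) ?_
      rw [abs_of_pos hx]
      simpa [zpow_ofNat] using h2.1
  · refine hup 1 (by omega) ?_
    rw [zpow_one, abs_of_pos hq]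
    exact (h.1 hq).1

/-- The hypothesis keeps the orbit of `x` away from `±1`, so the boundary of the fundamental domain
is avoided. For `q < 0` a factor `q` first makes `x` positive, after which only even powers of `q`
are used. -/
theorem exists_isNormalized {q x : ℝ} (hq0 : q ≠ 0) (hq1 : |q| < 1) (hx : x ≠ 0)
    (h : ∀ m : ℤ, (q ^ m * x) ^ 2 ≠ 1) : ∃ k : ℤ, IsNormalized q (q ^ k * x) := by
  rcases hq0.lt_or_gt with hq | hq
  · have pos : ∀ y : ℝ, 0 < y → ∃ k : ℤ, q ^ 2 < q ^ k * y ∧ q ^ k * y ≤ 1 := fun y hy => by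
      have hqq : 0 < q ^ 2 := by positivity
      have hqq1 : q ^ 2 < 1 := by rwa [sq_lt_one_iff_abs_lt_one]
      obtain ⟨n, h1, h2⟩ := exists_mem_Ioc_zpow hy ((one_lt_inv₀ hqq).2 hqq1)
      refine ⟨2 * (n + 1), ?_⟩
      rw [zpow_mul, zpow_ofNat]
      rw [inv_zpow'] at h1 h2
      have hp : 0 < (q ^ 2) ^ (n + 1) := zpow_pos hqq _
      constructor
      · calc q ^ 2 = (q ^ 2) ^ (n + 1) * (q ^ 2) ^ (-n) := by
              rw [← zpow_add₀ hqq.ne']; simp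
          _ < _ := by gcongr
      · calc (q ^ 2) ^ (n + 1) * y ≤ (q ^ 2) ^ (n + 1) * (q ^ 2) ^ (-(n + 1)) := by gcongr
          _ = 1 := by rw [← zpow_add₀ hqq.ne']; simp
    have main : ∃ k : ℤ, q ^ 2 < q ^ k * x ∧ q ^ k * x ≤ 1 := by
      rcases hx.lt_or_gt with hx | hx
      · obtain ⟨k, hk⟩ := pos (q * x) (mul_pos_of_neg_of_neg hq hx)
        exact ⟨k + 1, by rwa [zpow_add_one₀ hq0, mul_assoc]⟩
      · exact pos x hx
    obtain ⟨k, h1, h2⟩ := main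
    refine ⟨k, fun h => absurd h hq.not_gt, fun _ => ⟨h1, lt_of_le_of_ne h2 fun he => h k ?_⟩⟩
    rw [he, one_pow]
  · have hq1' : q < 1 := lt_of_abs_lt hq1
    obtain ⟨n, h1, h2⟩ := exists_mem_Ioc_zpow (abs_pos.2 hx) ((one_lt_inv₀ hq).2 hq1')
    rw [inv_zpow'] at h1 h2
    have hp : 0 < q ^ (n + 1) := zpow_pos hq _
    refine ⟨n + 1, fun _ => ?_, fun h => absurd h hq.not_gt⟩
    have e : |q ^ (n + 1) * x| = q ^ (n + 1) * |x| := by rw [abs_mul, abs_of_pos hp]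
    constructor
    · rw [e]
      calc q = q ^ (n + 1) * q ^ (-n) := by rw [← zpow_add₀ hq.ne']; simp
        _ < _ := by gcongr
    · refine lt_of_le_of_ne ?_ fun he => h (n + 1) ?_
      · rw [e]
        calc q ^ (n + 1) * |x| ≤ q ^ (n + 1) * q ^ (-(n + 1)) := by gcongr
          _ = 1 := by rw [← zpow_add₀ hq.ne']; simp
      · rw [← sq_abs, he, one_pow]

/-! ### Curves isomorphic to a Tate curve -/

theorem re_log_neg {q : ℝ} (hq0 : q ≠ 0) (hq1 : |q| < 1) : (log (q : ℂ)).re < 0 := by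
  rw [log_re, norm_real, Real.norm_eq_abs]
  exact Real.log_neg (abs_pos.2 hq0) hq1

theorem ofReal_unit_ne_zero (c : ℝˣ) : ((c : ℝ) : ℂ) ≠ 0 := by exact_mod_cast c.ne_zero

theorem scale_lattice_eq {E : WeierstrassCurve ℝ} {L : PeriodPair} (hL : IsPeriodLattice E L)
    {C : WeierstrassCurve.VariableChange ℝ} {q : ℝ} (hC : C • E = tateCurve q) {ℓ : ℂ}
    (hℓ : ℓ.re < 0) (hq : exp ℓ = q) :
    (scale L ((C.u : ℝ) : ℂ) (ofReal_unit_ne_zero _)).lattice = (tatePair ℓ hℓ).lattice := by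
  have h4 := E.variableChange_c₄ C
  have h6 := E.variableChange_c₆ C
  rw [hC] at h4 h6
  apply lattice_eq_of_invariants_eq
  · rw [g₂_scale, hL.1, g₂_tatePair hℓ hq, h4]
    push_cast
    ring
  · rw [g₃_scale, hL.2, g₃_tatePair hℓ hq, h6]
    push_cast
    ring

theorem mem_lattice_iff_of_scale {L M : PeriodPair} {c : ℂ} {hc : c ≠ 0}
    (h : (scale L c hc).lattice = M.lattice) {z : ℂ} : c * z ∈ M.lattice ↔ z ∈ L.lattice := by
  rw [← h, mul_mem_scale]

theorem weierstrassP_of_scale {L M : PeriodPair} {c : ℂ} {hc : c ≠ 0}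
    (h : (scale L c hc).lattice = M.lattice) (z : ℂ) :
    L.weierstrassP z = c ^ 2 * M.weierstrassP (c * z) := by
  rw [← weierstrassP_congr h, weierstrassP_scale, mul_inv_cancel_left₀ (pow_ne_zero 2 hc)]

theorem derivWeierstrassP_of_scale {L M : PeriodPair} {c : ℂ} {hc : c ≠ 0}
    (h : (scale L c hc).lattice = M.lattice) (z : ℂ) :
    L.derivWeierstrassP z = c ^ 3 * M.derivWeierstrassP (c * z) := by
  rw [← derivWeierstrassP_congr h, derivWeierstrassP_scale,
    mul_inv_cancel_left₀ (pow_ne_zero 3 hc)]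

theorem variableChange_tateCurve {E : WeierstrassCurve ℝ} {C : WeierstrassCurve.VariableChange ℝ}
    {q : ℝ} (hC : C • E = tateCurve q) :
    (C.u : ℝ) = E.a₁ + 2 * C.s ∧ E.a₃ + C.r * E.a₁ + 2 * C.t = 0 ∧
      (C.u : ℝ) ^ 2 = E.b₂ + 12 * C.r := by
  have h1 := E.variableChange_a₁ C
  have h3 := E.variableChange_a₃ C
  have hb := E.variableChange_b₂ C
  have hu := C.u.ne_zero
  rw [hC] at h1 h3 hb
  have hb' : (tateCurve q).b₂ = 1 := by simp [WeierstrassCurve.b₂, tateCurve]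
  rw [hb'] at hb
  simp only [tateCurve, Units.val_inv_eq_inv_val] at h1 h3 hb
  refine ⟨?_, ?_, ?_⟩
  · field_simp at h1
    linarith
  · have := (mul_eq_zero.1 h3.symm).resolve_left (by positivity)
    exact this
  · field_simp at hb
    linarith

/-- In the coordinates of the isomorphism with the Tate curve, the analytic parametrization by `z`
agrees with the parametrization of the Tate curve by `e ^ w`, where `w ≡ C.u z`. -/
theorem exists_exp_eq {E : WeierstrassCurve ℝ} {L : PeriodPair} (hL : IsPeriodLattice E L)
    {C : WeierstrassCurve.VariableChange ℝ} {q : ℝ} (hC : C • E = tateCurve q) {ℓ : ℂ}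
    (hℓ : ℓ.re < 0) (hq : exp ℓ = q) {x : ℝ} (hx0 : x ≠ 0) (hx : ∀ m : ℤ, q ^ m * x ≠ 1)
    {z : ℂ} {h} (hz : CorrespondsTo E L z (.some ((C.u : ℝ) ^ 2 * tateX q x + C.r)
      ((C.u : ℝ) ^ 3 * tateY q x + (C.u : ℝ) ^ 2 * C.s * tateX q x + C.t) h)) :
    ∃ k : ℤ, exp ((C.u : ℝ) * z) = ((q ^ k * x : ℝ) : ℂ) := by
  have hs := scale_lattice_eq hL hC hℓ hq
  obtain ⟨h1, h3, hb⟩ := variableChange_tateCurve hC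
  obtain ⟨hzL, hX, hY⟩ := hz
  have hc := ofReal_unit_ne_zero C.u
  have hw : exp (log (x : ℂ)) = x := exp_log (by exact_mod_cast hx0)
  have hwT : log (x : ℂ) ∉ (tatePair ℓ hℓ).lattice := by
    rw [mem_tatePair]
    rintro ⟨m, hm⟩
    rw [exp_add, exp_int_mul, hq, hw] at hm
    exact hx m (by exact_mod_cast hm)
  have hzT : ((C.u : ℝ) : ℂ) * z ∉ (tatePair ℓ hℓ).lattice := fun h =>
    hzL ((mem_lattice_iff_of_scale hs).1 h)
  have eX := tateX_eq hwT hq hw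
  have eY := tateY_eq hwT hq hw
  rw [weierstrassP_of_scale hs] at hX
  rw [derivWeierstrassP_of_scale hs] at hY
  have h1' : ((C.u : ℝ) : ℂ) = E.a₁ + 2 * C.s := by exact_mod_cast h1
  have h3' : (E.a₃ + C.r * E.a₁ + 2 * C.t : ℂ) = 0 := by exact_mod_cast h3
  have hb' : ((C.u : ℝ) : ℂ) ^ 2 = E.b₂ + 12 * C.r := by exact_mod_cast hb
  push_cast at hX hY
  clear hs
  generalize ((C.u : ℝ) : ℂ) = c at *
  have kX : (tatePair ℓ hℓ).weierstrassP (c * z) = (tatePair ℓ hℓ).weierstrassP (log (x : ℂ)) := by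
    apply mul_left_cancel₀ (pow_ne_zero 2 hc)
    linear_combination -hX + c ^ 2 * eX - hb' / 12
  have kY : (tatePair ℓ hℓ).derivWeierstrassP (c * z) =
      (tatePair ℓ hℓ).derivWeierstrassP (log (x : ℂ)) := by
    apply mul_left_cancel₀ (pow_ne_zero 3 hc)
    linear_combination -2 * hY + c ^ 3 * eY + h3' - c ^ 2 * tateX q x * h1'
  have := sub_mem_lattice_of_weierstrassP_eq hzT hwT kX kY
  obtain ⟨m, hm⟩ := mem_tatePair.1 this
  refine ⟨-m, ?_⟩
  have e : c * z = (m * ℓ + (c * z - log (x : ℂ))) + (-m * ℓ) + log (x : ℂ) := by ring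
  rw [e, exp_add, exp_add, hm, hw]
  have := exp_int_mul ℓ (-m)
  push_cast at this
  rw [this, hq]
  push_cast
  ring

/-- The invariants are real, and a lattice is determined by its invariants. -/
theorem conj_mem_lattice {E : WeierstrassCurve ℝ} {L : PeriodPair} (hL : IsPeriodLattice E L) :
    (conjPair L).lattice = L.lattice := by
  apply lattice_eq_of_invariants_eq
  · rw [g₂_conj, hL.1]
    simp [map_ofNat]
  · rw [g₃_conj, hL.2]
    simp [map_ofNat]

theorem exists_variableChange {E : WeierstrassCurve ℝ} {L : PeriodPair} (hL : IsPeriodLattice E L) :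
    ∃ (ℓ : ℂ) (_ : ℓ.re < 0) (q : ℝ) (C : WeierstrassCurve.VariableChange ℝ),
      exp ℓ = q ∧ C • E = tateCurve q := by
  obtain ⟨ℓ, hℓ, q, c, hq, hc, hlat⟩ := exists_tatePair_of_conj (L := L) fun z hz => by
    rwa [← mem_conjPair, conj_mem_lattice hL]
  have hc' : ((c⁻¹ : ℝ) : ℂ) ≠ 0 := by exact_mod_cast inv_ne_zero hc
  have hs : (scale L ((c⁻¹ : ℝ) : ℂ) hc').lattice = (tatePair ℓ hℓ).lattice := by
    ext z
    rw [mem_scale, ← hlat]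
    push_cast
    rw [div_inv_eq_mul, mul_comm]
  have hG := G_congr hs
  have e2 : (scale L ((c⁻¹ : ℝ) : ℂ) hc').g₂ = (tatePair ℓ hℓ).g₂ := by rw [g₂, g₂, hG]
  have e3 : (scale L ((c⁻¹ : ℝ) : ℂ) hc').g₃ = (tatePair ℓ hℓ).g₃ := by rw [g₃, g₃, hG]
  rw [g₂_scale, hL.1, g₂_tatePair hℓ hq] at e2
  rw [g₃_scale, hL.2, g₃_tatePair hℓ hq] at e3
  set U : ℝˣ := (Units.mk0 c hc)⁻¹ with hU
  have hUv : (U : ℝ) = c⁻¹ := by simp [hU]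
  have hUi : ((U⁻¹ : ℝˣ) : ℝ) = c := by simp [hU]
  have e4 : (tateCurve q).c₄ = c ^ 4 * E.c₄ := by
    have : (((tateCurve q).c₄ : ℝ) : ℂ) = ((c ^ 4 * E.c₄ : ℝ) : ℂ) := by
      push_cast at e2 ⊢
      field_simp at e2
      linear_combination -e2
    exact_mod_cast this
  have e6 : (tateCurve q).c₆ = c ^ 6 * E.c₆ := by
    have : (((tateCurve q).c₆ : ℝ) : ℂ) = ((c ^ 6 * E.c₆ : ℝ) : ℂ) := by
      push_cast at e3 ⊢
      field_simp at e3
      linear_combination -e3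
    exact_mod_cast this
  -- The values of `s`, `r` and the last entry of `C` are forced by `a₁ = 1`, `a₂ = 0`, `a₃ = 0`
  -- after the change of variables; `c₄` and `c₆` then determine `a₄` and `a₆`.
  set s := (c⁻¹ - E.a₁) / 2 with hs'
  set r := (s ^ 2 + s * E.a₁ - E.a₂) / 3 with hr
  set C : WeierstrassCurve.VariableChange ℝ := ⟨U, r, s, -(E.a₃ + r * E.a₁) / 2⟩ with hCdef
  have a1 : (C • E).a₁ = 1 := by
    rw [WeierstrassCurve.variableChange_a₁]
    simp only [hCdef, hUi, hs']
    field_simp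
    ring
  have a2 : (C • E).a₂ = 0 := by
    rw [WeierstrassCurve.variableChange_a₂]
    simp only [hCdef, hr]
    ring
  have a3 : (C • E).a₃ = 0 := by
    rw [WeierstrassCurve.variableChange_a₃]
    simp only [hCdef]
    ring
  have c4 : (C • E).c₄ = (tateCurve q).c₄ := by
    rw [WeierstrassCurve.variableChange_c₄, e4]
    simp only [hCdef, hUi]
  have c6 : (C • E).c₆ = (tateCurve q).c₆ := by
    rw [WeierstrassCurve.variableChange_c₆, e6]
    simp only [hCdef, hUi]
  have t1 : (tateCurve q).a₁ = 1 := rfl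
  have t2 : (tateCurve q).a₂ = 0 := rfl
  have t3 : (tateCurve q).a₃ = 0 := rfl
  have a4 : (C • E).a₄ = (tateCurve q).a₄ := by
    simp only [WeierstrassCurve.c₄, WeierstrassCurve.b₂, WeierstrassCurve.b₄, a1, a2, a3, t1, t2,
      t3] at c4
    linarith
  have a6 : (C • E).a₆ = (tateCurve q).a₆ := by
    simp only [WeierstrassCurve.c₆, WeierstrassCurve.b₂, WeierstrassCurve.b₄, WeierstrassCurve.b₆,
      a1, a2, a3, t1, t2, t3, a4] at c6
    linarith
  exact ⟨ℓ, hℓ, q, C, hq, WeierstrassCurve.ext (a1.trans t1.symm) (a2.trans t2.symm)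
    (a3.trans t3.symm) a4 a6⟩

/-- A real point given by `z` with `2 z` not a period is the image of a normalized parameter. -/
theorem exists_normalized_parameter {E : WeierstrassCurve ℝ} {L : PeriodPair}
    (hL : IsPeriodLattice E L) {C : WeierstrassCurve.VariableChange ℝ} {q : ℝ}
    (hC : C • E = tateCurve q) {ℓ : ℂ} (hℓ : ℓ.re < 0) (hq : exp ℓ = q) {z : ℂ}
    (h2z : 2 * z ∉ L.lattice) {P : E.toAffine.Point} (hz : CorrespondsTo E L z P) :
    ∃ x : ℝ, IsNormalized q x ∧ ∃ h, P = .some ((C.u : ℝ) ^ 2 * tateX q x + C.r)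
      ((C.u : ℝ) ^ 3 * tateY q x + (C.u : ℝ) ^ 2 * C.s * tateX q x + C.t) h := by
  have hs := scale_lattice_eq hL hC hℓ hq
  obtain ⟨h1, h3, hb⟩ := variableChange_tateCurve hC
  have hq0 : q ≠ 0 := by
    have := exp_ne_zero ℓ
    rw [hq] at this
    exact_mod_cast this
  have hq1 : |q| < 1 := by
    have := norm_exp_lt_one hℓ
    rwa [hq, norm_real, Real.norm_eq_abs] at this
  have hzL : z ∉ L.lattice := fun h => h2z (by
    have := add_mem h h
    rwa [← two_mul] at this)
  obtain _ | ⟨X, Y, hXY⟩ := P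
  · exact absurd hz hzL
  obtain ⟨-, hX, hY⟩ := hz
  set w : ℂ := ((C.u : ℝ) : ℂ) * z with hw
  -- A real point has `z̄ - z ∈ Λ`, that is `e^{mℓ + w̄ - w} = 1` for some `m`. The exponent has
  -- real part `m Re ℓ`, so `m = 0` and `e^w` is real.
  have hconj : exp w = ((exp w).re : ℂ) := by
    have hcl := conj_mem_lattice hL
    have hzc : (starRingEnd ℂ) z ∉ L.lattice := by
      rwa [← mem_conjPair, hcl]
    have k1 : L.weierstrassP ((starRingEnd ℂ) z) = L.weierstrassP z := by
      rw [← weierstrassP_congr hcl, weierstrassP_conj, weierstrassP_congr hcl]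
      have : L.weierstrassP z = ((X + E.b₂ / 12 : ℝ) : ℂ) := by
        push_cast
        rw [hX]
        ring
      rw [this, conj_ofReal]
    have k2 : L.derivWeierstrassP ((starRingEnd ℂ) z) = L.derivWeierstrassP z := by
      rw [← derivWeierstrassP_congr hcl, derivWeierstrassP_conj, derivWeierstrassP_congr hcl]
      have : L.derivWeierstrassP z = ((2 * Y + E.a₁ * X + E.a₃ : ℝ) : ℂ) := by
        push_cast
        rw [hY]
        ring
      rw [this, conj_ofReal]
    have hd := sub_mem_lattice_of_weierstrassP_eq hzc hzL k1 k2
    rw [← mem_lattice_iff_of_scale hs, mem_tatePair] at hd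
    obtain ⟨m, hm⟩ := hd
    have e : ((C.u : ℝ) : ℂ) * ((starRingEnd ℂ) z - z) = (starRingEnd ℂ) w - w := by
      rw [hw, map_mul, conj_ofReal]
      ring
    rw [e] at hm
    have hn := congrArg norm hm
    rw [norm_exp, norm_one, Real.exp_eq_one_iff] at hn
    have hm0 : m = 0 := by simpa [hℓ.ne] using hn
    rw [hm0, Int.cast_zero, zero_mul, zero_add, exp_sub, exp_conj,
      div_eq_one_iff_eq (exp_ne_zero _)] at hm
    exact (conj_eq_iff_re.1 hm).symm
  set x₀ := (exp w).re
  have hx0 : x₀ ≠ 0 := by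
    intro h
    rw [h] at hconj
    exact exp_ne_zero w (hconj.trans ofReal_zero)
  -- An orbit meeting `±1` would make `2z` a period.
  obtain ⟨k, hk⟩ := exists_isNormalized hq0 hq1 hx0 fun m hm => by
    apply h2z
    rw [← mem_lattice_iff_of_scale hs, mem_tatePair]
    refine ⟨2 * m, ?_⟩
    have : (((2 * m : ℤ) : ℂ) * ℓ + ((C.u : ℝ) : ℂ) * (2 * z)) =
        ((2 : ℕ) : ℂ) * (m * ℓ + w) := by
      rw [hw]
      push_cast
      ring
    rw [this, exp_nat_mul, exp_add, exp_int_mul, hq, hconj]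
    exact_mod_cast hm
  refine ⟨_, hk, ?_⟩
  set x := q ^ k * x₀
  have hl : k * ℓ ∈ (tatePair ℓ hℓ).lattice := mem_tatePair.2 ⟨-k, by simp⟩
  have hwx : exp (w + k * ℓ) = x := by
    rw [exp_add, exp_int_mul, hq, hconj, mul_comm, ofReal_mul, ofReal_zpow]
  have hwT : w + k * ℓ ∉ (tatePair ℓ hℓ).lattice := fun h => by
    have := sub_mem h hl
    rw [add_sub_cancel_right, mem_lattice_iff_of_scale hs] at this
    exact hzL this
  have eX := tateX_eq hwT hq hwx
  have eY := tateY_eq hwT hq hwx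
  rw [(tatePair ℓ hℓ).weierstrassP_add_coe w ⟨_, hl⟩] at eX
  rw [(tatePair ℓ hℓ).derivWeierstrassP_add_coe w ⟨_, hl⟩] at eY
  rw [weierstrassP_of_scale hs] at hX
  rw [derivWeierstrassP_of_scale hs] at hY
  have h1' : ((C.u : ℝ) : ℂ) = E.a₁ + 2 * C.s := by exact_mod_cast h1
  have h3' : (E.a₃ + C.r * E.a₁ + 2 * C.t : ℂ) = 0 := by exact_mod_cast h3
  have hb' : ((C.u : ℝ) : ℂ) ^ 2 = E.b₂ + 12 * C.r := by exact_mod_cast hb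
  have kX : X = (C.u : ℝ) ^ 2 * tateX q x + C.r := by
    have : (X : ℂ) = (((C.u : ℝ) ^ 2 * tateX q x + C.r : ℝ) : ℂ) := by
      push_cast
      linear_combination hX - ((C.u : ℝ) : ℂ) ^ 2 * eX + hb' / 12
    exact_mod_cast this
  have kY : Y = (C.u : ℝ) ^ 3 * tateY q x + (C.u : ℝ) ^ 2 * C.s * tateX q x + C.t := by
    have kX' : (X : ℂ) = ((C.u : ℝ) : ℂ) ^ 2 * tateX q x + C.r := by exact_mod_cast kX
    have : (Y : ℂ) =
        (((C.u : ℝ) ^ 3 * tateY q x + (C.u : ℝ) ^ 2 * C.s * tateX q x + C.t : ℝ) : ℂ) := by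
      push_cast
      linear_combination hY - ((C.u : ℝ) : ℂ) ^ 3 * eY / 2 - h3' / 2 - E.a₁ / 2 * kX' +
        ((C.u : ℝ) : ℂ) ^ 2 * tateX q x * h1' / 2
    exact_mod_cast this
  subst kX kY
  exact ⟨hXY, rfl⟩

/-! ### Quadratic functions -/

/-- A nowhere vanishing multiplicatively quadratic function with values in a field. -/
def IsQuad {M K : Type*} [AddCommGroup M] [Field K] (f : M → K) : Prop :=
  (∀ v, f v ≠ 0) ∧ ∀ a b c, f (a + b + c) * f a * f b * f c = f (a + b) * f (b + c) * f (c + a)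

/-- An additively quadratic function with integral values. -/
def IsQuadInt {M : Type*} [AddCommGroup M] (Q : M → ℤ) : Prop :=
  ∀ a b c, Q (a + b + c) + Q a + Q b + Q c = Q (a + b) + Q (b + c) + Q (c + a)

section Quadratic

variable {M K ι : Type*} [AddCommGroup M] [Field K]

theorem IsQuad.mul {f g : M → K} (hf : IsQuad f) (hg : IsQuad g) : IsQuad fun v => f v * g v := by
  refine ⟨fun v => mul_ne_zero (hf.1 v) (hg.1 v), fun a b c => ?_⟩
  have h1 := hf.2 a b c
  have h2 := hg.2 a b c
  calc _ = (f (a + b + c) * f a * f b * f c) * (g (a + b + c) * g a * g b * g c) := by ring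
    _ = (f (a + b) * f (b + c) * f (c + a)) * (g (a + b) * g (b + c) * g (c + a)) := by rw [h1, h2]
    _ = _ := by ring

theorem IsQuad.inv {f : M → K} (hf : IsQuad f) : IsQuad fun v => (f v)⁻¹ := by
  refine ⟨fun v => inv_ne_zero (hf.1 v), fun a b c => ?_⟩
  simp only [← mul_inv, hf.2 a b c]

theorem isQuad_one : IsQuad fun _ : M => (1 : K) := ⟨fun _ => one_ne_zero, by simp⟩

theorem isQuad_prod (s : Finset ι) {f : ι → M → K} (hf : ∀ i, IsQuad (f i)) :
    IsQuad fun v => ∏ i ∈ s, f i v := by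
  classical
  induction s using Finset.induction_on with
  | empty => simpa using isQuad_one
  | insert i s hi ih => simpa [Finset.prod_insert hi] using (hf i).mul ih

theorem isQuad_zpow {g : K} (hg : g ≠ 0) {Q : M → ℤ} (hQ : IsQuadInt Q) :
    IsQuad fun v => g ^ Q v := by
  refine ⟨fun v => zpow_ne_zero _ hg, fun a b c => ?_⟩
  simp only [← zpow_add₀ hg, hQ a b c]

theorem isQuad_cexp {S : M → ℂ} (hS : ∀ a b, S (a + b) = S a + S b) (α β : ℂ) :
    IsQuad fun v => exp (α * S v ^ 2 + β * S v) := by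
  refine ⟨fun v => exp_ne_zero _, fun a b c => ?_⟩
  simp only [← exp_add, hS]
  congr 1
  ring

theorem IsQuad.map_zero {f : M → K} (hf : IsQuad f) : f 0 = 1 := by
  have h := hf.2 0 0 0
  simp only [add_zero] at h
  have h0 := hf.1 0
  exact mul_left_cancel₀ (mul_ne_zero (mul_ne_zero h0 h0) h0) (by rw [h, mul_one])

theorem IsQuad.isQuadraticForm {n : ℕ} {f : (Fin n → ℤ) → ℝ} (hf : IsQuad f) :
    IsQuadraticForm fun v => Units.mk0 (f v) (hf.1 v) := by
  intro a b c
  ext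
  simp only [Units.val_mul, Units.val_inv_eq_inv_val, Units.val_mk0, Units.val_one]
  have h := hf.2 a b c
  have h1 := hf.1 (a + b)
  have h2 := hf.1 (b + c)
  have h3 := hf.1 (c + a)
  field_simp
  exact h

theorem isQuad_of_isQuadraticForm {n : ℕ} {f : (Fin n → ℤ) → ℝˣ} (hf : IsQuadraticForm f) :
    IsQuad fun v => ((f v : ℝ) : ℂ) := by
  refine ⟨fun v => ofReal_unit_ne_zero _, fun a b c => ?_⟩
  have h := congrArg Units.val (hf a b c)
  simp only [Units.val_mul, Units.val_inv_eq_inv_val, Units.val_one] at h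
  have h1 := (f (a + b)).ne_zero
  have h2 := (f (b + c)).ne_zero
  have h3 := (f (c + a)).ne_zero
  field_simp at h
  beta_reduce
  exact_mod_cast h

theorem isQuadInt_mul {A B : M → ℤ} (hA : ∀ a b, A (a + b) = A a + A b)
    (hB : ∀ a b, B (a + b) = B a + B b) : IsQuadInt fun v => A v * B v := by
  intro a b c
  simp only [hA, hB]
  ring

theorem isQuadInt_tri {A : M → ℤ} (hA : ∀ a b, A (a + b) = A a + A b) :
    IsQuadInt fun v => tri (A v) := by
  intro a b c
  simp only [hA]
  exact tri_quadratic _ _ _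

theorem isQuadInt_of_add {A : M → ℤ} (hA : ∀ a b, A (a + b) = A a + A b) : IsQuadInt A := by
  intro a b c
  simp only [hA]
  ring

theorem IsQuadInt.neg {Q : M → ℤ} (hQ : IsQuadInt Q) : IsQuadInt fun v => -Q v := by
  intro a b c
  linear_combination -hQ a b c

theorem IsQuadInt.add {P Q : M → ℤ} (hP : IsQuadInt P) (hQ : IsQuadInt Q) :
    IsQuadInt fun v => P v + Q v := by
  intro a b c
  linear_combination hP a b c + hQ a b c

theorem isQuadInt_sum (s : Finset ι) {Q : ι → M → ℤ} (hQ : ∀ i, IsQuadInt (Q i)) :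
    IsQuadInt fun v => ∑ i ∈ s, Q i v := by
  intro a b c
  simp only [← Finset.sum_add_distrib, hQ _ a b c]

end Quadratic

/-! ### The net of a curve in terms of the theta function -/

theorem isQuadInt_coord_mul {n : ℕ} (i j : Fin n) :
    IsQuadInt fun v : Fin n → ℤ => v i * v j :=
  isQuadInt_mul (fun _ _ => rfl) fun _ _ => rfl

theorem neg_one_zpow_signExponent {n : ℕ} :
    ∃ F : (Fin n → ℤ) → ℂ, IsQuad F ∧ ∀ v, (-1) ^ signExponent v = -F v := by
  refine ⟨_, isQuad_zpow (K := ℂ) (neg_ne_zero.2 one_ne_zero)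
    (Q := fun v : Fin n → ℤ => ∑ i, v i * v i + -∑ i, ∑ j ∈ Finset.Ioi i, v i * v j)
    ((isQuadInt_sum _ fun i => isQuadInt_coord_mul i i).add
      (isQuadInt_sum _ fun i => isQuadInt_sum _ fun j => isQuadInt_coord_mul i j).neg),
    fun v => ?_⟩
  rw [signExponent, zpow_sub_one₀ (neg_ne_zero.2 one_ne_zero)]
  simp only [pow_two, ← sub_eq_add_neg]
  norm_num

theorem isQuad_denominator {n : ℕ} {s : Fin n → ℂ} {t : Fin n → Fin n → ℂ} (hs : ∀ i, s i ≠ 0)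
    (ht : ∀ i j, i < j → t i j ≠ 0) :
    IsQuad fun v : Fin n → ℤ => (∏ i, s i ^ (2 * v i ^ 2 - ∑ j, v i * v j)) *
      ∏ i, ∏ j ∈ Finset.Ioi i, t i j ^ (v i * v j) := by
  refine (isQuad_prod _ fun i => isQuad_zpow (hs i) ?_).mul ?_
  · intro a b c
    simp only [Pi.add_apply, ← Finset.mul_sum, Finset.sum_add_distrib]
    ring
  -- Values of `t` off `i < j` may vanish and do not enter the product; `1` replaces them so that
  -- all factors can be treated alike.
  · have h : IsQuad fun v : Fin n → ℤ => ∏ i, ∏ j ∈ Finset.Ioi i,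
        (if i < j then t i j else 1) ^ (v i * v j) :=
      isQuad_prod _ fun i => isQuad_prod _ fun j => isQuad_zpow (by
        split_ifs with hij
        · exact ht i j hij
        · exact one_ne_zero) (isQuadInt_coord_mul i j)
    convert h using 5 with v i _ j hj
    rw [if_pos (Finset.mem_Ioi.1 hj)]

/-- The monomial `∏ uᵢ ^ vᵢ`. -/
def monomial {n : ℕ} {K : Type*} [Field K] (u : Fin n → K) (v : Fin n → ℤ) : K := ∏ i, u i ^ v i

/-- Changing the representatives of the `uᵢ` modulo `q^ℤ` costs only a quadratic form, so the
analytic coordinates `e^{Czᵢ}` may be exchanged for normalized parameters. -/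
theorem theta_monomial {n : ℕ} {q : ℝ} (hq0 : q ≠ 0) (hq1 : |q| < 1) {u : Fin n → ℝ}
    (hu : ∀ i, u i ≠ 0) (k : Fin n → ℤ) : ∃ F : (Fin n → ℤ) → ℂ, IsQuad F ∧
      ∀ v, (theta q (monomial (fun i => q ^ k i * u i) v) : ℂ) =
        F v * (theta q (monomial u v) : ℂ) := by
  have hK : ∀ a b : Fin n → ℤ, ∑ i, k i * (a + b) i = ∑ i, k i * a i + ∑ i, k i * b i :=
    fun a b => by simp only [Pi.add_apply, mul_add, Finset.sum_add_distrib]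
  have hq' : (q : ℂ) ≠ 0 := by exact_mod_cast hq0
  have hu' : ∀ i, (u i : ℂ) ≠ 0 := fun i => by exact_mod_cast hu i
  refine ⟨fun v => (-1) ^ (∑ i, k i * v i) * (q : ℂ) ^ (-tri (∑ i, k i * v i)) *
    ∏ i, (u i : ℂ) ^ (v i * -(∑ i, k i * v i)),
    ((isQuad_zpow (neg_ne_zero.2 one_ne_zero) (isQuadInt_of_add hK)).mul
      (isQuad_zpow hq' (isQuadInt_tri hK).neg)).mul
      (isQuad_prod _ fun i => isQuad_zpow (hu' i) (isQuadInt_mul (fun _ _ => rfl) fun a b => by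
        rw [hK, neg_add])), fun v => ?_⟩
  have e : monomial (fun i => q ^ k i * u i) v = q ^ (∑ i, k i * v i) * monomial u v := by
    simp only [monomial, mul_zpow, Finset.prod_mul_distrib, ← zpow_mul]
    congr 1
    induction (Finset.univ : Finset (Fin n)) using Finset.induction_on with
    | empty => simp
    | insert i s hi ih => rw [Finset.prod_insert hi, Finset.sum_insert hi, ih, zpow_add₀ hq0]
  have hx : monomial u v ≠ 0 := Finset.prod_ne_zero_iff.2 fun i _ => zpow_ne_zero _ (hu i)
  have hp : monomial u v ^ (-∑ i, k i * v i) = ∏ i, u i ^ (v i * -∑ i, k i * v i) := by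
    rw [monomial, ← Finset.prod_zpow]
    simp only [← zpow_mul]
  rw [e, theta_zpow_mul hq0 hq1 hx, hp]
  push_cast
  ring

theorem cexp_sum_eq_monomial {n : ℕ} (c : ℂ) (z : Fin n → ℂ) (v : Fin n → ℤ) :
    exp (c * ∑ i, (v i : ℂ) * z i) = monomial (fun i => exp (c * z i)) v := by
  simp only [monomial, ← exp_int_mul, ← exp_sum, Finset.mul_sum]
  congr 1
  exact Finset.sum_congr rfl fun i _ => by ring

theorem sum_stdVec {n : ℕ} (z : Fin n → ℂ) (i : Fin n) :
    ∑ j, ((stdVec i j : ℤ) : ℂ) * z j = z i := by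
  rw [Finset.sum_eq_single i] <;> simp +contextual [stdVec]

theorem Omega_eq_zero {n : ℕ} {L : PeriodPair} {z : Fin n → ℂ} {v : Fin n → ℤ}
    (h : ∑ i, (v i : ℂ) * z i ∈ L.lattice) : Omega L z v = 0 := by
  rw [Omega, sigma_eq_zero h, mul_zero, zero_div]

/-- A net associated with the image of a Tate curve is, up to a complex constant and a complex
quadratic function, a theta function of a monomial. -/
theorem exists_theta_form {n : ℕ} {W : (Fin n → ℤ) → ℝ}
    (hnd : IsNondegenerate W) {E : WeierstrassCurve ℝ} {L : PeriodPair} {z : Fin n → ℂ}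
    {f : (Fin n → ℤ) → ℝˣ} (hL : IsPeriodLattice E L) (hf : IsQuadraticForm f)
    (hW : ∀ v, (W v : ℂ) = ((f v : ℝ) : ℂ) * Omega L z v) {q : ℝ} (hq0 : q ≠ 0) (hq1 : |q| < 1)
    {u : Fin n → ℝ} (hu : ∀ i, IsNormalized q (u i)) {C : WeierstrassCurve.VariableChange ℝ}
    (hC : C • E = tateCurve q)
    (hz : ∀ i, ∃ h, CorrespondsTo E L (z i) (.some ((C.u : ℝ) ^ 2 * tateX q (u i) + C.r)
      ((C.u : ℝ) ^ 3 * tateY q (u i) + (C.u : ℝ) ^ 2 * C.s * tateX q (u i) + C.t) h)) :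
    ∃ (κ : ℂ) (F : (Fin n → ℤ) → ℂ), IsQuad F ∧
      ∀ v, (W v : ℂ) = κ * F v * (theta q (monomial u v) : ℂ) := by
  have hℓ := re_log_neg hq0 hq1
  have hq : exp (log (q : ℂ)) = q := exp_log (by exact_mod_cast hq0)
  have hs := scale_lattice_eq hL hC hℓ hq
  have hu0 : ∀ i, u i ≠ 0 := fun i => (hu i).ne_zero hq0
  have hk : ∀ i, ∃ k : ℤ, exp (((C.u : ℝ) : ℂ) * z i) = ((q ^ k * u i : ℝ) : ℂ) := fun i => by
    obtain ⟨h, hzi⟩ := hz i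
    exact exists_exp_eq hL hC hℓ hq (hu0 i) ((hu i).zpow_mul_ne_one hq0 hq1) hzi
  choose k hk using hk
  obtain ⟨a, b, c₀, -, hσ⟩ := exists_sigma_tatePair_eq hℓ
  obtain ⟨F₁, hF₁, hsign⟩ := neg_one_zpow_signExponent (n := n)
  obtain ⟨F₂, hF₂, htheta⟩ := theta_monomial hq0 hq1 hu0 k
  set c : ℂ := ((C.u : ℝ) : ℂ) with hc
  have hc0 : c ≠ 0 := ofReal_unit_ne_zero _
  -- `σ` vanishes on the lattice, so nonzero values of `W` keep the arguments off it. At `eᵢ` and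
  -- `eᵢ + eⱼ` this makes the denominator of `Omega` a quadratic form without zeros.
  have hnz : ∀ v, W v ≠ 0 → ∑ i, (v i : ℂ) * z i ∉ L.lattice := fun v hv h => hv (by
    have := hW v
    rw [Omega_eq_zero h, mul_zero] at this
    exact_mod_cast this)
  have hD := isQuad_denominator (n := n) (s := fun i => sigma L (z i))
    (t := fun i j => sigma L (z i + z j))
    (fun i => sigma_ne_zero (by simpa [sum_stdVec] using hnz _ (hnd.1 i).1))
    (fun i j hij => sigma_ne_zero (by
      have := hnz _ (hnd.2.1 i j hij.ne).1
      simpa [add_mul, Finset.sum_add_distrib, sum_stdVec] using this))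
  obtain ⟨S, hS⟩ : ∃ S : (Fin n → ℤ) → ℂ, ∀ v, S v = c * ∑ i, (v i : ℂ) * z i :=
    ⟨_, fun _ => rfl⟩
  have hSadd : ∀ x y, S (x + y) = S x + S y := fun x y => by
    simp only [hS, Pi.add_apply, Int.cast_add, add_mul, Finset.sum_add_distrib, mul_add]
  have hσL : ∀ v : Fin n → ℤ, sigma L (∑ i, (v i : ℂ) * z i) =
      c⁻¹ * sigma (tatePair _ hℓ) (c * ∑ i, (v i : ℂ) * z i) := fun v => by
    rw [← sigma_congr hs, sigma_scale, inv_mul_cancel_left₀ hc0]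
  have hexp : ∀ v, exp (c * ∑ i, (v i : ℂ) * z i) =
      ((monomial (fun i => q ^ k i * u i) v : ℝ) : ℂ) := fun v => by
    rw [cexp_sum_eq_monomial]
    simp only [monomial, hk]
    push_cast
    rfl
  obtain ⟨D, hDdef⟩ : ∃ D : (Fin n → ℤ) → ℂ, D = fun v =>
      (∏ i, sigma L (z i) ^ (2 * v i ^ 2 - ∑ j, v i * v j)) *
      ∏ i, ∏ j ∈ Finset.Ioi i, sigma L (z i + z j) ^ (v i * v j) := ⟨_, rfl⟩
  rw [← hDdef] at hD
  have hΩ : ∀ v, Omega L z v = (-1) ^ signExponent v * sigma L (∑ i, (v i : ℂ) * z i) / D v :=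
    fun v => by rw [hDdef, Omega]
  refine ⟨-c⁻¹ * c₀, fun v => ((f v : ℝ) : ℂ) * F₁ v * exp (a * S v ^ 2 + b * S v) * (D v)⁻¹ * F₂ v,
    ((((isQuad_of_isQuadraticForm hf).mul hF₁).mul (isQuad_cexp hSadd a b)).mul hD.inv).mul hF₂, fun v => ?_⟩
  rw [hW, hΩ, hσL, hσ, ← theta_eq_thetaExp hq1 hq (hexp v), htheta, hsign, ← hS]
  ring

/-- In the situation of a real net, the constant and the quadratic function are real. -/
theorem exists_real_form {n : ℕ} [NeZero n] {W θ : (Fin n → ℤ) → ℝ} {κ : ℂ} {F : (Fin n → ℤ) → ℂ}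
    (hF : IsQuad F) (h : ∀ v, (W v : ℂ) = κ * F v * (θ v : ℂ)) (hne : ∀ v, v ≠ 0 → W v ≠ 0) :
    ∃ (κ' : ℝ) (F' : (Fin n → ℤ) → ℝ), κ' ≠ 0 ∧ IsQuad F' ∧
      ∀ v, W v = κ' * F' v * θ v := by
  have hθ' : ∀ v, v ≠ 0 → (θ v : ℂ) ≠ 0 := fun v hv ht => hne v hv (by
    have := h v
    rw [ht, mul_zero] at this
    exact_mod_cast this)
  have hH : ∀ v, v ≠ 0 → κ * F v = ((W v / θ v : ℝ) : ℂ) := fun v hv => by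
    push_cast
    rw [h v, mul_div_cancel_right₀ _ (hθ' v hv)]
  set e : Fin n → ℤ := stdVec 0 with he
  have hm : ∀ m : ℤ, m ≠ 0 → m • e ≠ 0 := fun m hm h => hm (by
    have := congrFun h 0
    simpa [he, stdVec] using this)
  have he0 : e ≠ 0 := by simpa using hm 1 one_ne_zero
  have e1 := hH e he0
  have e2 := hH _ (hm 2 two_ne_zero)
  have e3 := hH _ (hm 3 three_ne_zero)
  have hquad := hF.2 e e e
  have d2 : e + e = (2 : ℤ) • e := by rw [two_smul]
  have d3 : e + e + e = (3 : ℤ) • e := by rw [d2, ← add_one_zsmul]; norm_num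
  rw [d3, d2] at hquad
  have hκ0 : κ ≠ 0 := by
    rintro rfl
    have := h e
    rw [zero_mul, zero_mul] at this
    exact hne e he0 (by exact_mod_cast this)
  -- Quadraticity gives `F(3e)F(e)³ = F(2e)³`, so this combination of the real numbers `κF(e)`,
  -- `κF(2e)`, `κF(3e)` is `κ⁴/κ³ = κ`.
  have hκ : κ = ((W ((3 : ℤ) • e) / θ ((3 : ℤ) • e) * (W e / θ e) ^ 3 /
      (W ((2 : ℤ) • e) / θ ((2 : ℤ) • e)) ^ 3 : ℝ) : ℂ) := by
    have hF2 := hF.1 ((2 : ℤ) • e)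
    have : ∀ x y z : ℝ, ((x * y ^ 3 / z ^ 3 : ℝ) : ℂ) = (x : ℂ) * (y : ℂ) ^ 3 / (z : ℂ) ^ 3 := by
      intro x y z
      push_cast
      rfl
    rw [this, ← e1, ← e2, ← e3, eq_div_iff (by positivity)]
    linear_combination (-κ ^ 4) * hquad
  generalize W ((3 : ℤ) • e) / θ ((3 : ℤ) • e) * (W e / θ e) ^ 3 /
      (W ((2 : ℤ) • e) / θ ((2 : ℤ) • e)) ^ 3 = κ' at hκ
  subst hκ
  have hF' : ∀ v, ∃ r : ℝ, F v = r := by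
    intro v
    by_cases hv : v = 0
    · exact ⟨1, by rw [hv, hF.map_zero, ofReal_one]⟩
    · exact ⟨W v / θ v / κ', by rw [ofReal_div, ← hH v hv, mul_div_cancel_left₀ _ hκ0]⟩
  choose G hG using hF'
  obtain rfl : F = fun v => (G v : ℂ) := funext hG
  refine ⟨κ', G, by exact_mod_cast hκ0, ⟨fun v => ?_, fun a b c => ?_⟩, fun v => ?_⟩
  · have := hF.1 v
    beta_reduce at this
    exact_mod_cast this
  · have := hF.2 a b c
    beta_reduce at this
    exact_mod_cast this
  · have := h v
    beta_reduce at this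
    exact_mod_cast this

/-! ### Parities -/

theorem parity_eq_of_nonneg {m : ℤ} {x : ℝ} (hx : x ≠ 0) (h : 0 ≤ (-1) ^ m * x) :
    parity x = (m : ZMod 2) := by
  unfold parity
  rcases Int.even_or_odd m with hm | hm
  · rw [hm.neg_one_zpow, one_mul] at h
    rw [if_neg (not_lt.2 h), (ZMod.intCast_zmod_eq_zero_iff_dvd m 2).2 hm.two_dvd]
  · rw [hm.neg_one_zpow] at h
    have hlt : x < 0 := lt_of_le_of_ne (by linarith) hx
    obtain ⟨j, rfl⟩ := hm
    rw [if_pos hlt]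
    push_cast
    rw [show (2 : ZMod 2) = 0 from rfl, zero_mul, zero_add]

/-- Turns the non-quadratic exponent `⌊v/2⌋` of the theorem into the quadratic exponent `v(v -
1)/2`, which a twist of the net can supply. -/
theorem tri_cast (v : ℤ) : ((tri v : ℤ) : ZMod 2) = ((⌊(v : ℚ) / 2⌋ : ℤ) : ZMod 2) := by
  have hfl : ⌊(v : ℚ) / 2⌋ = v / 2 := by
    have := Rat.floor_intCast_div_natCast v 2
    simpa using this
  rw [hfl, ZMod.intCast_eq_intCast_iff_dvd_sub]
  have h := two_mul_tri v
  rcases Int.even_or_odd' v with ⟨j, hj | hj⟩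
  · have : tri v = j * (2 * j - 1) := by
      subst hj
      have : 2 * tri (2 * j) = 2 * (j * (2 * j - 1)) := by rw [h]; ring
      omega
    have h2 : v / 2 = j := by omega
    rw [this, h2]
    exact ⟨j - j ^ 2, by push_cast; ring⟩
  · have : tri v = j * (2 * j + 1) := by
      subst hj
      have : 2 * tri (2 * j + 1) = 2 * (j * (2 * j + 1)) := by rw [h]; ring
      omega
    have h2 : v / 2 = j := by omega
    rw [this, h2]
    exact ⟨-j ^ 2, by push_cast; ring⟩

/-! ### Signs of monomials -/

theorem signPeriod_pos {q : ℝ} (hq0 : q ≠ 0) : 0 < signPeriod q := by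
  unfold signPeriod
  split_ifs with h
  · exact h
  · positivity

theorem signPeriod_rpow_beta {q u : ℝ} (hq0 : q ≠ 0) (hq1 : |q| < 1) (hu : IsNormalized q u) :
    signPeriod q ^ beta q u = |u| := by
  have hu0 := hu.ne_zero hq0
  unfold signPeriod beta
  split_ifs with h
  · exact Real.rpow_logb h (lt_of_abs_lt hq1).ne (abs_pos.2 hu0)
  · have hq : q < 0 := lt_of_le_of_ne (not_lt.1 h) hq0
    have hup : 0 < u := lt_of_le_of_lt (sq_nonneg q) (hu.2 hq).1
    rw [← sq_abs, ← Real.rpow_natCast, ← Real.rpow_mul (abs_nonneg q), abs_of_pos hup]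
    rw [show ((2 : ℕ) : ℝ) * (1 / 2 * Real.logb |q| u) = Real.logb |q| u by push_cast; ring]
    exact Real.rpow_logb (abs_pos.2 hq0) hq1.ne hup

theorem abs_monomial {n : ℕ} {q : ℝ} (hq0 : q ≠ 0) (hq1 : |q| < 1) {u : Fin n → ℝ}
    (hu : ∀ i, IsNormalized q (u i)) (v : Fin n → ℤ) :
    |monomial u v| = signPeriod q ^ (∑ i, (v i : ℝ) * beta q (u i)) := by
  rw [Real.rpow_sum_of_pos (signPeriod_pos hq0), monomial, Finset.abs_prod]
  refine Finset.prod_congr rfl fun i _ => ?_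
  rw [abs_zpow, ← signPeriod_rpow_beta hq0 hq1 (hu i), ← Real.rpow_mul_intCast
    (signPeriod_pos hq0).le, mul_comm]

theorem monomial_eq_sign_mul {n : ℕ} (u : Fin n → ℝ) (v : Fin n → ℤ) :
    monomial u v = (-1) ^ (∑ i ∈ Finset.univ.filter (fun i => u i < 0), v i) * |monomial u v| := by
  have h : ∀ i, u i ^ v i = (if u i < 0 then (-1) ^ v i else 1) * |u i| ^ v i := fun i => by
    split_ifs with hi
    · rw [abs_of_neg hi, ← mul_zpow, neg_one_mul, neg_neg]
    · rw [abs_of_nonneg (not_lt.1 hi), one_mul]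
  have hp : ∀ s : Finset (Fin n), ∏ i ∈ s, (-1 : ℝ) ^ v i = (-1) ^ ∑ i ∈ s, v i := fun s => by
    induction s using Finset.induction_on with
    | empty => simp
    | insert i s hi ih => rw [Finset.prod_insert hi, Finset.sum_insert hi, ih,
        zpow_add₀ (by norm_num)]
  rw [← hp, monomial, Finset.abs_prod, Finset.prod_filter, ← Finset.prod_mul_distrib]
  refine Finset.prod_congr rfl fun i _ => ?_
  rw [abs_zpow]
  exact h i

theorem irrational_beta {n : ℕ} {q : ℝ} (hq0 : q ≠ 0) (hq1 : |q| < 1) {u : Fin n → ℝ}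
    (hu : ∀ i, IsNormalized q (u i)) (hθ : ∀ v, v ≠ 0 → theta q (monomial u v) ≠ 0) (i : Fin n) :
    Irrational (beta q (u i)) := by
  rintro ⟨r, hr⟩
  -- The denominator makes the exponent integral, and the factor `2` removes the sign of `uᵢ`. The
  -- resulting monomial is an integral power of `q`, a zero of `θ`.
  have hv : ((2 * r.den : ℤ) • stdVec i : Fin n → ℤ) ≠ 0 := fun h => by
    have := congrFun h i
    simp [stdVec] at this
  apply hθ _ hv
  have hmon : monomial u ((2 * r.den : ℤ) • stdVec i) = signPeriod q ^ (2 * r.num) := by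
    have hv2 : monomial u ((2 * r.den : ℤ) • stdVec i) = u i ^ (2 * r.den : ℤ) := by
      rw [monomial, Finset.prod_eq_single i]
      · simp [stdVec]
      · intro j _ hj
        simp [stdVec, hj]
      · simp
    rw [hv2, zpow_mul, zpow_ofNat, ← sq_abs, ← signPeriod_rpow_beta hq0 hq1 (hu i), ← hr,
      zpow_natCast, ← pow_mul, ← Real.rpow_mul_natCast (signPeriod_pos hq0).le,
      ← Real.rpow_intCast]
    congr 1
    push_cast
    have : (r : ℝ) * r.den = r.num := by exact_mod_cast r.mul_den_eq_num
    linear_combination 2 * this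
  rw [hmon]
  unfold signPeriod
  split_ifs
  · exact theta_zpow_eq_zero hq0 hq1 _
  · rw [← zpow_natCast, ← zpow_mul]
    exact theta_zpow_eq_zero hq0 hq1 _

/-- The sign of a theta function of a monomial. -/
theorem theta_monomial_sign {n : ℕ} {q : ℝ} (hq0 : q ≠ 0) (hq1 : |q| < 1) {u : Fin n → ℝ}
    (hu : ∀ i, IsNormalized q (u i)) (v : Fin n → ℤ) :
    (Even (∑ i ∈ Finset.univ.filter (fun i => u i < 0), v i) →
      0 ≤ (-1) ^ ⌊∑ i, (v i : ℝ) * beta q (u i)⌋ * theta q (monomial u v)) ∧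
    (Odd (∑ i ∈ Finset.univ.filter (fun i => u i < 0), v i) → 0 ≤ theta q (monomial u v)) := by
  have h := monomial_eq_sign_mul u v
  constructor
  · intro he
    rw [he.neg_one_zpow, one_mul, abs_monomial hq0 hq1 hu] at h
    rw [h]
    exact theta_rpow_sign hq0 hq1 _
  · intro ho
    rw [ho.neg_one_zpow, abs_monomial hq0 hq1 hu] at h
    -- For `q < 0` every normalized parameter is positive, so the sum over negative ones is empty
    -- and cannot be odd.
    have hq : 0 < q := by
      by_contra hq
      have hq' : q < 0 := lt_of_le_of_ne (not_lt.1 hq) hq0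
      have : Finset.univ.filter (fun i => u i < 0) = ∅ :=
        Finset.filter_eq_empty_iff.2 fun i _ =>
          (lt_of_le_of_lt (sq_nonneg q) ((hu i).2 hq').1).not_gt
      rw [this, Finset.sum_empty] at ho
      exact absurd ho (by decide)
    refine theta_neg_nonneg hq ?_
    rw [h, neg_one_mul, neg_lt_zero]
    exact Real.rpow_pos_of_pos (signPeriod_pos hq0) _

/-! ### The theorem -/

theorem isNormalized_of_isTateData {n : ℕ} {E : WeierstrassCurve ℝ} {P : Fin n → E.toAffine.Point}
    {q : ℝ} {u : Fin n → ℝ} (h : IsTateData E P q u) (i : Fin n) : IsNormalized q (u i) :=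
  ⟨fun hq => h.2.2.2.1 hq i, fun hq => h.2.2.2.2 hq i⟩

theorem exists_isTateData {n : ℕ} {W : (Fin n → ℤ) → ℝ} (hnd : IsNondegenerate W)
    {E : WeierstrassCurve ℝ} {P : Fin n → E.toAffine.Point} (h : IsAssociated W E P) :
    ∃ (q : ℝ) (u : Fin n → ℝ), IsTateData E P q u := by
  obtain ⟨-, -, -, L, z, f, hL, hz, -, hW⟩ := h
  obtain ⟨ℓ, hℓ, q, C, hq, hC⟩ := exists_variableChange hL
  have h2z : ∀ i, 2 * z i ∉ L.lattice := fun i h => (hnd.1 i).2 (by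
    have := hW ((2 : ℤ) • stdVec i)
    rw [Omega_eq_zero (by
      simp only [Pi.smul_apply, smul_eq_mul, Int.cast_mul, mul_assoc, ← Finset.mul_sum, sum_stdVec]
      exact_mod_cast h), mul_zero] at this
    exact_mod_cast this)
  choose u hu hP using fun i => exists_normalized_parameter hL hC hℓ hq (h2z i) (hz i)
  refine ⟨q, u, ?_, ?_, ⟨C, hC, hP⟩, fun hq i => (hu i).1 hq, fun hq i => (hu i).2 hq⟩
  · have := exp_ne_zero ℓ
    rw [hq] at this
    exact abs_pos.2 (by exact_mod_cast this)
  · have := norm_exp_lt_one hℓ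
    rwa [hq, norm_real, Real.norm_eq_abs] at this

theorem exists_real_theta_form {n : ℕ} [NeZero n] {W : (Fin n → ℤ) → ℝ} (hnd : IsNondegenerate W)
    (hne : ∀ v, v ≠ 0 → W v ≠ 0) {E : WeierstrassCurve ℝ} {P : Fin n → E.toAffine.Point} {q : ℝ}
    {u : Fin n → ℝ} (h : IsAssociated W E P) (ht : IsTateData E P q u) :
    ∃ (κ : ℝ) (F : (Fin n → ℤ) → ℝ), κ ≠ 0 ∧ IsQuad F ∧
      ∀ v, W v = κ * F v * theta q (monomial u v) := by
  have hu := isNormalized_of_isTateData ht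
  obtain ⟨-, -, -, L, z, f, hL, hz, hf, hW⟩ := h
  obtain ⟨hq0, hq1, ⟨C, hC, hP⟩, -⟩ := ht
  obtain ⟨κ, F, hF, hκ⟩ := exists_theta_form hnd hL hf hW (abs_pos.1 hq0) hq1 hu hC fun i => by
    obtain ⟨hi, hPi⟩ := hP i
    exact ⟨hi, hPi ▸ hz i⟩
  exact exists_real_form hF hκ hne

theorem exists_sign_twist {n : ℕ} {W : (Fin n → ℤ) → ℝ} {q : ℝ} {u : Fin n → ℝ} (hq0 : q ≠ 0)
    (hq1 : |q| < 1) (hu : ∀ i, IsNormalized q (u i)) {κ : ℝ} {F : (Fin n → ℤ) → ℝ} (hκ : κ ≠ 0)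
    (hF : IsQuad F) (hW : ∀ v, W v = κ * F v * theta q (monomial u v))
    (hθ : ∀ v, v ≠ 0 → theta q (monomial u v) ≠ 0) :
    ∃ (g : (Fin n → ℤ) → ℝˣ) (W' : (Fin n → ℤ) → ℝ), IsQuadraticForm g ∧
      ((∀ v, W' v = (g v : ℝ) * W v) ∨ (∀ v, W' v = -((g v : ℝ) * W v))) ∧
      ∀ v, v ≠ 0 →
        (Even (∑ i ∈ Finset.univ.filter (fun i => u i < 0), v i) →
          parity (W' v) = ((⌊∑ i, (v i : ℝ) * beta q (u i)⌋ +
            ∑ i ∈ Finset.univ.filter (fun i => u i < 0), ⌊(v i : ℚ) / 2⌋ : ℤ) : ZMod 2)) ∧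
        (Odd (∑ i ∈ Finset.univ.filter (fun i => u i < 0), v i) →
          parity (W' v) = ((∑ i ∈ Finset.univ.filter (fun i => u i < 0),
            ⌊(v i : ℚ) / 2⌋ : ℤ) : ZMod 2)) := by
  set T : (Fin n → ℤ) → ℤ := fun v => ∑ i ∈ Finset.univ.filter (fun i => u i < 0), tri (v i)
    with hT
  have hTq : IsQuadInt T := isQuadInt_sum _ fun i => isQuadInt_tri fun _ _ => rfl
  have hg : IsQuad fun v => (F v)⁻¹ * (-1 : ℝ) ^ T v :=
    hF.inv.mul (isQuad_zpow (by norm_num) hTq)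
  have hTc : ∀ v, ((T v : ℤ) : ZMod 2) =
      ((∑ i ∈ Finset.univ.filter (fun i => u i < 0), ⌊(v i : ℚ) / 2⌋ : ℤ) : ZMod 2) := fun v => by
    simp only [hT, Int.cast_sum, tri_cast]
  have hgW : ∀ v, (F v)⁻¹ * (-1 : ℝ) ^ T v * W v =
      κ * ((-1) ^ T v * theta q (monomial u v)) := fun v => by
    have := hF.1 v
    rw [hW]
    field_simp
  -- The twist `g = F⁻¹(-1)^T` leaves `κ(-1)^T θ`; the sign of `κ` decides between `W' = gW` and `W'
  -- = -gW`.
  refine ⟨_, fun v => |κ| * ((-1) ^ T v * theta q (monomial u v)), hg.isQuadraticForm, ?_,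
    fun v hv => ?_⟩
  · simp only [Units.val_mk0, hgW]
    rcases abs_choice κ with h | h
    · exact Or.inl fun v => by rw [h]
    · exact Or.inr fun v => by rw [h, neg_mul]
  · have hsq : (-1 : ℝ) ^ T v * (-1) ^ T v = 1 := by
      rw [← mul_zpow]
      norm_num
    have h1 : (-1 : ℝ) ^ T v ≠ 0 := zpow_ne_zero _ (by norm_num)
    have hne : |κ| * ((-1) ^ T v * theta q (monomial u v)) ≠ 0 :=
      mul_ne_zero (abs_ne_zero.2 hκ) (mul_ne_zero h1 (hθ v hv))
    obtain ⟨he, ho⟩ := theta_monomial_sign hq0 hq1 hu v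
    constructor
    · intro hev
      rw [Int.cast_add, ← hTc, ← Int.cast_add]
      refine parity_eq_of_nonneg hne ?_
      rw [zpow_add₀ (by norm_num)]
      calc (0 : ℝ) ≤ |κ| * ((-1) ^ ⌊∑ i, (v i : ℝ) * beta q (u i)⌋ * theta q (monomial u v)) :=
            mul_nonneg (abs_nonneg _) (he hev)
        _ = _ := by linear_combination (-|κ| * (-1) ^ ⌊∑ i, (v i : ℝ) * beta q (u i)⌋ *
            theta q (monomial u v)) * hsq
    · intro hodd
      rw [← hTc]
      refine parity_eq_of_nonneg hne ?_
      calc (0 : ℝ) ≤ |κ| * theta q (monomial u v) := mul_nonneg (abs_nonneg _) (ho hodd)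
        _ = _ := by linear_combination (-|κ| * theta q (monomial u v)) * hsq

theorem sumFirst_eq {n k : ℕ} {u : Fin n → ℝ} (h1 : ∀ i : Fin n, (i : ℕ) < k → u i < 0)
    (h2 : ∀ i : Fin n, k ≤ (i : ℕ) → 0 < u i) (a : Fin n → ℤ) :
    sumFirst k a = ∑ i ∈ Finset.univ.filter (fun i => u i < 0), a i := by
  unfold sumFirst
  congr 1
  refine Finset.filter_congr fun i _ => ⟨h1 i, fun h => ?_⟩
  by_contra! hk
  exact lt_asymm h (h2 i hk)

end EllipticNetSigns

end


theorem theorem1p5 (n : ℕ) (W : (Fin n → ℤ) → ℝ)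
    (hnet : EllipticNetSigns.IsNet W)
    (hnd : EllipticNetSigns.IsNondegenerate W)
    (hns : EllipticNetSigns.IsNonsingular W)
    (hne : ∀ v, v ≠ 0 → W v ≠ 0) :
    (∃ (E : WeierstrassCurve ℝ) (P : Fin n → E.toAffine.Point) (q : ℝ) (u : Fin n → ℝ),
      EllipticNetSigns.IsAssociated W E P ∧ EllipticNetSigns.IsTateData E P q u) ∧
    ∀ (E : WeierstrassCurve ℝ) (P : Fin n → E.toAffine.Point) (q : ℝ) (u : Fin n → ℝ),
      EllipticNetSigns.IsAssociated W E P → EllipticNetSigns.IsTateData E P q u →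
      (∀ i, Irrational (EllipticNetSigns.beta q (u i))) ∧
      ∃ (g : (Fin n → ℤ) → ℝˣ) (W' : (Fin n → ℤ) → ℝ),
        EllipticNetSigns.IsQuadraticForm g ∧
        ((∀ v, W' v = (g v : ℝ) * W v) ∨ (∀ v, W' v = -((g v : ℝ) * W v))) ∧
        ((∀ i, 0 < u i) → ∀ v, v ≠ 0 →
          EllipticNetSigns.parity (W' v) =
            ((⌊∑ i, (v i : ℝ) * EllipticNetSigns.beta q (u i)⌋ : ℤ) : ZMod 2)) ∧
        (∀ k : ℕ, k ≤ n → (∀ i : Fin n, (i : ℕ) < k → u i < 0) →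
          (∀ i : Fin n, k ≤ (i : ℕ) → 0 < u i) → ∀ v, v ≠ 0 →
          (Even (EllipticNetSigns.sumFirst k v) →
            EllipticNetSigns.parity (W' v) =
              ((⌊∑ i, (v i : ℝ) * EllipticNetSigns.beta q (u i)⌋
                + EllipticNetSigns.sumFirst k (fun i => ⌊(v i : ℚ) / 2⌋) : ℤ) : ZMod 2)) ∧
          (Odd (EllipticNetSigns.sumFirst k v) →
            EllipticNetSigns.parity (W' v) =
              ((EllipticNetSigns.sumFirst k (fun i => ⌊(v i : ℚ) / 2⌋) : ℤ) : ZMod 2))) := by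
  open EllipticNetSigns in
  refine ⟨?_, fun E P q u hA hT => ?_⟩
  · obtain ⟨E, P, hA⟩ := hns
    obtain ⟨q, u, hT⟩ := exists_isTateData hnd hA
    exact ⟨E, P, q, u, hA, hT⟩
  -- For `n = 0` there is no `v ≠ 0`; this case is split off because the reality argument needs a
  -- basis vector.
  · rcases Nat.eq_zero_or_pos n with rfl | hn
    · refine ⟨fun i => i.elim0, 1, W, fun a b c => by simp, Or.inl fun v => by simp,
        fun _ v hv => absurd (Subsingleton.elim v 0) hv,
        fun _ _ _ _ v hv => absurd (Subsingleton.elim v 0) hv⟩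
    · have : NeZero n := ⟨hn.ne'⟩
      have hq0 : q ≠ 0 := abs_pos.1 hT.1
      have hq1 : |q| < 1 := hT.2.1
      have hu := isNormalized_of_isTateData hT
      obtain ⟨κ, F, hκ, hF, hW⟩ := exists_real_theta_form hnd hne hA hT
      have hθ : ∀ v, v ≠ 0 → theta q (monomial u v) ≠ 0 := fun v hv h => hne v hv (by
        rw [hW, h, mul_zero])
      refine ⟨irrational_beta hq0 hq1 hu hθ, ?_⟩
      obtain ⟨g, W', hg, hW', hpar⟩ := exists_sign_twist hq0 hq1 hu hκ hF hW hθ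
      refine ⟨g, W', hg, hW', fun hpos v hv => ?_, fun k _ h1 h2 v hv => ?_⟩
      · have he : Finset.univ.filter (fun i => u i < 0) = ∅ :=
          Finset.filter_eq_empty_iff.2 fun i _ => (hpos i).not_gt
        have := (hpar v hv).1
        simpa [he] using this
      · simp only [sumFirst_eq h1 h2]
        exact hpar v hv
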